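/- **Setting.** Let $n\ge 1$, let the scalar field be $\mathbb{R}$ or $\mathbb{C}$, and let $K\subset\mathbb{R}^n$ be a symmetric convex body, i.e. a compact convex set with non-empty interior and $K=-K$. Let $\|\cdot\|_K$ be the norm with closed unit ball $K$, let $B(x,t)=\{y:\|y-x\|_K\le t\}$ be the corresponding closed balls ("$K$-balls"), let $\mathbb{R}^{n+1}_+=\mathbb{R}^n\times(0,\infty)$ carry Lebesgue measure, and let $\Gamma_x=\{(y,t)\in\mathbb{R}^{n+1}_+:\|x-y\|_K\le t\}$. For $1<p<\infty$ let $p'$ be the conjugate exponent. * $T^p(K)$ is the space of locally integrable $g$ on $\mathbb{R}^{n+1}_+$ with $\|g\|_{T^p(K)}:=\operatorname{ess\,sup}_{x\in\mathbb{R}^n}\|g\|_{L^p(\Gamma_x)}<\infty$. * $V^{p'}(K)$ is the space of $f\in L^{p'}_{\mathrm{loc}}(\mathbb{R}^{n+1}_+)$ with $\|f\|_{V^{p'}(K)}:=\sup_{\|g\|_{T^p(K)}\le 1}\int_{\mathbb{R}^{n+1}_+}|fg|\,dx\,dt<\infty$, and $U^{p'}(K)$, with the same norm, is the closure of $C_c(\mathbb{R}^{n+1}_+)$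 in $V^{p'}(K)$. * $S^1(K)$ is the space of continuous $f$ on $\mathbb{R}^{n+1}_+$ with $\|f\|_{S^1(K)}:=\sup_{\mathcal C}\sum_{B(x,t)\in\mathcal C}|f(x,t)|<\infty$, the supremum being over finite collections $\mathcal C$ of pairwise disjoint $K$-balls, and $S^1_0(K)$, with the same norm, is the closure of $C_c(\mathbb{R}^{n+1}_+)$ in $S^1(K)$. * A $U$-atom is a function of the form $a(x,t)\int_{B(x,t)}g(y)\,dy$ with $\|a\|_{L^{p'}(\mathbb{R}^{n+1}_+)}\le 1$ and $\|g\|_{L^1(\mathbb{R}^n)}=1$. An $S$-atom is a function of the same form with $a\in C_c(\mathbb{R}^{n+1}_+)$, $|a|\le 1$ everywhere, and $\|g\|_{L^1(\mathbb{R}^n)}=1$. **Theorem.** There is a constant $C>0$ depending only on $n$ such that for every symmetric convex body $K\subset\mathbb{R}^n$ the following hold. 1. For every $1<p<\infty$: (a) $U^{p'}(K)$ is a Banach space and $T^p(K)$ is its dual: for $u\in U^{p'}(K)$ and $g\in T^p(K)$ the product $ug$ is integrable, and $g\mapsto\big(u\mapsto\int_{\mathbb{R}^{n+1}_+}u\,g\,dx\,dt\big)$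 is an isometric linear isomorphism of $T^p(K)$ onto $U^{p'}(K)^*$. (b) Every $U$-atom belongs to $U^{p'}(K)$, and a function $f\in L^{p'}_{\mathrm{loc}}(\mathbb{R}^{n+1}_+)$ belongs to $U^{p'}(K)$ if and only if $f=\sum_{i\ge1}\lambda_i f_i$ in $L^{p'}_{\mathrm{loc}}(\mathbb{R}^{n+1}_+)$ for some $U$-atoms $f_i$ and scalars $\lambda_i$ with $\sum_i|\lambda_i|<\infty$. (c) Every $f\in U^{p'}(K)$ can be written as $f=\sum_{i\ge1}\lambda_i f_i$ with $U$-atoms $f_i$ and $\sum_i|\lambda_i|\le C\|f\|_{U^{p'}(K)}$, the series converging in the norm of $U^{p'}(K)$ and in $L^{p'}_{\mathrm{loc}}(\mathbb{R}^{n+1}_+)$; and $\|f\|_{U^{p'}(K)}\le C\sum_i|\lambda_i|$ for every representation $f=\sum_i\lambda_i f_i$ by $U$-atoms that converges in the norm of $U^{p'}(K)$ with $\sum_i|\lambda_i|<\infty$. 2. Every $S$-atom belongs to $S^1_0(K)$. Every $f\in S^1_0(K)$ can be written as $f=\sum_{i\ge1}\lambda_i f_i$ with $S$-atoms $f_i$,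 convergence in the norm of $S^1(K)$ and $\sum_i|\lambda_i|\le C\|f\|_{S^1(K)}$; and $\|f\|_{S^1(K)}\le C\sum_i|\lambda_i|$ for every representation $f=\sum_i\lambda_i f_i$ by $S$-atoms that converges in the norm of $S^1(K)$ with $\sum_i|\lambda_i|<\infty$. -/

import Mathlib

open MeasureTheory Filter Topology
open scoped ENNReal CompactlySupported

noncomputable section

namespace TentDuality

/-- A symmetric convex body in `ℝⁿ`: a compact convex set with non-empty interior which is
symmetric about the origin. -/
structure SymmConvexBody (n : ℕ) extends ConvexBody (EuclideanSpace ℝ (Fin n)) where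
  interior_nonempty' : (interior carrier).Nonempty
  neg_mem' : ∀ x ∈ carrier, -x ∈ carrier

/-- Lebesgue measure on the half-line `(0, ∞)`. -/
instance : MeasureSpace (Set.Ioi (0 : ℝ)) where
  volume := Measure.comap Subtype.val volume

instance : SigmaFinite (volume : Measure (Set.Ioi (0 : ℝ))) := by
  refine (Measure.FiniteSpanningSetsIn.sigmaFinite (C := Set.univ)
    { set := fun k => Subtype.val ⁻¹' spanningSets (volume : Measure ℝ) k
      set_mem := fun _ => Set.mem_univ _
      finite := fun k => ?_
      spanning := by rw [← Set.preimage_iUnion, iUnion_spanningSets, Set.preimage_univ] })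
  change Measure.comap Subtype.val volume _ < ⊤
  rw [(MeasurableEmbedding.subtype_coe measurableSet_Ioi).comap_apply]
  exact (measure_mono (Set.image_preimage_subset _ _)).trans_lt (measure_spanningSets_lt_top _ k)

/-- The open upper half-space `ℝⁿ × (0, ∞)`, with its product topology and Lebesgue measure. -/
abbrev UpperHalf (n : ℕ) : Type := EuclideanSpace ℝ (Fin n) × Set.Ioi (0 : ℝ)

/-- The norm `‖x‖_K` whose closed unit ball is `K`. -/
def SymmConvexBody.kNorm {n : ℕ} (K : SymmConvexBody n) (x : EuclideanSpace ℝ (Fin n)) : ℝ :=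
  gauge K.carrier x

/-- The closed `K`-ball `B(x, t)`, indexed by the point `(x, t)` of the upper half-space. -/
def SymmConvexBody.kBall {n : ℕ} (K : SymmConvexBody n) (z : UpperHalf n) :
    Set (EuclideanSpace ℝ (Fin n)) :=
  {y | K.kNorm (y - z.1) ≤ (z.2 : ℝ)}

/-- The cone `Γ_x` with base `K` and vertex `x`. -/
def SymmConvexBody.cone {n : ℕ} (K : SymmConvexBody n) (x : EuclideanSpace ℝ (Fin n)) :
    Set (UpperHalf n) :=
  {z | K.kNorm (x - z.1) ≤ (z.2 : ℝ)}

theorem SymmConvexBody.carrier_mem_nhds_zero {n : ℕ} (K : SymmConvexBody n) :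
    K.carrier ∈ 𝓝 (0 : EuclideanSpace ℝ (Fin n)) := by
  obtain ⟨x, hx⟩ := K.interior_nonempty'
  have hneg : -x ∈ interior K.carrier := by
    have hopen : IsOpen (Neg.neg ⁻¹' interior K.carrier) := isOpen_interior.preimage continuous_neg
    have hsub : Neg.neg ⁻¹' interior K.carrier ⊆ K.carrier := fun y hy => by
      simpa using K.neg_mem' (-y) (interior_subset hy)
    exact interior_maximal hsub hopen (by simpa using hx)
  have h0 := K.convex'.interior hx hneg (a := 1 / 2) (b := 1 / 2)
    (by norm_num) (by norm_num) (by norm_num)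
  rw [smul_neg, add_neg_cancel] at h0
  exact mem_interior_iff_mem_nhds.1 h0

theorem SymmConvexBody.continuous_kNorm {n : ℕ} (K : SymmConvexBody n) : Continuous K.kNorm :=
  continuous_gauge K.convex' K.carrier_mem_nhds_zero

/-- A finite, absolutely homogeneous, subadditive, definite `ℝ≥0∞`-valued function gives a norm. -/
theorem core_of_enorm {𝕜 M : Type*} [RCLike 𝕜] [AddCommGroup M] [Module 𝕜 M] [Norm M]
    (N : M → ℝ≥0∞) (hfin : ∀ x, N x ≠ ⊤) (hsmul : ∀ (c : 𝕜) x, N (c • x) = ‖c‖ₑ * N x)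
    (hadd : ∀ x y, N (x + y) ≤ N x + N y) (hzero : ∀ x, N x = 0 → x = 0)
    (hN : ∀ x, ‖x‖ = (N x).toReal) : NormedSpace.Core 𝕜 M where
  norm_nonneg x := by rw [hN]; exact ENNReal.toReal_nonneg
  norm_smul c x := by rw [hN, hN, hsmul, ENNReal.toReal_mul, toReal_enorm]
  norm_triangle x y := by
    rw [hN, hN, hN, ← ENNReal.toReal_add (hfin x) (hfin y)]
    exact ENNReal.toReal_mono (ENNReal.add_ne_top.2 ⟨hfin x, hfin y⟩) (hadd x y)
  norm_eq_zero_iff x := by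
    rw [hN, ENNReal.toReal_eq_zero_iff]
    refine ⟨fun h => hzero x (h.resolve_right (hfin x)), ?_⟩
    rintro rfl
    left
    have := hsmul 0 0
    simpa using this

/-! ### The tent spaces `T^p(K)` -/

/-- `‖A_p f‖_{L^∞(ℝⁿ)}` with `A_p f (x) = ‖f‖_{L^p(Γ_x)}`, as an extended number. -/
def tentENorm {𝕜 : Type*} [RCLike 𝕜] {n : ℕ} (K : SymmConvexBody n) (p : ℝ≥0∞)
    (f : UpperHalf n → 𝕜) : ℝ≥0∞ :=
  essSup (fun x => eLpNorm f p (volume.restrict (K.cone x))) volume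

theorem tentENorm_add_le {𝕜 : Type*} [RCLike 𝕜] {n : ℕ} (K : SymmConvexBody n) {p : ℝ≥0∞}
    (hp : 1 ≤ p) (f g : UpperHalf n →ₘ[volume] 𝕜) :
    tentENorm K p (f + g : UpperHalf n →ₘ[volume] 𝕜) ≤ tentENorm K p f + tentENorm K p g := by
  refine le_trans (essSup_mono_ae (Eventually.of_forall fun x => ?_)) (ENNReal.essSup_add_le _ _)
  simp only [Pi.add_apply]
  rw [eLpNorm_congr_ae (ae_restrict_of_ae (AEEqFun.coeFn_add f g))]
  exact eLpNorm_add_le f.aestronglyMeasurable.restrict g.aestronglyMeasurable.restrict hp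

theorem tentENorm_smul {𝕜 : Type*} [RCLike 𝕜] {n : ℕ} (K : SymmConvexBody n) (p : ℝ≥0∞)
    (c : 𝕜) (f : UpperHalf n →ₘ[volume] 𝕜) :
    tentENorm K p (c • f : UpperHalf n →ₘ[volume] 𝕜) = ‖c‖ₑ * tentENorm K p f := by
  unfold tentENorm
  rw [← ENNReal.essSup_const_mul]
  congr 1
  funext x
  rw [eLpNorm_congr_ae (ae_restrict_of_ae (AEEqFun.coeFn_smul c f)), eLpNorm_const_smul]

theorem eq_zero_of_tentENorm_eq_zero {𝕜 : Type*} [RCLike 𝕜] {n : ℕ} (K : SymmConvexBody n)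
    {p : ℝ≥0∞} (hp : p ≠ 0) (f : UpperHalf n →ₘ[volume] 𝕜) (hf : tentENorm K p f = 0) :
    f = 0 := by
  have hae : ∀ᵐ x : EuclideanSpace ℝ (Fin n), f =ᵐ[volume.restrict (K.cone x)] 0 := by
    filter_upwards [ENNReal.ae_le_essSup
      (fun x => eLpNorm f p (volume.restrict (K.cone x)))] with x hx
    exact (eLpNorm_eq_zero_iff f.aestronglyMeasurable.restrict hp).1 (le_antisymm (hx.trans hf.le)
      zero_le)
  obtain ⟨D, hDs, hDc, hDd⟩ := (Measure.dense_of_ae hae).exists_countable_dense_subset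
  have hcover : ⋃ x ∈ D, K.cone x = Set.univ := by
    refine Set.eq_univ_of_forall fun z => ?_
    have hopen : IsOpen {x | K.kNorm (x - z.1) < (z.2 : ℝ)} :=
      isOpen_lt (K.continuous_kNorm.comp (continuous_id.sub continuous_const)) continuous_const
    obtain ⟨x, hxD, hx⟩ := hDd.exists_mem_open hopen
      ⟨z.1, by
        change gauge K.carrier (z.1 - z.1) < (z.2 : ℝ)
        rw [sub_self, gauge_zero]
        exact z.2.2⟩
    exact Set.mem_biUnion hxD (le_of_lt (show K.kNorm (x - z.1) < (z.2 : ℝ) from hx))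
  have hall : ∀ᵐ z ∂(volume.restrict (⋃ x ∈ D, K.cone x)), f z = 0 :=
    (ae_restrict_biUnion_iff _ hDc _).2 fun x hx => hDs hx
  rw [hcover, Measure.restrict_univ] at hall
  have hall' : (f : UpperHalf n → 𝕜) =ᵐ[volume] 0 := hall
  exact AEEqFun.ext (hall'.trans (AEEqFun.coeFn_zero).symm)

/-- `T^p(K)` as a space of (classes of) locally integrable functions. -/
def tentSubmodule (𝕜 : Type*) [RCLike 𝕜] {n : ℕ} (K : SymmConvexBody n) (p : ℝ≥0∞)
    [Fact (1 ≤ p)] : Submodule 𝕜 (UpperHalf n →ₘ[volume] 𝕜) where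
  carrier := {f | LocallyIntegrable f volume ∧ tentENorm K p f < ⊤}
  zero_mem' := by
    refine ⟨locallyIntegrable_zero.congr (AEEqFun.coeFn_zero).symm, ?_⟩
    have h := tentENorm_smul K p (0 : 𝕜) (0 : UpperHalf n →ₘ[volume] 𝕜)
    rw [show (0 : 𝕜) • (0 : UpperHalf n →ₘ[volume] 𝕜) = 0 from
      zero_smul 𝕜 (0 : UpperHalf n →ₘ[volume] 𝕜), enorm_zero,
      zero_mul] at h
    rw [h]
    exact ENNReal.zero_lt_top
  add_mem' := fun {f g} hf hg =>
    ⟨(hf.1.add hg.1).congr (AEEqFun.coeFn_add f g).symm,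
      (tentENorm_add_le K Fact.out f g).trans_lt (ENNReal.add_lt_top.2 ⟨hf.2, hg.2⟩)⟩
  smul_mem' := fun c f hf =>
    ⟨(hf.1.smul c).congr (AEEqFun.coeFn_smul c f).symm, by
      rw [tentENorm_smul]; exact ENNReal.mul_lt_top enorm_lt_top hf.2⟩

/-- The space `T^p(K)`. -/
def TentSpace (𝕜 : Type*) [RCLike 𝕜] {n : ℕ} (K : SymmConvexBody n) (p : ℝ≥0∞)
    [Fact (1 ≤ p)] : Type _ :=
  tentSubmodule 𝕜 K p

namespace TentSpace

variable {𝕜 : Type*} [RCLike 𝕜] {n : ℕ} {K : SymmConvexBody n} {p : ℝ≥0∞} [Fact (1 ≤ p)]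

instance : AddCommGroup (TentSpace 𝕜 K p) := inferInstanceAs (AddCommGroup (tentSubmodule 𝕜 K p))

instance : Module 𝕜 (TentSpace 𝕜 K p) := inferInstanceAs (Module 𝕜 (tentSubmodule 𝕜 K p))

/-- The class of functions underlying an element of `T^p(K)`. -/
def toFun (f : TentSpace 𝕜 K p) : UpperHalf n →ₘ[volume] 𝕜 := Subtype.val f

/-- `‖f‖_{T^p(K)}`. -/
instance : Norm (TentSpace 𝕜 K p) := ⟨fun f => (tentENorm K p f.toFun).toReal⟩

theorem core : NormedSpace.Core 𝕜 (TentSpace 𝕜 K p) :=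
  core_of_enorm (fun f : TentSpace 𝕜 K p => tentENorm K p f.toFun)
    (fun f => (Subtype.prop f).2.ne)
    (fun c f => tentENorm_smul K p c f.toFun)
    (fun f g => tentENorm_add_le K Fact.out f.toFun g.toFun)
    (fun f hf => Subtype.ext (eq_zero_of_tentENorm_eq_zero K
      (zero_lt_one.trans_le (Fact.out : 1 ≤ p)).ne' f.toFun hf))
    (fun _ => rfl)

instance : NormedAddCommGroup (TentSpace 𝕜 K p) := NormedAddCommGroup.ofCore core

instance : NormedSpace 𝕜 (TentSpace 𝕜 K p) := NormedSpace.ofCore core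

end TentSpace

/-! ### The spaces `V^{p'}(K)` and `U^{p'}(K)` -/

/-- `f ∈ L^q_loc` on the upper half-space. -/
def MemLpLoc {𝕜 : Type*} [RCLike 𝕜] {n : ℕ} (f : UpperHalf n → 𝕜) (q : ℝ≥0∞) : Prop :=
  ∀ O : Set (UpperHalf n), IsCompact O → MemLp f q (volume.restrict O)

/-- Convergence of a sequence in `L^q_loc` on the upper half-space. -/
def TendstoLpLoc {𝕜 : Type*} [RCLike 𝕜] {n : ℕ} (q : ℝ≥0∞) (s : ℕ → UpperHalf n → 𝕜)
    (f : UpperHalf n → 𝕜) : Prop :=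
  ∀ O : Set (UpperHalf n), IsCompact O →
    Tendsto (fun N => eLpNorm (fun z => s N z - f z) q (volume.restrict O)) atTop (𝓝 0)

/-- `sup { ∫ |f g| : ‖g‖_{T^p(K)} ≤ 1 }`, as an extended number. -/
def vENorm {𝕜 : Type*} [RCLike 𝕜] {n : ℕ} (K : SymmConvexBody n) (p : ℝ≥0∞) [Fact (1 ≤ p)]
    (f : UpperHalf n → 𝕜) : ℝ≥0∞ :=
  ⨆ (g : TentSpace 𝕜 K p) (_ : ‖g‖ ≤ 1), ∫⁻ z, ‖f z * g.toFun z‖ₑ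

theorem aemeasurable_enorm_mul {𝕜 : Type*} [RCLike 𝕜] {n : ℕ}
    (f g : UpperHalf n →ₘ[volume] 𝕜) :
    AEMeasurable (fun z => ‖f z * g z‖ₑ) (volume : Measure (UpperHalf n)) :=
  (f.aestronglyMeasurable.mul g.aestronglyMeasurable).enorm

theorem vENorm_add_le {𝕜 : Type*} [RCLike 𝕜] {n : ℕ} (K : SymmConvexBody n) (p : ℝ≥0∞)
    [Fact (1 ≤ p)] (f h : UpperHalf n →ₘ[volume] 𝕜) :
    vENorm K p (f + h : UpperHalf n →ₘ[volume] 𝕜) ≤ vENorm K p f + vENorm K p h := by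
  refine iSup₂_le fun g hg => ?_
  have key : ∫⁻ z, ‖(f + h : UpperHalf n →ₘ[volume] 𝕜) z * g.toFun z‖ₑ ≤
      (∫⁻ z, ‖f z * g.toFun z‖ₑ) + ∫⁻ z, ‖h z * g.toFun z‖ₑ := by
    rw [← lintegral_add_left'
      (aemeasurable_enorm_mul f g.toFun)]
    refine lintegral_mono_ae ?_
    filter_upwards [AEEqFun.coeFn_add f h] with z hz
    rw [hz, Pi.add_apply, add_mul]
    exact enorm_add_le _ _
  refine key.trans (add_le_add ?_ ?_)
  · exact le_iSup₂ (f := fun (g : TentSpace 𝕜 K p) (_ : ‖g‖ ≤ 1) => ∫⁻ z, ‖f z * g.toFun z‖ₑ) g hg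
  · exact le_iSup₂ (f := fun (g : TentSpace 𝕜 K p) (_ : ‖g‖ ≤ 1) => ∫⁻ z, ‖h z * g.toFun z‖ₑ) g hg

theorem vENorm_smul {𝕜 : Type*} [RCLike 𝕜] {n : ℕ} (K : SymmConvexBody n) (p : ℝ≥0∞)
    [Fact (1 ≤ p)] (c : 𝕜) (f : UpperHalf n →ₘ[volume] 𝕜) :
    vENorm K p (c • f : UpperHalf n →ₘ[volume] 𝕜) = ‖c‖ₑ * vENorm K p f := by
  unfold vENorm
  simp only [ENNReal.mul_iSup]
  refine iSup_congr fun g => iSup_congr fun _ => ?_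
  rw [← lintegral_const_mul'' _
    (aemeasurable_enorm_mul f g.toFun)]
  refine lintegral_congr_ae ?_
  filter_upwards [AEEqFun.coeFn_smul c f] with z hz
  rw [hz, Pi.smul_apply, smul_eq_mul, mul_assoc, enorm_mul]

theorem lintegral_mul_eq_zero_of_vENorm {𝕜 : Type*} [RCLike 𝕜] {n : ℕ} (K : SymmConvexBody n)
    (p : ℝ≥0∞) [Fact (1 ≤ p)] (f : UpperHalf n →ₘ[volume] 𝕜) (hf : vENorm K p f = 0)
    (g : TentSpace 𝕜 K p) : ∫⁻ z, ‖f z * g.toFun z‖ₑ = 0 := by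
  set c : 𝕜 := (((‖g‖ + 1)⁻¹ : ℝ) : 𝕜) with hc
  have hpos : 0 < ‖g‖ + 1 := by positivity
  have hc0 : c ≠ 0 := by
    rw [hc]
    exact_mod_cast (inv_pos.2 hpos).ne'
  have hle : ‖c • g‖ ≤ 1 := by
    rw [norm_smul, hc, RCLike.norm_ofReal, abs_of_pos (inv_pos.2 hpos), inv_mul_le_iff₀ hpos]
    linarith
  have h1 : ∫⁻ z, ‖f z * (c • g).toFun z‖ₑ = 0 :=
    le_antisymm ((le_iSup₂ (f := fun (g : TentSpace 𝕜 K p) (_ : ‖g‖ ≤ 1) =>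
      ∫⁻ z, ‖f z * g.toFun z‖ₑ) (c • g) hle).trans hf.le) zero_le
  have h2 : ∫⁻ z, ‖f z * (c • g).toFun z‖ₑ = ‖c‖ₑ * ∫⁻ z, ‖f z * g.toFun z‖ₑ := by
    rw [← lintegral_const_mul'' _
      (aemeasurable_enorm_mul f g.toFun)]
    refine lintegral_congr_ae ?_
    filter_upwards [AEEqFun.coeFn_smul c g.toFun] with z hz
    have hz' : (c • g).toFun z = c * g.toFun z := hz
    rw [hz', mul_left_comm, enorm_mul]
  rw [h2] at h1
  exact (mul_eq_zero.1 h1).resolve_left (by simpa using hc0)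

theorem eq_zero_of_vENorm_eq_zero {𝕜 : Type*} [RCLike 𝕜] {n : ℕ} (K : SymmConvexBody n)
    (p : ℝ≥0∞) [Fact (1 ≤ p)] (f : UpperHalf n →ₘ[volume] 𝕜) (hf : vENorm K p f = 0) :
    f = 0 := by
  have hs : ∀ s : Set (UpperHalf n), MeasurableSet s → volume s < ⊤ →
      ∀ᵐ z ∂(volume.restrict s), f z = 0 := by
    intro s hsm hsf
    have hmem : ∀ r : ℝ≥0∞, MemLp (s.indicator fun _ => (1 : 𝕜)) r volume :=
      fun r => memLp_indicator_const r hsm 1 (Or.inr hsf.ne)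
    have hcoe := AEEqFun.coeFn_mk (μ := (volume : Measure (UpperHalf n)))
      (s.indicator fun _ => (1 : 𝕜)) (hmem 1).aestronglyMeasurable
    let g : TentSpace 𝕜 K p := ⟨AEEqFun.mk _ (hmem 1).aestronglyMeasurable, by
      refine ⟨(memLp_one_iff_integrable.1 (hmem 1)).locallyIntegrable.congr hcoe.symm, ?_⟩
      refine lt_of_le_of_lt (essSup_le_of_ae_le (eLpNorm (s.indicator fun _ => (1 : 𝕜)) p volume)
        (Eventually.of_forall fun x => ?_)) (hmem p).eLpNorm_lt_top
      simp only
      rw [eLpNorm_congr_ae (ae_restrict_of_ae hcoe)]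
      exact eLpNorm_mono_measure _ Measure.restrict_le_self⟩
    have h0 := lintegral_mul_eq_zero_of_vENorm K p f hf g
    rw [lintegral_eq_zero_iff'
      (aemeasurable_enorm_mul f g.toFun)] at h0
    rw [ae_restrict_iff' hsm]
    filter_upwards [h0, hcoe] with z hz hz2 hzs
    have hg1 : g.toFun z = 1 := by
      refine Eq.trans hz2 ?_
      simp [hzs]
    simpa [hg1] using hz
  have hall : ∀ᵐ z ∂(volume.restrict (⋃ i, spanningSets (volume : Measure (UpperHalf n)) i)),
      f z = 0 :=
    (ae_restrict_iUnion_iff _ _).2 fun i =>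
      hs _ (measurableSet_spanningSets _ i) (measure_spanningSets_lt_top _ i)
  rw [iUnion_spanningSets, Measure.restrict_univ] at hall
  have hall' : (f : UpperHalf n → 𝕜) =ᵐ[volume] 0 := hall
  exact AEEqFun.ext (hall'.trans (AEEqFun.coeFn_zero).symm)

/-- `V^{p'}(K)` as a space of (classes of) functions in `L^{p'}_loc`, `p'` the conjugate
exponent of `p`. -/
def vSubmodule (𝕜 : Type*) [RCLike 𝕜] {n : ℕ} (K : SymmConvexBody n) (p : ℝ≥0∞)
    [Fact (1 ≤ p)] : Submodule 𝕜 (UpperHalf n →ₘ[volume] 𝕜) where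
  carrier := {f | MemLpLoc f p.conjExponent ∧ vENorm K p f < ⊤}
  zero_mem' := by
    refine ⟨fun O _ => MemLp.zero.ae_eq (ae_restrict_of_ae (AEEqFun.coeFn_zero).symm), ?_⟩
    have h := vENorm_smul K p (0 : 𝕜) (0 : UpperHalf n →ₘ[volume] 𝕜)
    rw [show (0 : 𝕜) • (0 : UpperHalf n →ₘ[volume] 𝕜) = 0 from
      zero_smul 𝕜 (0 : UpperHalf n →ₘ[volume] 𝕜), enorm_zero,
      zero_mul] at h
    rw [h]
    exact ENNReal.zero_lt_top
  add_mem' := fun {f g} hf hg =>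
    ⟨fun O hO => ((hf.1 O hO).add (hg.1 O hO)).ae_eq
        (ae_restrict_of_ae (AEEqFun.coeFn_add f g).symm),
      (vENorm_add_le K p f g).trans_lt (ENNReal.add_lt_top.2 ⟨hf.2, hg.2⟩)⟩
  smul_mem' := fun c f hf =>
    ⟨fun O hO => ((hf.1 O hO).const_smul c).ae_eq
        (ae_restrict_of_ae (AEEqFun.coeFn_smul c f).symm), by
      rw [vENorm_smul]; exact ENNReal.mul_lt_top enorm_lt_top hf.2⟩

/-- The space `V^{p'}(K)`. -/
def VSpace (𝕜 : Type*) [RCLike 𝕜] {n : ℕ} (K : SymmConvexBody n) (p : ℝ≥0∞)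
    [Fact (1 ≤ p)] : Type _ :=
  vSubmodule 𝕜 K p

namespace VSpace

variable {𝕜 : Type*} [RCLike 𝕜] {n : ℕ} {K : SymmConvexBody n} {p : ℝ≥0∞} [Fact (1 ≤ p)]

instance : AddCommGroup (VSpace 𝕜 K p) := inferInstanceAs (AddCommGroup (vSubmodule 𝕜 K p))

instance : Module 𝕜 (VSpace 𝕜 K p) := inferInstanceAs (Module 𝕜 (vSubmodule 𝕜 K p))

/-- The class of functions underlying an element of `V^{p'}(K)`. -/
def toFun (f : VSpace 𝕜 K p) : UpperHalf n →ₘ[volume] 𝕜 := Subtype.val f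

/-- `‖f‖_{V^{p'}(K)}`. -/
instance : Norm (VSpace 𝕜 K p) := ⟨fun f => (vENorm K p f.toFun).toReal⟩

theorem core : NormedSpace.Core 𝕜 (VSpace 𝕜 K p) :=
  core_of_enorm (fun f : VSpace 𝕜 K p => vENorm K p f.toFun)
    (fun f => (Subtype.prop f).2.ne)
    (fun c f => vENorm_smul K p c f.toFun)
    (fun f g => vENorm_add_le K p f.toFun g.toFun)
    (fun f hf => Subtype.ext (eq_zero_of_vENorm_eq_zero K p f.toFun hf))
    (fun _ => rfl)

instance : NormedAddCommGroup (VSpace 𝕜 K p) := NormedAddCommGroup.ofCore core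

instance : NormedSpace 𝕜 (VSpace 𝕜 K p) := NormedSpace.ofCore core

end VSpace

/-- The elements of `V^{p'}(K)` represented by a continuous function with compact support. -/
def vCc (𝕜 : Type*) [RCLike 𝕜] {n : ℕ} (K : SymmConvexBody n) (p : ℝ≥0∞) [Fact (1 ≤ p)] :
    Submodule 𝕜 (VSpace 𝕜 K p) where
  carrier := {f | ∃ φ : C_c(UpperHalf n, 𝕜), f.toFun =ᵐ[volume] φ}
  zero_mem' := ⟨0, AEEqFun.coeFn_zero⟩
  add_mem' := by
    rintro f g ⟨φ, hφ⟩ ⟨ψ, hψ⟩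
    exact ⟨φ + ψ, (AEEqFun.coeFn_add f.toFun g.toFun).trans (hφ.add hψ)⟩
  smul_mem' := by
    rintro c f ⟨φ, hφ⟩
    exact ⟨c • φ, (AEEqFun.coeFn_smul c f.toFun).trans (hφ.const_smul c)⟩

/-- `U^{p'}(K)`, the closure of `C_c` in `V^{p'}(K)`, with the norm of `V^{p'}(K)`. -/
abbrev USpace (𝕜 : Type*) [RCLike 𝕜] {n : ℕ} (K : SymmConvexBody n) (p : ℝ≥0∞)
    [Fact (1 ≤ p)] : Submodule 𝕜 (VSpace 𝕜 K p) :=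
  (vCc 𝕜 K p).topologicalClosure

/-! ### The spaces `S¹(K)` and `S¹₀(K)` -/

/-- `sup_C ∑_{B ∈ C} |f_B|` over finite collections `C` of pairwise disjoint `K`-balls, as an
extended number. -/
def sENorm {𝕜 : Type*} [RCLike 𝕜] {n : ℕ} (K : SymmConvexBody n) (f : UpperHalf n → 𝕜) : ℝ≥0∞ :=
  ⨆ (C : Finset (UpperHalf n)) (_ : (C : Set (UpperHalf n)).PairwiseDisjoint K.kBall),
    ∑ z ∈ C, ‖f z‖ₑ

theorem sENorm_add_le {𝕜 : Type*} [RCLike 𝕜] {n : ℕ} (K : SymmConvexBody n)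
    (f g : UpperHalf n → 𝕜) : sENorm K (f + g) ≤ sENorm K f + sENorm K g := by
  refine iSup₂_le fun C hC => ?_
  calc ∑ z ∈ C, ‖(f + g) z‖ₑ ≤ ∑ z ∈ C, (‖f z‖ₑ + ‖g z‖ₑ) :=
        Finset.sum_le_sum fun z _ => enorm_add_le _ _
    _ = (∑ z ∈ C, ‖f z‖ₑ) + ∑ z ∈ C, ‖g z‖ₑ := Finset.sum_add_distrib
    _ ≤ sENorm K f + sENorm K g := add_le_add
        (le_iSup₂ (f := fun (C : Finset (UpperHalf n))
          (_ : (C : Set (UpperHalf n)).PairwiseDisjoint K.kBall) => ∑ z ∈ C, ‖f z‖ₑ) C hC)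
        (le_iSup₂ (f := fun (C : Finset (UpperHalf n))
          (_ : (C : Set (UpperHalf n)).PairwiseDisjoint K.kBall) => ∑ z ∈ C, ‖g z‖ₑ) C hC)

theorem sENorm_smul {𝕜 : Type*} [RCLike 𝕜] {n : ℕ} (K : SymmConvexBody n) (c : 𝕜)
    (f : UpperHalf n → 𝕜) : sENorm K (c • f) = ‖c‖ₑ * sENorm K f := by
  simp only [sENorm, ENNReal.mul_iSup, Finset.mul_sum, Pi.smul_apply, smul_eq_mul, enorm_mul]

theorem enorm_le_sENorm {𝕜 : Type*} [RCLike 𝕜] {n : ℕ} (K : SymmConvexBody n)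
    (f : UpperHalf n → 𝕜) (z : UpperHalf n) : ‖f z‖ₑ ≤ sENorm K f := by
  have h := le_iSup₂ (f := fun (C : Finset (UpperHalf n))
    (_ : (C : Set (UpperHalf n)).PairwiseDisjoint K.kBall) => ∑ z ∈ C, ‖f z‖ₑ) {z}
    (by rw [Finset.coe_singleton]; exact Set.pairwiseDisjoint_singleton _ _)
  rw [Finset.sum_singleton] at h
  exact h

/-- `S¹(K)` as a space of continuous functions. -/
def sSubmodule (𝕜 : Type*) [RCLike 𝕜] {n : ℕ} (K : SymmConvexBody n) :
    Submodule 𝕜 C(UpperHalf n, 𝕜) where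
  carrier := {f | sENorm K f < ⊤}
  zero_mem' := by simp [sENorm]
  add_mem' := fun {f g} hf hg =>
    (sENorm_add_le K f g).trans_lt (ENNReal.add_lt_top.2 ⟨hf, hg⟩)
  smul_mem' := fun c f hf => by
    have h := sENorm_smul K c f
    exact h.trans_lt (ENNReal.mul_lt_top enorm_lt_top hf)

/-- The space `S¹(K)`. -/
def SSpace (𝕜 : Type*) [RCLike 𝕜] {n : ℕ} (K : SymmConvexBody n) : Type _ :=
  sSubmodule 𝕜 K

namespace SSpace

variable {𝕜 : Type*} [RCLike 𝕜] {n : ℕ} {K : SymmConvexBody n}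

instance : AddCommGroup (SSpace 𝕜 K) := inferInstanceAs (AddCommGroup (sSubmodule 𝕜 K))

instance : Module 𝕜 (SSpace 𝕜 K) := inferInstanceAs (Module 𝕜 (sSubmodule 𝕜 K))

/-- The continuous function underlying an element of `S¹(K)`. -/
def toFun (f : SSpace 𝕜 K) : C(UpperHalf n, 𝕜) := Subtype.val f

/-- `‖f‖_{S¹(K)}`. -/
instance : Norm (SSpace 𝕜 K) := ⟨fun f => (sENorm K f.toFun).toReal⟩

theorem core : NormedSpace.Core 𝕜 (SSpace 𝕜 K) :=
  core_of_enorm (fun f : SSpace 𝕜 K => sENorm K f.toFun)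
    (fun f => (Subtype.prop f).ne)
    (fun c f => sENorm_smul K c f.toFun)
    (fun f g => sENorm_add_le K f.toFun g.toFun)
    (fun f hf => Subtype.ext (ContinuousMap.ext fun z => by
      have h := (enorm_le_sENorm K f.toFun z).trans hf.le
      exact enorm_eq_zero.1 (le_antisymm h zero_le)))
    (fun _ => rfl)

instance : NormedAddCommGroup (SSpace 𝕜 K) := NormedAddCommGroup.ofCore core

instance : NormedSpace 𝕜 (SSpace 𝕜 K) := NormedSpace.ofCore core

end SSpace

/-- The elements of `S¹(K)` with compact support, that is, `C_c` as a subspace of `S¹(K)`. -/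
def sCc (𝕜 : Type*) [RCLike 𝕜] {n : ℕ} (K : SymmConvexBody n) : Submodule 𝕜 (SSpace 𝕜 K) where
  carrier := {f | HasCompactSupport f.toFun}
  zero_mem' := HasCompactSupport.zero
  add_mem' := fun {_ _} hf hg => HasCompactSupport.add hf hg
  smul_mem' := fun c _ hf => HasCompactSupport.smul_left (f := fun _ => c) hf

/-- `S¹₀(K)`, the closure of `C_c` in `S¹(K)`, with the norm of `S¹(K)`. -/
abbrev S0Space (𝕜 : Type*) [RCLike 𝕜] {n : ℕ} (K : SymmConvexBody n) :
    Submodule 𝕜 (SSpace 𝕜 K) :=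
  (sCc 𝕜 K).topologicalClosure

/-! ### Atoms -/

/-- The function `(x, t) ↦ a(x, t) ∫_{B(x,t)} g`. -/
def atomFun {𝕜 : Type*} [RCLike 𝕜] {n : ℕ} (K : SymmConvexBody n) (a : UpperHalf n → 𝕜)
    (g : EuclideanSpace ℝ (Fin n) → 𝕜) (z : UpperHalf n) : 𝕜 :=
  a z * ∫ y in K.kBall z, g y

/-- `‖g‖_{L¹(ℝⁿ)} = 1`. -/
def HasL1NormOne {𝕜 : Type*} [RCLike 𝕜] {n : ℕ} (g : EuclideanSpace ℝ (Fin n) → 𝕜) : Prop :=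
  Integrable g ∧ ∫ y, ‖g y‖ = 1

/-- `F` is an atom with profile `a` in the unit ball of `L^q` of the upper half-space. -/
def IsLqAtom {𝕜 : Type*} [RCLike 𝕜] {n : ℕ} (K : SymmConvexBody n) (q : ℝ≥0∞)
    (F : UpperHalf n → 𝕜) : Prop :=
  ∃ (a : UpperHalf n → 𝕜) (g : EuclideanSpace ℝ (Fin n) → 𝕜),
    MemLp a q volume ∧ eLpNorm a q volume ≤ 1 ∧ HasL1NormOne g ∧ F =ᵐ[volume] atomFun K a g

/-- `F` is an atom with profile `a` continuous, compactly supported and bounded by `1`. -/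
def IsCcAtom {𝕜 : Type*} [RCLike 𝕜] {n : ℕ} (K : SymmConvexBody n)
    (F : UpperHalf n → 𝕜) : Prop :=
  ∃ (a : C_c(UpperHalf n, 𝕜)) (g : EuclideanSpace ℝ (Fin n) → 𝕜),
    (∀ z, ‖a z‖ ≤ 1) ∧ HasL1NormOne g ∧ ∀ z, F z = atomFun K a g z

end TentDuality

end

open MeasureTheory Filter Topology TentDuality
open scoped ENNReal

/-!
Write `P g (x, t) = ∫_{B(x,t)} g`, so that atoms are the functions `a · P g`, and let `q` be the
exponent conjugate to `p`. Spheres of `K` are null, so `P g` is continuous for integrable `g`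
(`SymmConvexBody.continuous_ballIntegral`); for a fixed positive integrable weight `g₀` it is also
nowhere zero (`decayIntegral`).

*The spaces `U` and `T`.* Tonelli's theorem and Hölder's inequality on each cone give
`∫ |a · P g · h| ≤ ‖g‖₁ ‖a‖_q ‖h‖_T` (`lintegral_atom_mul_le`), so atoms have `V`-norm at most one.
As `P g` is continuous, `C_c` profiles give functions in `C_c`, and density of `C_c` in `L^q` puts all
atoms into `U` (`VSpace.atom_mem`). Conversely each `φ ∈ C_c` is `(φ / P g₀) · P g₀`, so the functions
`a · P g₀` with `a ∈ L^q` are dense in `U`. A functional `ℓ` on `U` therefore amounts to the functional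
`a ↦ ℓ (a · P g₀)` on `L^q`, which is integration against some `G`
(`exists_measurable_repr_lpDual`, by Radon–Nikodym), and `h = G / P g₀` represents `ℓ`. Testing
against atoms with `g` concentrating at a point `y` and letting Fatou's lemma produce the indicator of
the cone at `y` shows that the tent norm of `h` is at most the supremum of `|ℓ|` over atoms
(`tentENorm_le_of_dual`). Hence `T^p = U^*` isometrically (`TentSpace.dualEquiv`), and atoms norm the
dual. By the Hahn–Banach theorem their closed convex hull is the unit ball of `U`, and iterating the
resulting approximations gives the atomic decomposition with constant `2`
(`exists_finite_approx_of_norming`, `exists_hasSum_of_approx`). Completeness comes from the contractive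
embedding of `V` in `L^q`, itself the converse of Hölder's inequality, and Fatou's lemma.

*The space `S¹₀`.* Every `f ∈ C_c` is a single multiple of an atom: it suffices to find `g` with
`|f| ≤ P g` and `‖g‖₁ ≤ (6ⁿ + 1) ‖f‖_S`, for then `f = (f / P g) · P g`
(`exists_dominating_ballIntegral`). On a finite net of the support, the local ratio method for weighted
packings (`exists_local_ratio`), processing balls by increasing radius, gives weights of total mass at
most `‖f‖_S` such that the value of `f` at a ball is at most the sum of the weights of the no larger
balls that meet it. A ball that meets a no larger ball contains a fixed proportion of the threefold
dilate of the latter, so spreading each weight over that dilate gives `g` on the net, and a small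
multiple of `g₀` absorbs the oscillation of `f` between net points.
-/

open MeasureTheory Filter Topology TentDuality
open scoped ENNReal

/-! ### Series decompositions in normed spaces -/

/-- If every vector `u` is within `‖u‖ / 2` of a finite combination of elements of a bounded set
`A` with coefficients of total mass at most `C ‖u‖`, then iterating the approximation gives a series
that converges to `u`. The space need not be complete. -/
theorem exists_hasSum_of_approx {𝕜 E : Type*} [RCLike 𝕜] [NormedAddCommGroup E] [NormedSpace 𝕜 E]
    {A : Set E} {C : ℝ} (hA : ∀ a ∈ A, ‖a‖ ≤ 1)
    (happrox : ∀ u : E, ∃ (m : ℕ) (c : Fin (m + 1) → 𝕜) (a : Fin (m + 1) → E),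
      (∀ i, a i ∈ A) ∧ ∑ i, ‖c i‖ ≤ C * ‖u‖ ∧ ‖u - ∑ i, c i • a i‖ ≤ ‖u‖ / 2) (u : E) :
    ∃ (lam : ℕ → 𝕜) (F : ℕ → E), (∀ i, F i ∈ A) ∧ Summable (fun i => ‖lam i‖) ∧
      HasSum (fun i => lam i • F i) u ∧ ∑' i, ‖lam i‖ ≤ 2 * C * ‖u‖ := by
  choose m c a hmem hsum herr using happrox
  let r : ℕ → E := fun k => (fun v => v - ∑ i, c v i • a v i)^[k] u
  have hr0 : r 0 = u := rfl
  have hrs : ∀ k, r (k + 1) = r k - ∑ i, c (r k) i • a (r k) i := fun k =>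
    Function.iterate_succ_apply' _ _ _
  have hr : ∀ k, ‖r k‖ ≤ ‖u‖ * (1 / 2) ^ k := by
    intro k
    induction k with
    | zero => simp [hr0]
    | succ k ih =>
      rw [hrs]
      refine (herr _).trans ?_
      rw [pow_succ]
      linarith
  let ι := Σ k : ℕ, Fin (m (r k) + 1)
  let lam' : ι → 𝕜 := fun x => c (r x.1) x.2
  let F' : ι → E := fun x => a (r x.1) x.2
  have hC : 0 ≤ C * ‖u‖ := le_trans (Finset.sum_nonneg fun _ _ => norm_nonneg _) (hsum u)
  have hinner : ∀ k, ∑ i, ‖c (r k) i‖ ≤ C * ‖u‖ * (1 / 2) ^ k := by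
    intro k
    rcases eq_or_ne u 0 with rfl | hu
    · have : r k = 0 := by simpa using hr k
      refine (hsum _).trans ?_
      simp [this]
    · have hC' : 0 ≤ C := nonneg_of_mul_nonneg_left hC (norm_pos_iff.2 hu)
      calc _ ≤ C * ‖r k‖ := hsum _
        _ ≤ C * (‖u‖ * (1 / 2) ^ k) := mul_le_mul_of_nonneg_left (hr k) hC'
        _ = _ := by ring
  have hgeo : HasSum (fun k : ℕ => C * ‖u‖ * (1 / 2 : ℝ) ^ k) (C * ‖u‖ * 2) :=
    hasSum_geometric_two.mul_left _
  have hsummable : Summable (fun k => ∑ i, ‖c (r k) i‖) :=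
    Summable.of_nonneg_of_le (fun k => Finset.sum_nonneg fun _ _ => norm_nonneg _) hinner
      hgeo.summable
  have hlam : Summable (fun x : ι => ‖lam' x‖) := by
    refine (summable_sigma_of_nonneg fun x => norm_nonneg _).2 ⟨fun k => ?_, ?_⟩
    · exact (hasSum_fintype _).summable
    · simpa [lam', tsum_fintype] using hsummable
  have hterm : Summable (fun x : ι => ‖lam' x • F' x‖) := by
    refine Summable.of_nonneg_of_le (fun _ => norm_nonneg _) (fun x => ?_) hlam
    rw [norm_smul]
    exact mul_le_of_le_one_right (norm_nonneg _) (hA _ (hmem _ _))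
  have htend : Tendsto (fun N : ℕ => ∑ x ∈ (Finset.range N).sigma (fun _ => Finset.univ),
      lam' x • F' x) atTop (𝓝 u) := by
    have hpart : ∀ N : ℕ, ∑ x ∈ (Finset.range N).sigma (fun _ => Finset.univ),
        lam' x • F' x = u - r N := by
      intro N
      rw [Finset.sum_sigma]
      induction N with
      | zero => simp [hr0]
      | succ N ih =>
        rw [Finset.sum_range_succ, ih, hrs]
        simp only [lam', F']
        abel
    simp only [hpart]
    have h0 : Tendsto r atTop (𝓝 0) := by
      refine squeeze_zero_norm hr ?_
      simpa using (tendsto_pow_atTop_nhds_zero_of_lt_one (r := (1 / 2 : ℝ)) (by norm_num)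
        (by norm_num)).const_mul ‖u‖
    simpa using h0.const_sub u
  have hHas : HasSum (fun x : ι => lam' x • F' x) u := by
    refine hasSum_of_subseq_of_summable hterm (tendsto_atTop_finset_of_monotone ?_ ?_) htend
    · intro i j hij
      exact Finset.sigma_mono (Finset.range_mono hij) fun _ => le_rfl
    · intro x
      exact ⟨x.1 + 1, Finset.mem_sigma.2 ⟨Finset.mem_range.2 (Nat.lt_succ_self _),
        Finset.mem_univ _⟩⟩
  have hinf : Infinite ι := Infinite.of_injective (fun k : ℕ => (⟨k, 0⟩ : ι))
    fun a b h => congrArg Sigma.fst h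
  obtain ⟨e⟩ : Nonempty (ℕ ≃ ι) := by
    have := Classical.choice (nonempty_denumerable ι)
    exact ⟨(Denumerable.eqv ι).symm⟩
  refine ⟨lam' ∘ e, F' ∘ e, fun i => hmem _ _, (e.summable_iff).2 hlam,
    (e.hasSum_iff).2 hHas, ?_⟩
  have h1 : ∑' i, ‖(lam' ∘ e) i‖ = ∑' x, ‖lam' x‖ := e.tsum_eq (fun x => ‖lam' x‖)
  rw [h1, hlam.tsum_sigma]
  have h2 : ∀ k, ∑' i, ‖lam' ⟨k, i⟩‖ = ∑ i, ‖c (r k) i‖ := fun k => tsum_fintype _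
  simp only [h2]
  refine (hsummable.tsum_le_tsum hinner hgeo.summable).trans ?_
  rw [hgeo.tsum_eq]
  linarith

/-! ### Duality of `L^q` and `L^p` -/

/-- Dominated convergence in `L^q`. -/
theorem tendsto_eLpNorm_zero_of_dominated {α ι E F : Type*} [MeasurableSpace α] {μ : Measure α}
    [NormedAddCommGroup E] [NormedAddCommGroup F] {l : Filter ι} [l.IsCountablyGenerated]
    {q : ℝ≥0∞} (hq0 : q ≠ 0)
    (hq : q ≠ ⊤) {f : ι → α → E} {b : α → F} (hb : MemLp b q μ)
    (hf : ∀ i, AEStronglyMeasurable (f i) μ) (hle : ∀ i, ∀ᵐ x ∂μ, ‖f i x‖ ≤ ‖b x‖)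
    (hlim : ∀ᵐ x ∂μ, Tendsto (fun i => f i x) l (𝓝 0)) :
    Tendsto (fun i => eLpNorm (f i) q μ) l (𝓝 0) := by
  have hqpos : 0 < q.toReal := ENNReal.toReal_pos hq0 hq
  have h1 : Tendsto (fun i => ∫⁻ x, ‖f i x‖ₑ ^ q.toReal ∂μ) l (𝓝 (∫⁻ _, 0 ∂μ)) := by
    refine tendsto_lintegral_filter_of_dominated_convergence' (fun x => ‖b x‖ₑ ^ q.toReal)
      (Eventually.of_forall fun i => (hf i).enorm.pow_const _) (Eventually.of_forall fun i => ?_)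
      (lintegral_rpow_enorm_lt_top_of_eLpNorm_lt_top hq0 hq hb.2).ne ?_
    · filter_upwards [hle i] with x hx
      exact ENNReal.rpow_le_rpow (enorm_le_iff_norm_le.2 hx) hqpos.le
    · filter_upwards [hlim] with x hx
      have h2 : Tendsto (fun i => ‖f i x‖ₑ) l (𝓝 0) := by simpa using hx.enorm
      have h3 := h2.ennrpow_const q.toReal
      rwa [ENNReal.zero_rpow_of_pos hqpos] at h3
  simp only [lintegral_zero] at h1
  have h4 := h1.ennrpow_const (1 / q.toReal)
  rw [ENNReal.zero_rpow_of_pos (by positivity)] at h4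
  simpa only [eLpNorm_eq_lintegral_rpow_enorm_toReal hq0 hq] using h4

theorem tendsto_toLp_of_dominated {α ι E F : Type*} [MeasurableSpace α] {μ : Measure α}
    [NormedAddCommGroup E] [NormedAddCommGroup F] [NormedSpace ℝ F]
    {l : Filter ι} [l.IsCountablyGenerated]
    {q : ℝ≥0∞} [Fact (1 ≤ q)] (hq : q ≠ ⊤) {f : ι → α → E} {g : α → E} {b : α → F}
    (hb : MemLp b q μ) (hf : ∀ i, MemLp (f i) q μ) (hg : MemLp g q μ)
    (hle : ∀ i, ∀ᵐ x ∂μ, ‖f i x‖ ≤ ‖b x‖) (hgle : ∀ᵐ x ∂μ, ‖g x‖ ≤ ‖b x‖)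
    (hlim : ∀ᵐ x ∂μ, Tendsto (fun i => f i x) l (𝓝 (g x))) :
    Tendsto (fun i => (hf i).toLp (f i)) l (𝓝 (hg.toLp g)) := by
  rw [Lp.tendsto_Lp_iff_tendsto_eLpNorm'']
  refine tendsto_eLpNorm_zero_of_dominated (b := fun x => (2 : ℝ) • b x)
    (zero_lt_one.trans_le (Fact.out : 1 ≤ q)).ne' hq (hb.const_smul 2)
    (fun i => (hf i).1.sub hg.1) (fun i => ?_) ?_
  · filter_upwards [hle i, hgle] with x h1 h2
    rw [norm_smul, Real.norm_ofNat, Pi.sub_apply]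
    exact (norm_sub_le _ _).trans (by linarith)
  · filter_upwards [hlim] with x hx
    simpa using hx.sub_const (g x)

theorem toLp_eq_zero_of_ae_eq_zero {α E : Type*} [MeasurableSpace α] {μ : Measure α}
    [NormedAddCommGroup E] {q : ℝ≥0∞} {f : α → E} (hf : MemLp f q μ) (h : f =ᵐ[μ] 0) :
    hf.toLp f = 0 :=
  (MemLp.toLp_congr hf MemLp.zero h).trans (MemLp.toLp_zero _)

/-- The set function `E ↦ L (1_E w)` attached to a functional `L` on `L^q` and a weight
`w ∈ L^q`. -/
noncomputable def lpDualVectorMeasure {α 𝕜 : Type*} [MeasurableSpace α] {μ : Measure α} [RCLike 𝕜]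
    {q : ℝ≥0∞} [Fact (1 ≤ q)] (hq : q ≠ ⊤) (L : StrongDual 𝕜 (Lp 𝕜 q μ)) {w : α → 𝕜}
    (hw : MemLp w q μ) : VectorMeasure α 𝕜 := by
  classical
  exact
  { measureOf' := fun s =>
      if hs : MeasurableSet s then L ((hw.indicator hs).toLp (s.indicator w)) else 0
    empty' := by
      rw [dif_pos MeasurableSet.empty]
      have : (hw.indicator MeasurableSet.empty).toLp ((∅ : Set α).indicator w) = 0 :=
        toLp_eq_zero_of_ae_eq_zero _ (by rw [Set.indicator_empty]; rfl)
      rw [this, map_zero]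
    not_measurable' := fun s hs => dif_neg hs
    m_iUnion' := fun s hs hd => by
      have hU : MeasurableSet (⋃ i, s i) := MeasurableSet.iUnion hs
      rw [dif_pos hU]
      simp only [dif_pos (hs _)]
      rw [HasSum]
      have hfin : ∀ t : Finset ℕ, MeasurableSet (⋃ i ∈ t, s i) := fun t =>
        t.measurableSet_biUnion fun i _ => hs i
      have hsum : ∀ t : Finset ℕ, ∑ i ∈ t, L ((hw.indicator (hs i)).toLp ((s i).indicator w)) =
          L ((hw.indicator (hfin t)).toLp ((⋃ i ∈ t, s i).indicator w)) := by
        intro t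
        rw [← map_sum]
        congr 1
        refine Lp.ext ?_
        refine (Lp.coeFn_finsetSum _ _).trans ?_
        have h1 : ∀ᵐ x ∂μ, ∀ i, (hw.indicator (hs i)).toLp ((s i).indicator w) x =
            (s i).indicator w x := ae_all_iff.2 fun i => (hw.indicator (hs i)).coeFn_toLp
        filter_upwards [h1, (hw.indicator (hfin t)).coeFn_toLp] with x hx1 hx2
        rw [hx2, Finset.indicator_biUnion_apply t s (fun i _ j _ hij => hd hij), Finset.sum_apply]
        exact Finset.sum_congr rfl fun i _ => hx1 i
      simp only [hsum]
      refine (L.continuous.tendsto _).comp ?_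
      refine tendsto_toLp_of_dominated (b := w) hq hw _ _ (fun t => ?_) ?_ ?_
      · exact Eventually.of_forall fun x => norm_indicator_le_norm_self _ _
      · exact Eventually.of_forall fun x => norm_indicator_le_norm_self _ _
      · refine Eventually.of_forall fun x => ?_
        by_cases hx : x ∈ ⋃ i, s i
        · obtain ⟨i, hi⟩ := Set.mem_iUnion.1 hx
          refine tendsto_const_nhds.congr' ?_
          filter_upwards [eventually_ge_atTop {i}] with t ht
          rw [Set.indicator_of_mem hx, Set.indicator_of_mem]
          exact Set.mem_biUnion (Finset.singleton_subset_iff.1 ht) hi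
        · refine tendsto_const_nhds.congr' ?_
          filter_upwards with t
          rw [Set.indicator_of_notMem hx, Set.indicator_of_notMem]
          intro h
          obtain ⟨i, -, hi⟩ := Set.mem_iUnion₂.1 h
          exact hx (Set.mem_iUnion.2 ⟨i, hi⟩) }

theorem lpDualVectorMeasure_apply {α 𝕜 : Type*} [MeasurableSpace α] {μ : Measure α} [RCLike 𝕜]
    {q : ℝ≥0∞} [Fact (1 ≤ q)] (hq : q ≠ ⊤) (L : StrongDual 𝕜 (Lp 𝕜 q μ)) {w : α → 𝕜}
    (hw : MemLp w q μ) {s : Set α} (hs : MeasurableSet s) :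
    lpDualVectorMeasure hq L hw s = L ((hw.indicator hs).toLp (s.indicator w)) :=
  dif_pos hs

/-- Radon–Nikodym for the set function `E ↦ L (1_E w)`. -/
theorem exists_integrable_density_of_lpDual {α 𝕜 : Type*} [MeasurableSpace α] {μ : Measure α}
    [SigmaFinite μ] [RCLike 𝕜]
    {q : ℝ≥0∞} [Fact (1 ≤ q)] (hq : q ≠ ⊤) (L : StrongDual 𝕜 (Lp 𝕜 q μ)) {w : α → 𝕜}
    (hw : MemLp w q μ) : ∃ D : α → 𝕜, Measurable D ∧ Integrable D μ ∧
      ∀ s (hs : MeasurableSet s),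
        L ((hw.indicator hs).toLp (s.indicator w)) = ∫ x in s, D x ∂μ := by
  set v := lpDualVectorMeasure hq L hw with hv
  have hac : ∀ s, μ.toENNRealVectorMeasure s = 0 → v s = 0 := by
    intro s h
    by_cases hs : MeasurableSet s
    · rw [Measure.toENNRealVectorMeasure_apply_measurable hs] at h
      rw [hv, lpDualVectorMeasure_apply hq L hw hs]
      have : (hw.indicator hs).toLp (s.indicator w) = 0 :=
        toLp_eq_zero_of_ae_eq_zero _ (indicator_meas_zero h)
      rw [this, map_zero]
    · exact v.not_measurable hs
  let vr : SignedMeasure α := v.mapRange (RCLike.re : 𝕜 →+ ℝ) RCLike.continuous_re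
  let vi : SignedMeasure α := v.mapRange (RCLike.im : 𝕜 →+ ℝ) RCLike.continuous_im
  have hr := SignedMeasure.withDensityᵥ_rnDeriv_eq vr μ fun s hs => by
    rw [VectorMeasure.mapRange_apply, hac s hs, map_zero]
  have hi := SignedMeasure.withDensityᵥ_rnDeriv_eq vi μ fun s hs => by
    rw [VectorMeasure.mapRange_apply, hac s hs, map_zero]
  have hir := SignedMeasure.integrable_rnDeriv vr μ
  have hii := SignedMeasure.integrable_rnDeriv vi μ
  have hmr := SignedMeasure.measurable_rnDeriv vr μ
  have hmi := SignedMeasure.measurable_rnDeriv vi μ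
  refine ⟨fun x => (vr.rnDeriv μ x : 𝕜) + (vi.rnDeriv μ x : 𝕜) * RCLike.I, ?_, ?_, ?_⟩
  · fun_prop
  · exact hir.ofReal.add (hii.ofReal.mul_const _)
  · intro s hs
    rw [integral_add (hir.ofReal (𝕜 := 𝕜)).restrict
        ((hii.ofReal (𝕜 := 𝕜)).mul_const _).restrict,
      integral_mul_const, integral_ofReal, integral_ofReal,
      ← withDensityᵥ_apply hir hs, ← withDensityᵥ_apply hii hs, hr, hi,
      VectorMeasure.mapRange_apply, VectorMeasure.mapRange_apply,
      ← lpDualVectorMeasure_apply hq L hw hs]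
    exact (RCLike.re_add_im _).symm

theorem MeasureTheory.MemLp.bounded_mul {α 𝕜 : Type*} [MeasurableSpace α] {μ : Measure α}
    [RCLike 𝕜] {q : ℝ≥0∞} {w b : α → 𝕜} (hw : MemLp w q μ) (hb : AEStronglyMeasurable b μ)
    {c : ℝ} (hc : ∀ x, ‖b x‖ ≤ c) : MemLp (fun x => b x * w x) q μ :=
  hw.of_le_mul (hb.mul hw.1) (Eventually.of_forall fun x => by
    rw [norm_mul]
    exact mul_le_mul_of_nonneg_right (hc x) (norm_nonneg _))

theorem lpDual_bounded_mul {α 𝕜 : Type*} [MeasurableSpace α] {μ : Measure α}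
    [RCLike 𝕜] {q : ℝ≥0∞} [Fact (1 ≤ q)] (hq : q ≠ ⊤) (L : StrongDual 𝕜 (Lp 𝕜 q μ)) {w D : α → 𝕜}
    (hw : MemLp w q μ) (hD : Integrable D μ) (h : ∀ s (hs : MeasurableSet s),
        L ((hw.indicator hs).toLp (s.indicator w)) = ∫ x in s, D x ∂μ)
    {b : α → 𝕜} (hb : StronglyMeasurable b) {c : ℝ} (hc : ∀ x, ‖b x‖ ≤ c) :
    L ((hw.bounded_mul hb.aestronglyMeasurable hc).toLp _) = ∫ x, b x * D x ∂μ := by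
  have simple : ∀ (s : SimpleFunc α 𝕜) (hs : MemLp (fun x => s x * w x) q μ),
      L (hs.toLp _) = ∫ x, s x * D x ∂μ := by
    intro s
    induction s using SimpleFunc.induction with
    | @const d s hs =>
      intro hm
      have h1 : hm.toLp _ = d • (hw.indicator hs).toLp (s.indicator w) := by
        rw [← MemLp.toLp_const_smul]
        refine MemLp.toLp_congr _ _ (Eventually.of_forall fun x => ?_)
        by_cases hx : x ∈ s <;> simp [hx, SimpleFunc.piecewise_apply]
      rw [h1, map_smul, h s hs, smul_eq_mul, ← integral_const_mul, ← integral_indicator hs]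
      congr 1
      ext x
      by_cases hx : x ∈ s <;> simp [hx, SimpleFunc.piecewise_apply]
    | @add f g hd hf hg =>
      intro hm
      obtain ⟨cf, hcf⟩ := f.exists_forall_norm_le
      obtain ⟨cg, hcg⟩ := g.exists_forall_norm_le
      have hmf := hw.bounded_mul f.aestronglyMeasurable hcf
      have hmg := hw.bounded_mul g.aestronglyMeasurable hcg
      have h1 : hm.toLp _ = hmf.toLp _ + hmg.toLp _ := by
        rw [← MemLp.toLp_add]
        refine MemLp.toLp_congr _ _ (Eventually.of_forall fun x => ?_)
        simp [add_mul]
      rw [h1, map_add, hf, hg, ← integral_add]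
      · congr 1
        ext x
        simp [add_mul]
      · exact hD.bdd_mul f.aestronglyMeasurable (Eventually.of_forall hcf)
      · exact hD.bdd_mul g.aestronglyMeasurable (Eventually.of_forall hcg)
  have hnn : ∀ x : α, 0 ≤ c := fun x => (norm_nonneg _).trans (hc x)
  have hbn : ∀ k x, ‖hb.approxBounded c k x‖ ≤ c := fun k x => hb.norm_approxBounded_le (hnn x) k x
  have hbt : ∀ x, Tendsto (fun k => hb.approxBounded c k x) atTop (𝓝 (b x)) := fun x =>
    hb.tendsto_approxBounded_of_norm_le (hc x)
  have hmem := fun k => hw.bounded_mul (hb.approxBounded c k).aestronglyMeasurable (hbn k)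
  have t1 : Tendsto (fun k => (hmem k).toLp _) atTop
      (𝓝 ((hw.bounded_mul hb.aestronglyMeasurable hc).toLp _)) := by
    refine tendsto_toLp_of_dominated (b := fun x => (c : 𝕜) * w x) hq (hw.const_mul _) hmem _
      (fun k => Eventually.of_forall fun x => ?_) (Eventually.of_forall fun x => ?_)
      (Eventually.of_forall fun x => (hbt x).mul_const _)
    · rw [norm_mul, norm_mul, RCLike.norm_ofReal, abs_of_nonneg (hnn x)]
      exact mul_le_mul_of_nonneg_right (hbn k x) (norm_nonneg _)
    · rw [norm_mul, norm_mul, RCLike.norm_ofReal, abs_of_nonneg (hnn x)]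
      exact mul_le_mul_of_nonneg_right (hc x) (norm_nonneg _)
  have t2 : Tendsto (fun k => ∫ x, hb.approxBounded c k x * D x ∂μ) atTop
      (𝓝 (∫ x, b x * D x ∂μ)) := by
    refine tendsto_integral_of_dominated_convergence (fun x => c * ‖D x‖)
      (fun k => (hb.approxBounded c k).aestronglyMeasurable.mul hD.1) (hD.norm.const_mul c)
      (fun k => Eventually.of_forall fun x => ?_)
      (Eventually.of_forall fun x => (hbt x).mul_const _)
    rw [norm_mul]
    exact mul_le_mul_of_nonneg_right (hbn k x) (norm_nonneg _)
  refine tendsto_nhds_unique ((L.continuous.tendsto _).comp t1) (t2.congr fun k => ?_)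
  exact (simple _ (hmem k)).symm

/-- The unimodular factor turning `z` into `‖z‖`, and `0` at `z = 0`. -/
noncomputable def conjSign {𝕜 : Type*} [RCLike 𝕜] (z : 𝕜) : 𝕜 := star z / (‖z‖ : 𝕜)

theorem conjSign_mul_self {𝕜 : Type*} [RCLike 𝕜] (z : 𝕜) : conjSign z * z = (‖z‖ : 𝕜) := by
  rcases eq_or_ne z 0 with rfl | hz
  · simp
  · have : (‖z‖ : 𝕜) ≠ 0 := by simpa using hz
    rw [conjSign, div_mul_eq_mul_div, div_eq_iff this, RCLike.star_def, RCLike.conj_mul, sq]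

theorem norm_conjSign_le {𝕜 : Type*} [RCLike 𝕜] (z : 𝕜) : ‖conjSign z‖ ≤ 1 := by
  rw [conjSign, norm_div, norm_star, RCLike.norm_ofReal, abs_norm]
  exact div_self_le_one _

theorem measurable_conjSign {𝕜 : Type*} [RCLike 𝕜] : Measurable (conjSign : 𝕜 → 𝕜) := by
  unfold conjSign
  exact (continuous_star.measurable).div (RCLike.measurable_ofReal.comp measurable_norm)

theorem exists_memLp_pos {α : Type*} (𝕜 : Type*) [MeasurableSpace α] (μ : Measure α)
    [SigmaFinite μ] [RCLike 𝕜] {q : ℝ≥0∞} (hq0 : q ≠ 0) (hq : q ≠ ⊤) :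
    ∃ w : α → ℝ, Measurable w ∧ (∀ x, 0 < w x) ∧ MemLp (fun x => (w x : 𝕜)) q μ := by
  obtain ⟨w, hwpos, hwm, hwint⟩ := exists_pos_lintegral_lt_of_sigmaFinite μ one_ne_zero
  have hQ : 0 < q.toReal := ENNReal.toReal_pos hq0 hq
  refine ⟨fun x => (w x : ℝ) ^ (1 / q.toReal), by fun_prop,
    fun x => Real.rpow_pos_of_pos (hwpos x) _, ?_, ?_⟩
  · exact (RCLike.measurable_ofReal.comp (by fun_prop)).aestronglyMeasurable
  · rw [eLpNorm_lt_top_iff_lintegral_rpow_enorm_lt_top hq0 hq]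
    refine lt_of_le_of_lt (le_of_eq (lintegral_congr fun x => ?_)) (hwint.trans ENNReal.one_lt_top)
    have h1 : ‖(((w x : ℝ) ^ (1 / q.toReal) : ℝ) : 𝕜)‖ₑ = (w x : ℝ≥0∞) ^ (1 / q.toReal) := by
      rw [← ofReal_norm, RCLike.norm_ofReal, abs_of_nonneg (by positivity),
        ← ENNReal.ofReal_rpow_of_pos (NNReal.coe_pos.2 (hwpos x)), ENNReal.ofReal_coe_nnreal]
    rw [h1, ← ENNReal.rpow_mul, one_div_mul_cancel hQ.ne', ENNReal.rpow_one]

/-- Every continuous functional on `L^q(μ)`, with `μ` σ-finite and `q < ∞`, is integration against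
a measurable function `G`. -/
theorem exists_measurable_repr_lpDual {α 𝕜 : Type*} [MeasurableSpace α] {μ : Measure α}
    [SigmaFinite μ] [RCLike 𝕜] {q : ℝ≥0∞} [Fact (1 ≤ q)] (hq : q ≠ ⊤)
    (L : StrongDual 𝕜 (Lp 𝕜 q μ)) : ∃ G : α → 𝕜, Measurable G ∧
      ∀ a (ha : MemLp a q μ), ∫⁻ x, ‖a x * G x‖ₑ ∂μ ≤ ‖L‖ₑ * eLpNorm a q μ ∧
        L (ha.toLp a) = ∫ x, a x * G x ∂μ := by
  have hq0 : q ≠ 0 := (zero_lt_one.trans_le (Fact.out : 1 ≤ q)).ne'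
  obtain ⟨w, hwm, hwpos, hw⟩ := exists_memLp_pos 𝕜 μ hq0 hq
  obtain ⟨D, hDm, hD, hrep⟩ := exists_integrable_density_of_lpDual hq L hw
  have hwne : ∀ x, (w x : 𝕜) ≠ 0 := fun x => by exact_mod_cast (hwpos x).ne'
  have hwm' : Measurable fun x => (w x : 𝕜) := RCLike.measurable_ofReal.comp hwm
  refine ⟨fun x => D x / w x, hDm.div hwm', ?_⟩
  set G : α → 𝕜 := fun x => D x / w x with hG
  have hGm : Measurable G := hDm.div hwm'
  -- the representation for functions dominated by a multiple of the weight
  have key : ∀ a : α → 𝕜, Measurable a → ∀ c : ℝ, (∀ x, ‖a x‖ ≤ c * w x) →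
      ∀ ha : MemLp a q μ, L (ha.toLp a) = ∫ x, a x * G x ∂μ := by
    intro a ham c hc ha
    have hb : ∀ x, ‖a x / (w x : 𝕜)‖ ≤ c := fun x => by
      rw [norm_div, RCLike.norm_ofReal, abs_of_pos (hwpos x), div_le_iff₀ (hwpos x)]
      exact hc x
    have h1 := lpDual_bounded_mul hq L hw hD hrep (ham.div hwm').stronglyMeasurable hb
    have h2 : ∫ x, a x * G x ∂μ = ∫ x, (a x / w x) * D x ∂μ :=
      integral_congr_ae (Eventually.of_forall fun x => by simp only [hG]; ring)
    rw [h2]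
    refine Eq.trans ?_ h1
    congr 1
    exact MemLp.toLp_congr _ _ (Eventually.of_forall fun x => (div_mul_cancel₀ _ (hwne x)).symm)
  have main : ∀ a : α → 𝕜, Measurable a → ∀ ha : MemLp a q μ,
      ∫⁻ x, ‖a x * G x‖ₑ ∂μ ≤ ‖L‖ₑ * eLpNorm a q μ ∧ L (ha.toLp a) = ∫ x, a x * G x ∂μ := by
    intro a ham ha
    let A : ℕ → Set α := fun k => {x | ‖a x‖ ≤ k * w x}
    have hA : ∀ k, MeasurableSet (A k) := fun k =>
      measurableSet_le ham.norm (hwm.const_mul _)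
    have hev : ∀ x, ∀ᶠ k in atTop, x ∈ A k := by
      intro x
      obtain ⟨k, hk⟩ := exists_nat_ge (‖a x‖ / w x)
      filter_upwards [eventually_ge_atTop k] with j hj
      have : ‖a x‖ / w x ≤ j := hk.trans (by exact_mod_cast hj)
      exact (div_le_iff₀ (hwpos x)).1 this
    have hak : ∀ k x, ‖(A k).indicator a x‖ ≤ k * w x := by
      intro k x
      by_cases hx : x ∈ A k
      · rw [Set.indicator_of_mem hx]; exact hx
      · rw [Set.indicator_of_notMem hx, norm_zero]
        exact mul_nonneg (Nat.cast_nonneg _) (hwpos x).le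
    have hbound : ∀ k, ∫⁻ x, ‖(A k).indicator a x * G x‖ₑ ∂μ ≤ ‖L‖ₑ * eLpNorm a q μ := by
      intro k
      let s : α → 𝕜 := fun x => conjSign ((A k).indicator a x * G x)
      have hsm : Measurable s :=
        measurable_conjSign.comp ((ham.indicator (hA k)).mul hGm)
      let a' : α → 𝕜 := fun x => s x * (A k).indicator a x
      have hle : ∀ x, ‖a' x‖ ≤ ‖(A k).indicator a x‖ := fun x => by
        rw [norm_mul]
        exact mul_le_of_le_one_left (norm_nonneg _) (norm_conjSign_le _)
      have ha'm : Measurable a' := hsm.mul (ham.indicator (hA k))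
      have ha' : MemLp a' q μ := ha.mono ha'm.aestronglyMeasurable
        (Eventually.of_forall fun x => (hle x).trans (norm_indicator_le_norm_self _ _))
      have h1 := key a' ha'm k (fun x => (hle x).trans (hak k x)) ha'
      have h2 : ∀ x, a' x * G x = ((‖(A k).indicator a x * G x‖ : ℝ) : 𝕜) := fun x => by
        rw [← conjSign_mul_self]
        simp only [a', s]
        ring
      have hint : Integrable (fun x => (A k).indicator a x * G x) μ := by
        refine (hD.norm.const_mul (k : ℝ)).mono
          ((ham.indicator (hA k)).mul hGm).aestronglyMeasurable (Eventually.of_forall fun x => ?_)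
        have h3 := hak k x
        rw [norm_mul, hG, norm_div, RCLike.norm_ofReal, abs_of_pos (hwpos x), norm_mul, norm_norm,
          Real.norm_natCast, ← mul_div_assoc, div_le_iff₀ (hwpos x)]
        calc _ ≤ (k * w x) * ‖D x‖ := mul_le_mul_of_nonneg_right h3 (norm_nonneg _)
          _ = _ := by ring
      simp only [h2] at h1
      rw [integral_ofReal] at h1
      have h4 : ‖L (ha'.toLp a')‖ ≤ ‖L‖ * (eLpNorm a' q μ).toReal := by
        have := L.le_opNorm (ha'.toLp a')
        rwa [Lp.norm_toLp] at this
      rw [h1, RCLike.norm_ofReal, abs_of_nonneg (integral_nonneg fun _ => norm_nonneg _)] at h4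
      rw [← ofReal_integral_norm_eq_lintegral_enorm hint]
      refine (ENNReal.ofReal_le_ofReal h4).trans ?_
      rw [ENNReal.ofReal_mul (norm_nonneg _), ofReal_norm, ENNReal.ofReal_toReal ha'.2.ne]
      gcongr
      exact eLpNorm_mono fun x => (hle x).trans (norm_indicator_le_norm_self _ _)
    have hlimpt : ∀ x, ∀ᶠ k in atTop, (A k).indicator a x = a x := fun x => by
      filter_upwards [hev x] with k hk using Set.indicator_of_mem hk _
    have hfin : ∫⁻ x, ‖a x * G x‖ₑ ∂μ ≤ ‖L‖ₑ * eLpNorm a q μ := by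
      calc ∫⁻ x, ‖a x * G x‖ₑ ∂μ
          ≤ ∫⁻ x, liminf (fun k => ‖(A k).indicator a x * G x‖ₑ) atTop ∂μ := by
            refine lintegral_mono fun x => ?_
            have : Tendsto (fun k => ‖(A k).indicator a x * G x‖ₑ) atTop (𝓝 ‖a x * G x‖ₑ) :=
              tendsto_const_nhds.congr' (by
                filter_upwards [hlimpt x] with k hk
                rw [hk])
            exact this.liminf_eq.ge
        _ ≤ liminf (fun k => ∫⁻ x, ‖(A k).indicator a x * G x‖ₑ ∂μ) atTop :=
            lintegral_liminf_le fun k => ((ham.indicator (hA k)).mul hGm).enorm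
        _ ≤ _ := liminf_le_of_frequently_le' (Frequently.of_forall hbound)
    refine ⟨hfin, ?_⟩
    have hint : Integrable (fun x => a x * G x) μ :=
      ⟨(ham.mul hGm).aestronglyMeasurable,
        hfin.trans_lt (ENNReal.mul_lt_top enorm_lt_top ha.2)⟩
    have t1 : Tendsto (fun k => (ha.indicator (hA k)).toLp ((A k).indicator a)) atTop
        (𝓝 (ha.toLp a)) :=
      tendsto_toLp_of_dominated hq ha _ _
        (fun k => Eventually.of_forall fun x => norm_indicator_le_norm_self _ _)
        (Eventually.of_forall fun x => le_rfl)
        (Eventually.of_forall fun x => tendsto_const_nhds.congr' (by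
          filter_upwards [hlimpt x] with k hk using hk.symm))
    have t2 : Tendsto (fun k => ∫ x, (A k).indicator a x * G x ∂μ) atTop
        (𝓝 (∫ x, a x * G x ∂μ)) := by
      refine tendsto_integral_of_dominated_convergence (fun x => ‖a x * G x‖)
        (fun k => ((ham.indicator (hA k)).mul hGm).aestronglyMeasurable) hint.norm
        (fun k => Eventually.of_forall fun x => ?_)
        (Eventually.of_forall fun x => tendsto_const_nhds.congr' (by
          filter_upwards [hlimpt x] with k hk
          rw [hk]))
      rw [norm_mul, norm_mul]
      exact mul_le_mul_of_nonneg_right (norm_indicator_le_norm_self _ _) (norm_nonneg _)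
    refine tendsto_nhds_unique ((L.continuous.tendsto _).comp t1) (t2.congr fun k => ?_)
    exact (key _ (ham.indicator (hA k)) k (hak k) (ha.indicator (hA k))).symm
  intro a ha
  have hae : ha.1.mk a =ᵐ[μ] a := ha.1.ae_eq_mk.symm
  have hmk : MemLp (ha.1.mk a) q μ := ha.ae_eq hae.symm
  have h := main _ ha.1.stronglyMeasurable_mk.measurable hmk
  refine ⟨?_, ?_⟩
  · rw [← eLpNorm_congr_ae hae]
    refine le_trans (le_of_eq (lintegral_congr_ae ?_)) h.1
    filter_upwards [hae] with x hx
    rw [hx]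
  · rw [MemLp.toLp_congr ha hmk hae.symm, h.2]
    refine integral_congr_ae ?_
    filter_upwards [hae] with x hx
    rw [hx]

/-- The converse of Hölder's inequality: a measurable function pairing boundedly with `L^q` lies in
`L^p`. -/
theorem eLpNorm_le_of_forall_lintegral_mul_le {α 𝕜 : Type*} [MeasurableSpace α] {μ : Measure α}
    [SigmaFinite μ] [RCLike 𝕜] {p q : ℝ≥0∞} [p.HolderConjugate q] (hp : p ≠ ⊤) (hq : q ≠ ⊤)
    {F : α → 𝕜} (hF : AEStronglyMeasurable F μ) {R : ℝ≥0∞}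
    (h : ∀ a : α → 𝕜, MemLp a q μ → ∫⁻ x, ‖a x * F x‖ₑ ∂μ ≤ R * eLpNorm a q μ) :
    eLpNorm F p μ ≤ R := by
  wlog hFm : Measurable F generalizing F
  · rw [eLpNorm_congr_ae hF.ae_eq_mk]
    refine this hF.stronglyMeasurable_mk.aestronglyMeasurable (fun a ha => ?_)
      hF.stronglyMeasurable_mk.measurable
    refine le_trans (le_of_eq (lintegral_congr_ae ?_)) (h a ha)
    filter_upwards [hF.ae_eq_mk] with x hx
    rw [hx]
  have hPQ : p.toReal.HolderConjugate q.toReal := ENNReal.HolderConjugate.toReal_of_ne_top hp hq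
  have hP := hPQ.pos
  have hQ := hPQ.symm.pos
  have hp0 : p ≠ 0 := fun h0 => by simp [h0] at hP
  have hq0 : q ≠ 0 := fun h0 => by simp [h0] at hQ
  let A : ℕ → Set α := fun k => spanningSets μ k ∩ {x | ‖F x‖ ≤ k}
  have hA : ∀ k, MeasurableSet (A k) := fun k =>
    (measurableSet_spanningSets μ k).inter (measurableSet_le hFm.norm measurable_const)
  have hev : ∀ x, ∀ᶠ k in atTop, x ∈ A k := by
    intro x
    obtain ⟨k, hk⟩ := exists_nat_ge ‖F x‖
    filter_upwards [eventually_ge_atTop k, eventually_ge_atTop (spanningSetsIndex μ x)] with j hj hj2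
    exact ⟨monotone_spanningSets μ hj2 (mem_spanningSetsIndex μ x),
      hk.trans (by exact_mod_cast hj)⟩
  have hbound : ∀ k, eLpNorm ((A k).indicator F) p μ ≤ R := by
    intro k
    set I : ℝ≥0∞ := ∫⁻ x, ‖(A k).indicator F x‖ₑ ^ p.toReal ∂μ with hI
    have hnorm : eLpNorm ((A k).indicator F) p μ = I ^ (1 / p.toReal) :=
      eLpNorm_eq_lintegral_rpow_enorm_toReal hp0 hp
    have hmem : MemLp ((A k).indicator F) p μ := by
      have hfin : μ (A k) ≠ ⊤ :=
        ((measure_mono Set.inter_subset_left).trans_lt (measure_spanningSets_lt_top μ k)).ne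
      refine (memLp_indicator_const p (hA k) (k : ℝ) (Or.inr hfin)).mono
        (hFm.indicator (hA k)).aestronglyMeasurable (Eventually.of_forall fun x => ?_)
      by_cases hx : x ∈ A k
      · rw [Set.indicator_of_mem hx, Set.indicator_of_mem hx, Real.norm_natCast]
        exact hx.2
      · rw [Set.indicator_of_notMem hx, Set.indicator_of_notMem hx, norm_zero, norm_zero]
    have hIfin : I ≠ ⊤ := (lintegral_rpow_enorm_lt_top_of_eLpNorm_lt_top hp0 hp hmem.2).ne
    -- the extremal function in Hölder's inequality
    let a : α → 𝕜 := fun x => ((‖(A k).indicator F x‖ ^ (p.toReal - 1) : ℝ) : 𝕜)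
    have hea : ∀ x, ‖a x‖ₑ = ‖(A k).indicator F x‖ₑ ^ (p.toReal - 1) := fun x => by
      rw [← ofReal_norm, RCLike.norm_ofReal, abs_of_nonneg (by positivity), ← ofReal_norm,
        ENNReal.ofReal_rpow_of_nonneg (norm_nonneg _) (by linarith [hPQ.lt])]
    have ham : Measurable a :=
      RCLike.measurable_ofReal.comp ((hFm.indicator (hA k)).norm.pow_const _)
    have haq : eLpNorm a q μ = I ^ (1 / q.toReal) := by
      rw [eLpNorm_eq_lintegral_rpow_enorm_toReal hq0 hq, hI]
      congr 1
      refine lintegral_congr fun x => ?_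
      rw [hea, ← ENNReal.rpow_mul, hPQ.sub_one_mul_conj]
    have haF : ∫⁻ x, ‖a x * F x‖ₑ ∂μ = I := by
      refine lintegral_congr fun x => ?_
      rw [enorm_mul, hea]
      by_cases hx : x ∈ A k
      · rw [Set.indicator_of_mem hx]
        calc _ = ‖F x‖ₑ ^ (p.toReal - 1) * ‖F x‖ₑ ^ (1 : ℝ) := by rw [ENNReal.rpow_one]
          _ = _ := by
            rw [← ENNReal.rpow_add_of_nonneg _ _ (by linarith [hPQ.lt]) zero_le_one,
              sub_add_cancel]
      · rw [Set.indicator_of_notMem hx, enorm_zero, ENNReal.zero_rpow_of_pos hP,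
          ENNReal.zero_rpow_of_pos (by linarith [hPQ.lt]), zero_mul]
    have hI1 : I ≤ R * I ^ (1 / q.toReal) := by
      rw [← haq]
      refine le_trans haF.ge (h a ⟨ham.aestronglyMeasurable, ?_⟩)
      rw [haq]
      exact ENNReal.rpow_lt_top_of_nonneg (by positivity) hIfin
    rw [hnorm]
    rcases eq_or_ne I 0 with h0 | h0
    · rw [h0, ENNReal.zero_rpow_of_pos (by positivity)]
      exact zero_le
    · have h2 : I = I ^ (1 / p.toReal) * I ^ (1 / q.toReal) := by
        rw [← ENNReal.rpow_add _ _ h0 hIfin, one_div, one_div, hPQ.inv_add_inv_eq_one,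
          ENNReal.rpow_one]
      rw [h2] at hI1
      have hne : I ^ (1 / q.toReal) ≠ 0 := by
        simp [ENNReal.rpow_eq_zero_iff, h0, hIfin]
      have hne' : I ^ (1 / q.toReal) ≠ ⊤ :=
        ENNReal.rpow_ne_top_of_nonneg (by positivity) hIfin
      have h3 := hI1
      rw [← h2] at h3
      refine (ENNReal.mul_le_mul_iff_left hne hne').1 ?_
      rw [← h2]
      exact h3
  refine (Lp.eLpNorm_lim_le_liminf_eLpNorm
    (fun k => (hFm.indicator (hA k)).aestronglyMeasurable) F
    (Eventually.of_forall fun x => tendsto_const_nhds.congr' ?_)).trans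
    (liminf_le_of_frequently_le' (Frequently.of_forall hbound))
  filter_upwards [hev x] with k hk
  rw [Set.indicator_of_mem hk]

/-! ### Geometry of `K`-balls and cones -/

namespace TentDuality

instance : LocallyCompactSpace (Set.Ioi (0 : ℝ)) := isOpen_Ioi.locallyCompactSpace

instance : IsFiniteMeasureOnCompacts (volume : Measure (Set.Ioi (0 : ℝ))) :=
  IsFiniteMeasureOnCompacts.comap' volume continuous_subtype_val
    (MeasurableEmbedding.subtype_coe measurableSet_Ioi)

instance : NullSingletonClass (volume : Measure (Set.Ioi (0 : ℝ))) where
  measure_singleton t := by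
    change Measure.comap Subtype.val volume _ = 0
    rw [(MeasurableEmbedding.subtype_coe measurableSet_Ioi).comap_apply, Set.image_singleton,
      measure_singleton]

instance (n : ℕ) : IsFiniteMeasureOnCompacts (volume : Measure (UpperHalf n)) :=
  inferInstanceAs (IsFiniteMeasureOnCompacts
    ((volume : Measure (EuclideanSpace ℝ (Fin n))).prod (volume : Measure (Set.Ioi (0 : ℝ)))))

instance (n : ℕ) : (volume : Measure (UpperHalf n)).Regular :=
  Measure.Regular.of_sigmaCompactSpace_of_isLocallyFiniteMeasure _

variable {𝕜 : Type*} [RCLike 𝕜] {n : ℕ} (K : SymmConvexBody n)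

namespace SymmConvexBody

theorem kNorm_zero : K.kNorm 0 = 0 := gauge_zero

theorem kNorm_neg (x : EuclideanSpace ℝ (Fin n)) : K.kNorm (-x) = K.kNorm x :=
  gauge_neg K.neg_mem' x

theorem kNorm_sub_comm (x y : EuclideanSpace ℝ (Fin n)) : K.kNorm (x - y) = K.kNorm (y - x) := by
  rw [← neg_sub, kNorm_neg]

theorem kNorm_add_le (x y : EuclideanSpace ℝ (Fin n)) :
    K.kNorm (x + y) ≤ K.kNorm x + K.kNorm y :=
  gauge_add_le K.convex' (absorbent_nhds_zero K.carrier_mem_nhds_zero) x y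

theorem kNorm_smul {r : ℝ} (hr : 0 ≤ r) (x : EuclideanSpace ℝ (Fin n)) :
    K.kNorm (r • x) = r * K.kNorm x :=
  gauge_smul_of_nonneg hr x

theorem kNorm_sub_le (x y z : EuclideanSpace ℝ (Fin n)) :
    K.kNorm (x - z) ≤ K.kNorm (x - y) + K.kNorm (y - z) := by
  simpa using K.kNorm_add_le (x - y) (y - z)

theorem isClosed_kBall (z : UpperHalf n) : IsClosed (K.kBall z) :=
  isClosed_le (K.continuous_kNorm.comp (continuous_id.sub continuous_const)) continuous_const

theorem measurableSet_kBall (z : UpperHalf n) : MeasurableSet (K.kBall z) :=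
  (K.isClosed_kBall z).measurableSet

theorem continuous_kNorm_sub_fst (x : EuclideanSpace ℝ (Fin n)) :
    Continuous fun z : UpperHalf n => K.kNorm (x - z.1) :=
  K.continuous_kNorm.comp (continuous_const.sub continuous_fst)

theorem continuous_height : Continuous fun z : UpperHalf n => (z.2 : ℝ) :=
  continuous_subtype_val.comp continuous_snd

theorem measurableSet_cone (x : EuclideanSpace ℝ (Fin n)) : MeasurableSet (K.cone x) :=
  (isClosed_le (K.continuous_kNorm_sub_fst x) continuous_height).measurableSet

theorem setOf_kNorm_le_one : {x | K.kNorm x ≤ 1} = K.carrier := by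
  ext x
  exact (gauge_le_one_iff_mem_closure K.convex' K.carrier_mem_nhds_zero).trans
    (by rw [K.isCompact'.isClosed.closure_eq])

theorem volume_carrier_pos : 0 < volume K.carrier :=
  Measure.measure_pos_of_mem_nhds _ K.carrier_mem_nhds_zero

theorem volume_carrier_lt_top : volume K.carrier < ⊤ := K.isCompact'.measure_lt_top

open scoped Pointwise in
theorem volume_setOf_kNorm_sub_le (x : EuclideanSpace ℝ (Fin n)) {t : ℝ} (ht : 0 < t) :
    volume {y | K.kNorm (y - x) ≤ t} = ENNReal.ofReal (t ^ n) * volume K.carrier := by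
  have h1 : {y | K.kNorm (y - x) ≤ t} = (fun y => y + -x) ⁻¹' (t • K.carrier) := by
    ext y
    rw [Set.mem_preimage, Set.mem_smul_set_iff_inv_smul_mem₀ ht.ne', ← setOf_kNorm_le_one]
    simp only [Set.mem_ofPred_eq]
    rw [kNorm_smul K (inv_nonneg.2 ht.le), inv_mul_le_iff₀ ht, mul_one, sub_eq_add_neg]
  rw [h1, measure_preimage_add_right, Measure.addHaar_smul, finrank_euclideanSpace_fin,
    abs_of_pos (pow_pos ht n)]

theorem volume_kBall (z : UpperHalf n) :
    volume (K.kBall z) = ENNReal.ofReal ((z.2 : ℝ) ^ n) * volume K.carrier :=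
  K.volume_setOf_kNorm_sub_le z.1 z.2.2

theorem volume_kBall_pos (z : UpperHalf n) : 0 < volume (K.kBall z) := by
  rw [volume_kBall]
  exact ENNReal.mul_pos (ENNReal.ofReal_pos.2 (pow_pos z.2.2 n)).ne' K.volume_carrier_pos.ne'

open scoped Pointwise in
theorem volume_kSphere (x : EuclideanSpace ℝ (Fin n)) {t : ℝ} (ht : 0 < t) :
    volume {y | K.kNorm (y - x) = t} = 0 := by
  have h1 : {y | K.kNorm (y - x) = t} = (fun y => y + -x) ⁻¹' (t • frontier K.carrier) := by
    ext y
    rw [Set.mem_preimage, Set.mem_smul_set_iff_inv_smul_mem₀ ht.ne',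
      ← gauge_eq_one_iff_mem_frontier K.convex' K.carrier_mem_nhds_zero]
    change _ ↔ K.kNorm _ = 1
    rw [kNorm_smul K (inv_nonneg.2 ht.le), inv_mul_eq_one₀ ht.ne', ← sub_eq_add_neg,
      Set.mem_ofPred_eq, eq_comm]
  rw [h1, measure_preimage_add_right, Measure.addHaar_smul, K.convex'.addHaar_frontier volume, mul_zero]

/-- The boundary of a cone is the graph of a function, hence null. -/
theorem ae_kNorm_sub_ne (x : EuclideanSpace ℝ (Fin n)) :
    ∀ᵐ z : UpperHalf n, K.kNorm (x - z.1) ≠ z.2 := by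
  have hm : MeasurableSet {z : UpperHalf n | K.kNorm (x - z.1) = z.2} :=
    (isClosed_eq (K.continuous_kNorm_sub_fst x) continuous_height).measurableSet
  rw [ae_iff]
  simp only [not_not]
  refine (Measure.measure_prod_null hm).2 (Eventually.of_forall fun y => ?_)
  refine Set.Subsingleton.measure_zero ?_ _
  intro s hs t ht
  exact Subtype.ext (hs.symm.trans ht)

/-! ### Integrals over `K`-balls -/

/-- The function `(x, t) ↦ ∫_{B(x,t)} g`. -/
noncomputable def ballIntegral (g : EuclideanSpace ℝ (Fin n) → 𝕜) (z : UpperHalf n) : 𝕜 :=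
  ∫ y in K.kBall z, g y

theorem ballIntegral_ofReal (g : EuclideanSpace ℝ (Fin n) → ℝ) (z : UpperHalf n) :
    K.ballIntegral (fun y => (g y : 𝕜)) z = ((K.ballIntegral g z : ℝ) : 𝕜) :=
  integral_ofReal

theorem enorm_ballIntegral_le (g : EuclideanSpace ℝ (Fin n) → 𝕜) (z : UpperHalf n) :
    ‖K.ballIntegral g z‖ₑ ≤ ∫⁻ y in K.kBall z, ‖g y‖ₑ :=
  enorm_integral_le_lintegral_enorm _

/-- Near a point `z` whose ball does not have `y` on its boundary, membership of `y` in the ball is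
locally constant. -/
theorem eventually_mem_kBall_iff {y : EuclideanSpace ℝ (Fin n)} {z : UpperHalf n}
    (h : K.kNorm (y - z.1) ≠ z.2) :
    ∀ᶠ w : EuclideanSpace ℝ (Fin n) × UpperHalf n in 𝓝 (y, z),
      (w.1 ∈ K.kBall w.2 ↔ y ∈ K.kBall z) := by
  have c1 : Continuous fun w : EuclideanSpace ℝ (Fin n) × UpperHalf n =>
      K.kNorm (w.1 - w.2.1) :=
    K.continuous_kNorm.comp (continuous_fst.sub (continuous_fst.comp continuous_snd))
  have c2 : Continuous fun w : EuclideanSpace ℝ (Fin n) × UpperHalf n => (w.2.2 : ℝ) :=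
    continuous_height.comp continuous_snd
  rcases lt_or_gt_of_ne h with hlt | hgt
  · filter_upwards [(isOpen_lt c1 c2).mem_nhds (x := (y, z)) hlt] with w hw
    exact iff_of_true (le_of_lt hw) hlt.le
  · filter_upwards [(isOpen_lt c2 c1).mem_nhds (x := (y, z)) hgt] with w hw
    exact iff_of_false (not_le_of_gt hw) (not_le_of_gt hgt)

theorem continuous_ballIntegral {g : EuclideanSpace ℝ (Fin n) → 𝕜} (hg : Integrable g) :
    Continuous (K.ballIntegral g) := by
  have h : K.ballIntegral g = fun z => ∫ y, (K.kBall z).indicator g y := by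
    ext z
    exact (integral_indicator (K.measurableSet_kBall z)).symm
  rw [h, continuous_iff_continuousAt]
  intro z
  refine continuousAt_of_dominated (bound := fun y => ‖g y‖)
    (Eventually.of_forall fun w => hg.1.indicator (K.measurableSet_kBall w))
    (Eventually.of_forall fun w => Eventually.of_forall fun y => norm_indicator_le_norm_self _ _)
    hg.norm ?_
  have hae : ∀ᵐ y, K.kNorm (y - z.1) ≠ z.2 := by
    rw [ae_iff]
    simpa using K.volume_kSphere z.1 z.2.2
  filter_upwards [hae] with y hy
  refine ContinuousAt.congr (f := fun _ => (K.kBall z).indicator g y) continuousAt_const ?_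
  have hev : ∀ᶠ w in 𝓝 z, (y ∈ K.kBall w ↔ y ∈ K.kBall z) :=
    (Continuous.tendsto' (by fun_prop : Continuous fun w : UpperHalf n => (y, w)) z (y, z)
      rfl).eventually (K.eventually_mem_kBall_iff hy)
  filter_upwards [hev] with w hw
  by_cases hz : y ∈ K.kBall z
  · rw [Set.indicator_of_mem hz, Set.indicator_of_mem (hw.2 hz)]
  · rw [Set.indicator_of_notMem hz, Set.indicator_of_notMem (fun h => hz (hw.1 h))]

theorem ballIntegral_mono {g h : EuclideanSpace ℝ (Fin n) → ℝ} (hg : Integrable g)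
    (hh : Integrable h) (hle : ∀ y, g y ≤ h y) (z : UpperHalf n) :
    K.ballIntegral g z ≤ K.ballIntegral h z :=
  integral_mono hg.restrict hh.restrict hle

theorem ballIntegral_nonneg {g : EuclideanSpace ℝ (Fin n) → ℝ} (hg : ∀ y, 0 ≤ g y)
    (z : UpperHalf n) : 0 ≤ K.ballIntegral g z :=
  integral_nonneg hg

theorem ballIntegral_pos {g : EuclideanSpace ℝ (Fin n) → ℝ} (hg : Integrable g)
    (hpos : ∀ y, 0 < g y) (z : UpperHalf n) : 0 < K.ballIntegral g z := by
  refine (setIntegral_pos_iff_support_of_nonneg_ae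
    (Eventually.of_forall fun y => (hpos y).le) hg.integrableOn).2 ?_
  have : Function.support g = Set.univ := Set.eq_univ_of_forall fun y => (hpos y).ne'
  rw [this, Set.univ_inter]
  exact K.volume_kBall_pos z

end SymmConvexBody

theorem integral_pos_of_forall_pos {g : EuclideanSpace ℝ (Fin n) → ℝ} (hg : Integrable g)
    (hpos : ∀ y, 0 < g y) : 0 < ∫ y, g y := by
  refine (integral_pos_iff_support_of_nonneg (fun y => (hpos y).le) hg).2 ?_
  have : Function.support g = Set.univ := Set.eq_univ_of_forall fun y => (hpos y).ne'
  rw [this]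
  exact Measure.measure_univ_pos.2 (NeZero.ne _)

/-- A strictly positive integrable weight on `ℝⁿ` that is bounded below on bounded sets. -/
noncomputable def decayWeight (n : ℕ) (x : EuclideanSpace ℝ (Fin n)) : ℝ :=
  (1 + ‖x‖) ^ (-((n : ℝ) + 1))

theorem decayWeight_pos (x : EuclideanSpace ℝ (Fin n)) : 0 < decayWeight n x :=
  Real.rpow_pos_of_pos (by positivity) _

theorem integrable_decayWeight : Integrable (decayWeight n) :=
  integrable_one_add_norm (by rw [finrank_euclideanSpace_fin]; linarith)

theorem le_decayWeight {x : EuclideanSpace ℝ (Fin n)} {R : ℝ} (hx : ‖x‖ ≤ R) :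
    (1 + R) ^ (-((n : ℝ) + 1)) ≤ decayWeight n x :=
  Real.rpow_le_rpow_of_nonpos (by positivity) (by linarith) (by linarith [Nat.cast_nonneg (α := ℝ) n])

/-- The normalized indicators of small balls around `y` form an approximate identity; their ball
integrals converge to the indicator of the cone with vertex `y`, off its boundary. -/
theorem exists_approx_identity (y : EuclideanSpace ℝ (Fin n)) :
    ∃ g : ℕ → EuclideanSpace ℝ (Fin n) → ℝ, (∀ k x, 0 ≤ g k x) ∧ (∀ k, Integrable (g k)) ∧
      (∀ k, ∫ x, g k x = 1) ∧ (∀ k, ∃ c : ℝ, ∀ x, g k x ≤ c * decayWeight n x) ∧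
      ∀ z : UpperHalf n, K.kNorm (y - z.1) ≠ z.2 →
        Tendsto (fun k => K.ballIntegral (g k) z) atTop
          (𝓝 ((K.cone y).indicator (fun _ => (1 : ℝ)) z)) := by
  let r : ℕ → ℝ := fun k => 1 / ((k : ℝ) + 1)
  have hr : ∀ k, 0 < r k := fun k => by positivity
  let V : ℕ → ℝ := fun k => volume.real (Metric.ball y (r k))
  have hV : ∀ k, 0 < V k := fun k =>
    ENNReal.toReal_pos (Metric.measure_ball_pos volume y (hr k)).ne' measure_ball_lt_top.ne
  let g : ℕ → EuclideanSpace ℝ (Fin n) → ℝ := fun k =>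
    (Metric.ball y (r k)).indicator fun _ => (V k)⁻¹
  have hint : ∀ k, Integrable (g k) := fun k =>
    (integrable_indicator_iff Metric.isOpen_ball.measurableSet).2
      (integrableOn_const measure_ball_lt_top.ne)
  have h1 : ∀ k, ∫ x, g k x = 1 := fun k => by
    rw [integral_indicator Metric.isOpen_ball.measurableSet, setIntegral_const, smul_eq_mul]
    exact mul_inv_cancel₀ (hV k).ne'
  refine ⟨g, fun k x => Set.indicator_nonneg (fun _ _ => (inv_pos.2 (hV k)).le) x, hint, h1, ?_, ?_⟩
  · intro k
    set d : ℝ := (1 + (‖y‖ + r k)) ^ (-((n : ℝ) + 1)) with hd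
    have hdpos : 0 < d := Real.rpow_pos_of_pos (by have := hr k; positivity) _
    refine ⟨(V k)⁻¹ / d, fun x => ?_⟩
    by_cases hx : x ∈ Metric.ball y (r k)
    · simp only [g, Set.indicator_of_mem hx]
      have hxn : ‖x‖ ≤ ‖y‖ + r k := by
        have h2 : ‖x - y‖ < r k := by rwa [← dist_eq_norm]
        calc ‖x‖ = ‖y + (x - y)‖ := by rw [add_sub_cancel]
          _ ≤ ‖y‖ + ‖x - y‖ := norm_add_le _ _
          _ ≤ _ := by linarith
      calc (V k)⁻¹ = (V k)⁻¹ / d * d := (div_mul_cancel₀ _ hdpos.ne').symm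
        _ ≤ _ := mul_le_mul_of_nonneg_left (le_decayWeight hxn)
          (div_nonneg (inv_pos.2 (hV k)).le hdpos.le)
    · simp only [g, Set.indicator_of_notMem hx]
      exact mul_nonneg (div_nonneg (inv_pos.2 (hV k)).le hdpos.le) (decayWeight_pos x).le
  · intro z hz
    have hev : ∀ᶠ x in 𝓝 y, (x ∈ K.kBall z ↔ y ∈ K.kBall z) :=
      (Continuous.tendsto' (by fun_prop : Continuous fun x : EuclideanSpace ℝ (Fin n) => (x, z)) y
        (y, z) rfl).eventually (K.eventually_mem_kBall_iff hz)
    obtain ⟨ε, hε, hball⟩ := Metric.eventually_nhds_iff_ball.1 hev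
    have hrlim : ∀ᶠ k in atTop, r k < ε :=
      tendsto_one_div_add_atTop_nhds_zero_nat.eventually (gt_mem_nhds hε)
    refine tendsto_const_nhds.congr' ?_
    filter_upwards [hrlim] with k hk
    have hsub : ∀ x ∈ Metric.ball y (r k), (x ∈ K.kBall z ↔ y ∈ K.kBall z) := fun x hx =>
      hball x (Metric.ball_subset_ball hk.le hx)
    by_cases hyz : y ∈ K.kBall z
    · have hyc : z ∈ K.cone y := hyz
      rw [Set.indicator_of_mem hyc, ← h1 k]
      refine (setIntegral_eq_integral_of_forall_compl_eq_zero fun x hx => ?_).symm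
      exact Set.indicator_of_notMem (fun hx2 => hx ((hsub x hx2).2 hyz)) _
    · have hyc : z ∉ K.cone y := hyz
      rw [Set.indicator_of_notMem hyc]
      refine (setIntegral_eq_zero_of_forall_eq_zero fun x hx => ?_).symm
      exact Set.indicator_of_notMem (fun hx2 => hyz ((hsub x hx2).1 hx)) _

end TentDuality

/-! ### The pairing of `T^p(K)` and `V^{p'}(K)` -/

namespace TentDuality

variable {𝕜 : Type*} [RCLike 𝕜] {n : ℕ} (K : SymmConvexBody n)

theorem lintegral_mul_le_eLpNorm_mul_eLpNorm {α : Type*} [MeasurableSpace α] {μ : Measure α}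
    {p q : ℝ≥0∞} [hpq : p.HolderConjugate q] {a h : α → 𝕜} (ha : AEStronglyMeasurable a μ)
    (hh : AEStronglyMeasurable h μ) :
    ∫⁻ z, ‖a z * h z‖ₑ ∂μ ≤ eLpNorm a q μ * eLpNorm h p μ := by
  have : q.HolderConjugate p := hpq.symm
  have h1 := eLpNorm_smul_le_mul_eLpNorm (p := q) (q := p) (r := 1) hh ha
  rw [eLpNorm_one_eq_lintegral_enorm] at h1
  exact h1

/-- Tonelli's theorem and Hölder's inequality on each cone: the profile of an atom pairs with the
tent norm. -/
theorem lintegral_atom_mul_le {p q : ℝ≥0∞} [p.HolderConjugate q] {a h : UpperHalf n → 𝕜}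
    {g : EuclideanSpace ℝ (Fin n) → 𝕜} (ha : AEStronglyMeasurable a)
    (hh : AEStronglyMeasurable h) (hg : AEStronglyMeasurable g) :
    ∫⁻ z, ‖a z * K.ballIntegral g z * h z‖ₑ ≤
      (∫⁻ y, ‖g y‖ₑ) * eLpNorm a q volume * tentENorm K p h := by
  let S : Set (UpperHalf n × EuclideanSpace ℝ (Fin n)) := {w | w.1 ∈ K.cone w.2}
  have hS : MeasurableSet S := by
    refine (isClosed_le (f := fun w : UpperHalf n × EuclideanSpace ℝ (Fin n) =>
      K.kNorm (w.2 - w.1.1)) (g := fun w => (w.1.2 : ℝ)) ?_ ?_).measurableSet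
    · exact K.continuous_kNorm.comp (continuous_snd.sub (continuous_fst.comp continuous_fst))
    · exact SymmConvexBody.continuous_height.comp continuous_fst
  let f : UpperHalf n → EuclideanSpace ℝ (Fin n) → ℝ≥0∞ := fun z y =>
    S.indicator (fun w => ‖a w.1 * h w.1‖ₑ * ‖g w.2‖ₑ) (z, y)
  have hf : AEMeasurable (Function.uncurry f)
      ((volume : Measure (UpperHalf n)).prod (volume : Measure (EuclideanSpace ℝ (Fin n)))) := by
    have : Function.uncurry f = S.indicator (fun w => ‖a w.1 * h w.1‖ₑ * ‖g w.2‖ₑ) := by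
      ext ⟨z, y⟩; rfl
    rw [this]
    exact ((ha.mul hh).enorm.comp_fst.mul hg.enorm.comp_snd).indicator hS
  calc ∫⁻ z, ‖a z * K.ballIntegral g z * h z‖ₑ
      ≤ ∫⁻ z, ∫⁻ y, f z y := by
        refine lintegral_mono fun z => ?_
        calc ‖a z * K.ballIntegral g z * h z‖ₑ
            = ‖a z * h z‖ₑ * ‖K.ballIntegral g z‖ₑ := by rw [mul_right_comm, enorm_mul]
          _ ≤ ‖a z * h z‖ₑ * ∫⁻ y in K.kBall z, ‖g y‖ₑ := by
              gcongr
              exact K.enorm_ballIntegral_le g z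
          _ = ∫⁻ y, f z y := by
              rw [← lintegral_indicator (K.measurableSet_kBall z),
                ← lintegral_const_mul' _ _ enorm_ne_top]
              refine lintegral_congr fun y => ?_
              by_cases hy : y ∈ K.kBall z
              · have hy' : (z, y) ∈ S := hy
                simp only [f, Set.indicator_of_mem hy, Set.indicator_of_mem hy']
              · have hy' : (z, y) ∉ S := hy
                simp only [f, Set.indicator_of_notMem hy, Set.indicator_of_notMem hy', mul_zero]
    _ = ∫⁻ y, ∫⁻ z, f z y := lintegral_lintegral_swap hf
    _ ≤ ∫⁻ y, ‖g y‖ₑ * (eLpNorm a q volume * tentENorm K p h) := by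
        refine lintegral_mono_ae ?_
        filter_upwards [ENNReal.ae_le_essSup
          (fun x => eLpNorm h p (volume.restrict (K.cone x)))] with y hy
        have h1 : ∫⁻ z, f z y = ‖g y‖ₑ * ∫⁻ z in K.cone y, ‖a z * h z‖ₑ := by
          rw [← lintegral_indicator (K.measurableSet_cone y),
            ← lintegral_const_mul' _ _ enorm_ne_top]
          refine lintegral_congr fun z => ?_
          by_cases hz : z ∈ K.cone y
          · have hz' : (z, y) ∈ S := hz
            simp only [f, Set.indicator_of_mem hz, Set.indicator_of_mem hz', mul_comm]
          · have hz' : (z, y) ∉ S := hz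
            simp only [f, Set.indicator_of_notMem hz, Set.indicator_of_notMem hz', mul_zero]
        rw [h1]
        gcongr
        refine (lintegral_mul_le_eLpNorm_mul_eLpNorm (p := p) (q := q) ha.restrict
          hh.restrict).trans ?_
        exact mul_le_mul' (eLpNorm_mono_measure _ Measure.restrict_le_self) hy
    _ = _ := by
        rw [lintegral_mul_const'' _ hg.enorm, mul_assoc]

theorem tentENorm_congr_ae {p : ℝ≥0∞} {f g : UpperHalf n → 𝕜} (h : f =ᵐ[volume] g) :
    tentENorm K p f = tentENorm K p g := by
  unfold tentENorm
  congr 1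
  ext x
  exact eLpNorm_congr_ae (ae_restrict_of_ae h)

theorem tentENorm_le_eLpNorm {p : ℝ≥0∞} (f : UpperHalf n → 𝕜) :
    tentENorm K p f ≤ eLpNorm f p volume :=
  essSup_le_of_ae_le _ (Eventually.of_forall fun _ => eLpNorm_mono_measure _ Measure.restrict_le_self)

theorem vENorm_congr_ae {p : ℝ≥0∞} [Fact (1 ≤ p)] {f g : UpperHalf n → 𝕜} (h : f =ᵐ[volume] g) :
    vENorm K p f = vENorm K p g := by
  unfold vENorm
  refine iSup_congr fun k => iSup_congr fun _ => lintegral_congr_ae ?_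
  filter_upwards [h] with z hz
  rw [hz]

variable {K}

theorem TentSpace.tentENorm_eq {p : ℝ≥0∞} [Fact (1 ≤ p)] (g : TentSpace 𝕜 K p) :
    tentENorm K p g.toFun = ‖g‖ₑ := by
  rw [← ofReal_norm]
  exact (ENNReal.ofReal_toReal (Subtype.prop g).2.ne).symm

/-- The element of `T^p(K)` given by a locally integrable function of finite tent norm. -/
noncomputable def TentSpace.mk {p : ℝ≥0∞} [Fact (1 ≤ p)] (h : UpperHalf n → 𝕜)
    (hloc : LocallyIntegrable h volume) (hfin : tentENorm K p h < ⊤) : TentSpace 𝕜 K p :=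
  ⟨AEEqFun.mk h hloc.aestronglyMeasurable, hloc.congr (AEEqFun.coeFn_mk _ _).symm, by
    rwa [tentENorm_congr_ae K (AEEqFun.coeFn_mk _ _)]⟩

theorem TentSpace.toFun_mk {p : ℝ≥0∞} [Fact (1 ≤ p)] (h : UpperHalf n → 𝕜)
    (hloc : LocallyIntegrable h volume) (hfin : tentENorm K p h < ⊤) :
    (TentSpace.mk h hloc hfin).toFun =ᵐ[volume] h :=
  AEEqFun.coeFn_mk _ _

theorem TentSpace.toFun_smul {p : ℝ≥0∞} [Fact (1 ≤ p)] (c : 𝕜) (g : TentSpace 𝕜 K p) :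
    (c • g).toFun =ᵐ[volume] fun z => c * g.toFun z :=
  AEEqFun.coeFn_smul c g.toFun

theorem TentSpace.toFun_add {p : ℝ≥0∞} [Fact (1 ≤ p)] (f g : TentSpace 𝕜 K p) :
    (f + g).toFun =ᵐ[volume] fun z => f.toFun z + g.toFun z :=
  AEEqFun.coeFn_add f.toFun g.toFun

theorem lintegral_mul_le_vENorm {p : ℝ≥0∞} [Fact (1 ≤ p)] (f : UpperHalf n → 𝕜)
    (g : TentSpace 𝕜 K p) : ∫⁻ z, ‖f z * g.toFun z‖ₑ ≤ vENorm K p f * ‖g‖ₑ := by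
  rcases eq_or_ne g 0 with rfl | hg
  · have h0 : (0 : TentSpace 𝕜 K p).toFun =ᵐ[volume] (0 : UpperHalf n → 𝕜) := AEEqFun.coeFn_zero
    have h1 : ∫⁻ z, ‖f z * (0 : TentSpace 𝕜 K p).toFun z‖ₑ = ∫⁻ _ : UpperHalf n, 0 := by
      refine lintegral_congr_ae ?_
      filter_upwards [h0] with z hz
      rw [hz, Pi.zero_apply, mul_zero, enorm_zero]
    rw [h1, lintegral_zero]
    exact zero_le
  · have hpos : 0 < ‖g‖ := norm_pos_iff.2 hg
    set c : 𝕜 := ((‖g‖⁻¹ : ℝ) : 𝕜) with hc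
    have hcn : ‖c‖ = ‖g‖⁻¹ := by rw [hc, RCLike.norm_ofReal, abs_of_pos (inv_pos.2 hpos)]
    have hcg : ‖c • g‖ ≤ 1 := by rw [norm_smul, hcn, inv_mul_cancel₀ hpos.ne']
    have h1 : ∫⁻ z, ‖f z * (c • g).toFun z‖ₑ ≤ vENorm K p f :=
      le_iSup₂ (f := fun (g : TentSpace 𝕜 K p) (_ : ‖g‖ ≤ 1) => ∫⁻ z, ‖f z * g.toFun z‖ₑ) (c • g) hcg
    have h2 : ∫⁻ z, ‖f z * (c • g).toFun z‖ₑ = ‖c‖ₑ * ∫⁻ z, ‖f z * g.toFun z‖ₑ := by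
      rw [← lintegral_const_mul' _ _ enorm_ne_top]
      refine lintegral_congr_ae ?_
      filter_upwards [TentSpace.toFun_smul c g] with z hz
      rw [hz, mul_left_comm, enorm_mul]
    rw [h2] at h1
    have h3 : ‖g‖ₑ * ‖c‖ₑ = 1 := by
      rw [← ofReal_norm, ← ofReal_norm, ← ENNReal.ofReal_mul (norm_nonneg _), hcn,
        mul_inv_cancel₀ hpos.ne', ENNReal.ofReal_one]
    calc ∫⁻ z, ‖f z * g.toFun z‖ₑ = ‖g‖ₑ * (‖c‖ₑ * ∫⁻ z, ‖f z * g.toFun z‖ₑ) := by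
          rw [← mul_assoc, h3, one_mul]
      _ ≤ ‖g‖ₑ * vENorm K p f := by gcongr
      _ = _ := mul_comm _ _

theorem vENorm_le_of_ae_eq_atom {p q : ℝ≥0∞} [Fact (1 ≤ p)] [p.HolderConjugate q]
    {a f : UpperHalf n → 𝕜} {g : EuclideanSpace ℝ (Fin n) → 𝕜} (ha : AEStronglyMeasurable a)
    (hg : AEStronglyMeasurable g) (hf : f =ᵐ[volume] fun z => a z * K.ballIntegral g z) :
    vENorm K p f ≤ (∫⁻ y, ‖g y‖ₑ) * eLpNorm a q volume := by
  rw [vENorm_congr_ae K hf]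
  refine iSup₂_le fun h hh => ?_
  refine (lintegral_atom_mul_le K (p := p) (q := q) ha h.toFun.aestronglyMeasurable hg).trans ?_
  rw [h.tentENorm_eq]
  refine mul_le_of_le_one_right zero_le ?_
  rwa [← ofReal_norm, ENNReal.ofReal_le_one]

/-- `V^{p'}(K)` embeds contractively in `L^{p'}` of the whole half-space. -/
theorem eLpNorm_le_vENorm {p q : ℝ≥0∞} [Fact (1 ≤ p)] [hpq : p.HolderConjugate q] (hp : p ≠ ⊤)
    (hq : q ≠ ⊤) {f : UpperHalf n → 𝕜} (hf : AEStronglyMeasurable f) :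
    eLpNorm f q volume ≤ vENorm K p f := by
  have : q.HolderConjugate p := hpq.symm
  refine eLpNorm_le_of_forall_lintegral_mul_le (p := q) (q := p) hq hp hf fun a ha => ?_
  have hfin : tentENorm K p a < ⊤ := (tentENorm_le_eLpNorm K a).trans_lt ha.2
  let g : TentSpace 𝕜 K p := TentSpace.mk a (ha.locallyIntegrable Fact.out) hfin
  have hga : g.toFun =ᵐ[volume] a := TentSpace.toFun_mk _ _ _
  calc ∫⁻ z, ‖a z * f z‖ₑ = ∫⁻ z, ‖f z * g.toFun z‖ₑ := by
        refine lintegral_congr_ae ?_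
        filter_upwards [hga] with z hz
        rw [hz, mul_comm]
    _ ≤ vENorm K p f * ‖g‖ₑ := lintegral_mul_le_vENorm f g
    _ ≤ vENorm K p f * eLpNorm a p volume := by
        rw [← g.tentENorm_eq, tentENorm_congr_ae K hga]
        gcongr
        exact tentENorm_le_eLpNorm K a

theorem conjExponent_ne_top {p : ℝ≥0∞} (hp1 : 1 < p) : p.conjExponent ≠ ⊤ := by
  rw [ENNReal.conjExponent]
  exact ENNReal.add_ne_top.2 ⟨ENNReal.one_ne_top, ENNReal.inv_ne_top.2 (tsub_pos_of_lt hp1).ne'⟩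

variable {p : ℝ≥0∞} [Fact (1 ≤ p)]

theorem VSpace.vENorm_eq (f : VSpace 𝕜 K p) : vENorm K p f.toFun = ‖f‖ₑ := by
  rw [← ofReal_norm]
  exact (ENNReal.ofReal_toReal (Subtype.prop f).2.ne).symm

omit [Fact (1 ≤ p)] in
instance : Fact (1 ≤ p.conjExponent) := ⟨by rw [ENNReal.conjExponent]; exact le_self_add⟩

/-- The element of `V^{p'}(K)` given by a measurable function of finite norm. -/
noncomputable def VSpace.mk (hp1 : 1 < p) (hp : p ≠ ⊤) (f : UpperHalf n → 𝕜)
    (hf : AEStronglyMeasurable f) (hfin : vENorm K p f < ⊤) : VSpace 𝕜 K p :=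
  ⟨AEEqFun.mk f hf, by
    refine ⟨fun O _ => ?_, by rwa [vENorm_congr_ae K (AEEqFun.coeFn_mk f hf)]⟩
    have h : MemLp f p.conjExponent volume :=
      ⟨hf, (eLpNorm_le_vENorm hp (conjExponent_ne_top hp1) hf).trans_lt hfin⟩
    exact (h.ae_eq (AEEqFun.coeFn_mk f hf).symm).restrict O⟩

theorem VSpace.toFun_mk (hp1 : 1 < p) (hp : p ≠ ⊤) (f : UpperHalf n → 𝕜)
    (hf : AEStronglyMeasurable f) (hfin : vENorm K p f < ⊤) :
    (VSpace.mk hp1 hp f hf hfin).toFun =ᵐ[volume] f :=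
  AEEqFun.coeFn_mk f hf

theorem VSpace.enorm_mk (hp1 : 1 < p) (hp : p ≠ ⊤) (f : UpperHalf n → 𝕜)
    (hf : AEStronglyMeasurable f) (hfin : vENorm K p f < ⊤) :
    ‖VSpace.mk hp1 hp f hf hfin‖ₑ = vENorm K p f := by
  rw [← VSpace.vENorm_eq, vENorm_congr_ae K (VSpace.toFun_mk hp1 hp f hf hfin)]

theorem VSpace.ext_ae {f g : VSpace 𝕜 K p} (h : f.toFun =ᵐ[volume] g.toFun) : f = g :=
  Subtype.ext (AEEqFun.ext h)

theorem VSpace.toFun_smul (c : 𝕜) (f : VSpace 𝕜 K p) :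
    (c • f).toFun =ᵐ[volume] fun z => c * f.toFun z :=
  AEEqFun.coeFn_smul c f.toFun

theorem VSpace.toFun_add (f g : VSpace 𝕜 K p) :
    (f + g).toFun =ᵐ[volume] fun z => f.toFun z + g.toFun z :=
  AEEqFun.coeFn_add f.toFun g.toFun

theorem VSpace.toFun_sub (f g : VSpace 𝕜 K p) :
    (f - g).toFun =ᵐ[volume] fun z => f.toFun z - g.toFun z :=
  AEEqFun.coeFn_sub f.toFun g.toFun

theorem VSpace.toFun_zero : (0 : VSpace 𝕜 K p).toFun =ᵐ[volume] (0 : UpperHalf n → 𝕜) :=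
  AEEqFun.coeFn_zero

theorem VSpace.eLpNorm_le (hp1 : 1 < p) (hp : p ≠ ⊤) (f : VSpace 𝕜 K p) :
    eLpNorm f.toFun p.conjExponent volume ≤ ‖f‖ₑ := by
  rw [← VSpace.vENorm_eq]
  exact eLpNorm_le_vENorm hp (conjExponent_ne_top hp1) f.toFun.aestronglyMeasurable

theorem VSpace.memLp (hp1 : 1 < p) (hp : p ≠ ⊤) (f : VSpace 𝕜 K p) :
    MemLp f.toFun p.conjExponent volume :=
  ⟨f.toFun.aestronglyMeasurable, (f.eLpNorm_le hp1 hp).trans_lt enorm_lt_top⟩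

theorem vENorm_le_of_tendsto_ae {f : ℕ → UpperHalf n → 𝕜} {F : UpperHalf n → 𝕜} {R : ℝ≥0∞}
    (hf : ∀ i, AEStronglyMeasurable (f i)) (hR : ∀ᶠ i in atTop, vENorm K p (f i) ≤ R)
    (hlim : ∀ᵐ z, Tendsto (fun i => f i z) atTop (𝓝 (F z))) : vENorm K p F ≤ R := by
  refine iSup₂_le fun g hg => ?_
  calc ∫⁻ z, ‖F z * g.toFun z‖ₑ
      ≤ ∫⁻ z, liminf (fun i => ‖f i z * g.toFun z‖ₑ) atTop := by
        refine lintegral_mono_ae ?_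
        filter_upwards [hlim] with z hz
        exact (hz.mul_const _).enorm.liminf_eq.ge
    _ ≤ liminf (fun i => ∫⁻ z, ‖f i z * g.toFun z‖ₑ) atTop :=
        lintegral_liminf_le' fun i => ((hf i).mul g.toFun.aestronglyMeasurable).enorm
    _ ≤ R := by
        refine liminf_le_of_frequently_le' (Eventually.frequently ?_)
        filter_upwards [hR] with i hi
        refine le_trans ?_ hi
        exact le_iSup₂ (f := fun (g : TentSpace 𝕜 K p) (_ : ‖g‖ ≤ 1) =>
          ∫⁻ z, ‖f i z * g.toFun z‖ₑ) g hg

/-- A Cauchy sequence in `V^{p'}(K)` converges in `L^{p'}`; Fatou's lemma upgrades the convergence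
to the norm of `V^{p'}(K)`. -/
theorem VSpace.completeSpace (hp1 : 1 < p) (hp : p ≠ ⊤) : CompleteSpace (VSpace 𝕜 K p) := by
  refine Metric.complete_of_cauchySeq_tendsto fun u hu => ?_
  have hLp : CauchySeq fun k => ((u k).memLp hp1 hp).toLp _ := by
    refine Metric.cauchySeq_iff'.2 fun ε hε => ?_
    obtain ⟨N, hN⟩ := Metric.cauchySeq_iff'.1 hu ε hε
    refine ⟨N, fun k hk => lt_of_le_of_lt ?_ (hN k hk)⟩
    rw [Lp.dist_edist, Lp.edist_toLp_toLp, dist_eq_norm, ← toReal_enorm]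
    refine ENNReal.toReal_mono enorm_ne_top ?_
    refine le_trans (le_of_eq (eLpNorm_congr_ae ?_)) ((u k - u N).eLpNorm_le hp1 hp)
    exact (VSpace.toFun_sub _ _).symm
  obtain ⟨F, hF⟩ := cauchySeq_tendsto_of_complete hLp
  obtain ⟨ns, hmono, hns⟩ := (tendstoInMeasure_of_tendsto_Lp hF).exists_seq_tendsto_ae
  have hcoe : ∀ᵐ z, ∀ k, ((u k).memLp hp1 hp).toLp _ z = (u k).toFun z :=
    ae_all_iff.2 fun k => ((u k).memLp hp1 hp).coeFn_toLp
  have hae : ∀ᵐ z, Tendsto (fun i => (u (ns i)).toFun z) atTop (𝓝 (F z)) := by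
    filter_upwards [hns, hcoe] with z hz hz2
    exact hz.congr fun i => hz2 (ns i)
  have hFm : AEStronglyMeasurable (F : UpperHalf n → 𝕜) := Lp.aestronglyMeasurable F
  have hsub : ∀ ε > 0, ∃ N, ∀ k ≥ N,
      vENorm K p (fun z => F z - (u k).toFun z) ≤ ENNReal.ofReal ε := by
    intro ε hε
    obtain ⟨N, hN⟩ := Metric.cauchySeq_iff.1 hu ε hε
    refine ⟨N, fun k hk => vENorm_le_of_tendsto_ae (f := fun i => (u (ns i) - u k).toFun)
      (fun i => AEEqFun.aestronglyMeasurable _) ?_ ?_⟩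
    · filter_upwards [hmono.tendsto_atTop.eventually_ge_atTop N] with i hi
      rw [VSpace.vENorm_eq, ← ofReal_norm, ← dist_eq_norm]
      exact ENNReal.ofReal_le_ofReal (hN _ hi _ hk).le
    · filter_upwards [hae, ae_all_iff.2 fun i => VSpace.toFun_sub (u (ns i)) (u k)] with z h1 h2
      simp only [h2]
      exact h1.sub_const _
  obtain ⟨N, hN⟩ := hsub 1 one_pos
  have hdm : ∀ k, AEStronglyMeasurable (fun z => F z - (u k).toFun z) (volume : Measure (UpperHalf n)) :=
    fun k => hFm.sub (AEEqFun.aestronglyMeasurable _)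
  have hdfin : vENorm K p (fun z => F z - (u N).toFun z) < ⊤ :=
    (hN N le_rfl).trans_lt ENNReal.ofReal_lt_top
  let d : VSpace 𝕜 K p := VSpace.mk hp1 hp _ (hdm N) hdfin
  have hd : (d + u N).toFun =ᵐ[volume] F := by
    filter_upwards [VSpace.toFun_add d (u N), VSpace.toFun_mk hp1 hp _ (hdm N) hdfin] with z h1 h2
    rw [h1, h2, sub_add_cancel]
  refine ⟨d + u N, Metric.tendsto_atTop.2 fun ε hε => ?_⟩
  obtain ⟨M, hM⟩ := hsub (ε / 2) (half_pos hε)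
  refine ⟨M, fun k hk => ?_⟩
  rw [dist_comm, dist_eq_norm]
  refine lt_of_le_of_lt ?_ (half_lt_self hε)
  rw [← ENNReal.ofReal_le_ofReal_iff (half_pos hε).le, ofReal_norm, ← VSpace.vENorm_eq]
  refine le_trans (le_of_eq (vENorm_congr_ae K ?_)) (hM k hk)
  filter_upwards [VSpace.toFun_sub (d + u N) (u k), hd] with z h1 h2
  rw [h1, h2]

end TentDuality

/-! ### Atoms in `U^{p'}(K)` -/

namespace TentDuality

variable {𝕜 : Type*} [RCLike 𝕜] {n : ℕ} {K : SymmConvexBody n} {p : ℝ≥0∞} [Fact (1 ≤ p)]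

/-- The function `(x, t) ↦ a(x, t) ∫_{B(x,t)} g` as an element of `V^{p'}(K)`. -/
noncomputable def VSpace.atom (K : SymmConvexBody n) (hp1 : 1 < p) (hp : p ≠ ⊤)
    {a : UpperHalf n → 𝕜} {g : EuclideanSpace ℝ (Fin n) → 𝕜} (ha : MemLp a p.conjExponent volume)
    (hg : Integrable g) : VSpace 𝕜 K p :=
  VSpace.mk hp1 hp (fun z => a z * K.ballIntegral g z)
    (ha.1.mul (K.continuous_ballIntegral hg).aestronglyMeasurable)
    ((vENorm_le_of_ae_eq_atom (q := p.conjExponent) ha.1 hg.1 (ae_eq_refl _)).trans_lt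
      (ENNReal.mul_lt_top hg.2 ha.2))

theorem VSpace.toFun_atom (hp1 : 1 < p) (hp : p ≠ ⊤)
    {a : UpperHalf n → 𝕜} {g : EuclideanSpace ℝ (Fin n) → 𝕜} (ha : MemLp a p.conjExponent volume)
    (hg : Integrable g) :
    (VSpace.atom K hp1 hp ha hg).toFun =ᵐ[volume] fun z => a z * K.ballIntegral g z :=
  VSpace.toFun_mk _ _ _ _ _

theorem VSpace.enorm_atom_le (hp1 : 1 < p) (hp : p ≠ ⊤)
    {a : UpperHalf n → 𝕜} {g : EuclideanSpace ℝ (Fin n) → 𝕜} (ha : MemLp a p.conjExponent volume)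
    (hg : Integrable g) :
    ‖VSpace.atom K hp1 hp ha hg‖ₑ ≤ (∫⁻ y, ‖g y‖ₑ) * eLpNorm a p.conjExponent volume := by
  rw [VSpace.atom, VSpace.enorm_mk]
  exact vENorm_le_of_ae_eq_atom ha.1 hg.1 (ae_eq_refl _)

/-- The positive continuous function `(x, t) ↦ ∫_{B(x,t)} (1 + |y|)^{-n-1} dy`. -/
noncomputable def decayIntegral (𝕜 : Type*) [RCLike 𝕜] (K : SymmConvexBody n) (z : UpperHalf n) : 𝕜 :=
  K.ballIntegral (fun y => (decayWeight n y : 𝕜)) z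

theorem integrable_ofReal_decayWeight :
    Integrable fun y : EuclideanSpace ℝ (Fin n) => (decayWeight n y : 𝕜) :=
  integrable_decayWeight.ofReal

theorem decayIntegral_eq (z : UpperHalf n) :
    decayIntegral 𝕜 K z = ((K.ballIntegral (decayWeight n) z : ℝ) : 𝕜) :=
  K.ballIntegral_ofReal _ z

theorem decayIntegral_ne_zero (z : UpperHalf n) : decayIntegral 𝕜 K z ≠ 0 := by
  rw [decayIntegral_eq]
  exact_mod_cast (K.ballIntegral_pos integrable_decayWeight decayWeight_pos z).ne'

theorem continuous_decayIntegral : Continuous (decayIntegral 𝕜 K) :=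
  K.continuous_ballIntegral integrable_ofReal_decayWeight

theorem hasCompactSupport_div_decayIntegral {φ : UpperHalf n → 𝕜} (hφ : HasCompactSupport φ) :
    HasCompactSupport fun z => φ z / decayIntegral 𝕜 K z := by
  simp only [div_eq_mul_inv]
  exact hφ.mul_right

theorem memLp_div_decayIntegral {φ : UpperHalf n → 𝕜} (hc : Continuous φ)
    (hφ : HasCompactSupport φ) (q : ℝ≥0∞) :
    MemLp (fun z => φ z / decayIntegral 𝕜 K z) q volume :=
  (hc.div continuous_decayIntegral decayIntegral_ne_zero).memLp_of_hasCompactSupport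
    (hasCompactSupport_div_decayIntegral hφ)

/-- Every continuous function with compact support is an atom, up to normalization. -/
theorem VSpace.atom_div_decayIntegral_ae_eq (hp1 : 1 < p) (hp : p ≠ ⊤) {φ : UpperHalf n → 𝕜}
    (hc : Continuous φ) (hφ : HasCompactSupport φ) :
    (VSpace.atom K hp1 hp (memLp_div_decayIntegral (K := K) hc hφ p.conjExponent)
      integrable_ofReal_decayWeight).toFun =ᵐ[volume] φ := by
  filter_upwards [VSpace.toFun_atom (K := K) hp1 hp
    (memLp_div_decayIntegral (K := K) hc hφ p.conjExponent) integrable_ofReal_decayWeight] with z hz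
  rw [hz]
  exact div_mul_cancel₀ _ (decayIntegral_ne_zero z)

theorem VSpace.exists_mem_vCc (hp1 : 1 < p) (hp : p ≠ ⊤) {φ : UpperHalf n → 𝕜}
    (hc : Continuous φ) (hφ : HasCompactSupport φ) :
    ∃ v ∈ vCc 𝕜 K p, v.toFun =ᵐ[volume] φ :=
  have h := VSpace.atom_div_decayIntegral_ae_eq (K := K) hp1 hp hc hφ
  ⟨_, ⟨⟨⟨φ, hc⟩, hφ⟩, h⟩, h⟩

/-- An `L^{p'}` profile is approximated by profiles in `C_c`, and ball integrals are continuous, so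
atoms belong to the closure of `C_c`. -/
theorem VSpace.atom_mem (hp1 : 1 < p) (hp : p ≠ ⊤)
    {a : UpperHalf n → 𝕜} {g : EuclideanSpace ℝ (Fin n) → 𝕜} (ha : MemLp a p.conjExponent volume)
    (hg : Integrable g) : VSpace.atom K hp1 hp ha hg ∈ USpace 𝕜 K p := by
  refine Metric.mem_closure_iff.2 fun ε hε => ?_
  obtain ⟨δ, hδ, hδε⟩ := ENNReal.exists_nnreal_pos_mul_lt (a := ∫⁻ y, ‖g y‖ₑ) (b := ENNReal.ofReal ε)
    hg.2.ne (ENNReal.ofReal_pos.2 hε).ne'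
  obtain ⟨b, hbs, hab, hbc, hb⟩ := ha.exists_hasCompactSupport_eLpNorm_sub_le
    (conjExponent_ne_top hp1) (ENNReal.coe_pos.2 hδ).ne'
  obtain ⟨v, hv, hvb⟩ := VSpace.exists_mem_vCc (K := K) hp1 hp
    (hbc.mul (K.continuous_ballIntegral hg)) (hbs.mul_right (f' := K.ballIntegral g))
  refine ⟨v, hv, ?_⟩
  rw [dist_eq_norm, ← ENNReal.ofReal_lt_ofReal_iff hε, ofReal_norm, ← VSpace.vENorm_eq]
  refine lt_of_le_of_lt ?_ hδε
  refine (vENorm_le_of_ae_eq_atom (p := p) (q := p.conjExponent) (a := a - b) (g := g)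
    (ha.1.sub hb.1) hg.1 ?_).trans ?_
  · filter_upwards [VSpace.toFun_sub (VSpace.atom K hp1 hp ha hg) v, hvb,
      VSpace.toFun_atom (K := K) hp1 hp ha hg] with z h1 h2 h3
    rw [h1, h2, h3, Pi.sub_apply, sub_mul]
    rfl
  · rw [mul_comm]
    gcongr

/-- The function `(x, t) ↦ a(x, t) ∫_{B(x,t)} g` as an element of `U^{p'}(K)`. -/
noncomputable def USpace.atom (K : SymmConvexBody n) (hp1 : 1 < p) (hp : p ≠ ⊤)
    {a : UpperHalf n → 𝕜} {g : EuclideanSpace ℝ (Fin n) → 𝕜} (ha : MemLp a p.conjExponent volume)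
    (hg : Integrable g) : USpace 𝕜 K p :=
  ⟨VSpace.atom K hp1 hp ha hg, VSpace.atom_mem hp1 hp ha hg⟩

theorem USpace.toFun_atom (hp1 : 1 < p) (hp : p ≠ ⊤)
    {a : UpperHalf n → 𝕜} {g : EuclideanSpace ℝ (Fin n) → 𝕜} (ha : MemLp a p.conjExponent volume)
    (hg : Integrable g) :
    (USpace.atom K hp1 hp ha hg).1.toFun =ᵐ[volume] fun z => a z * K.ballIntegral g z :=
  VSpace.toFun_atom hp1 hp ha hg

theorem USpace.enorm_atom_le (hp1 : 1 < p) (hp : p ≠ ⊤)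
    {a : UpperHalf n → 𝕜} {g : EuclideanSpace ℝ (Fin n) → 𝕜} (ha : MemLp a p.conjExponent volume)
    (hg : Integrable g) :
    ‖USpace.atom K hp1 hp ha hg‖ₑ ≤ (∫⁻ y, ‖g y‖ₑ) * eLpNorm a p.conjExponent volume :=
  VSpace.enorm_atom_le hp1 hp ha hg

theorem USpace.ext_ae {u v : USpace 𝕜 K p} (h : u.1.toFun =ᵐ[volume] v.1.toFun) : u = v :=
  Subtype.ext (VSpace.ext_ae h)

theorem USpace.toFun_add (u v : USpace 𝕜 K p) :
    (u + v).1.toFun =ᵐ[volume] fun z => u.1.toFun z + v.1.toFun z :=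
  VSpace.toFun_add u.1 v.1

theorem USpace.toFun_smul (c : 𝕜) (u : USpace 𝕜 K p) :
    (c • u).1.toFun =ᵐ[volume] fun z => c * u.1.toFun z :=
  VSpace.toFun_smul c u.1

theorem USpace.completeSpace (hp1 : 1 < p) (hp : p ≠ ⊤) : CompleteSpace (USpace 𝕜 K p) :=
  have := VSpace.completeSpace (𝕜 := 𝕜) (K := K) hp1 hp
  (Submodule.isClosed_topologicalClosure (vCc 𝕜 K p)).completeSpace_coe

/-- Two continuous functionals on `U^{p'}(K)` that agree on the multiples of the function
`decayIntegral` by profiles in `L^{p'}` agree. -/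
theorem USpace.dual_ext (hp1 : 1 < p) (hp : p ≠ ⊤) {ℓ ℓ' : StrongDual 𝕜 (USpace 𝕜 K p)}
    (h : ∀ (a : UpperHalf n → 𝕜) (ha : MemLp a p.conjExponent volume),
      ℓ (USpace.atom K hp1 hp ha integrable_ofReal_decayWeight) =
        ℓ' (USpace.atom K hp1 hp ha integrable_ofReal_decayWeight)) : ℓ = ℓ' := by
  refine ContinuousLinearMap.ext fun u => ?_
  obtain ⟨v, hv, hvu⟩ := mem_closure_iff_seq_limit.1 u.2
  let w : ℕ → USpace 𝕜 K p := fun k => ⟨v k, subset_closure (hv k)⟩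
  have hw : Tendsto w atTop (𝓝 u) := tendsto_subtype_rng.2 hvu
  refine tendsto_nhds_unique ((ℓ.continuous.tendsto u).comp hw)
    (((ℓ'.continuous.tendsto u).comp hw).congr fun k => ?_)
  obtain ⟨φ, hφ⟩ := hv k
  have hφc : Continuous φ := φ.1.2
  have hφs : HasCompactSupport φ := φ.2
  have hwk : w k = USpace.atom K hp1 hp
      (memLp_div_decayIntegral (K := K) hφc hφs p.conjExponent) integrable_ofReal_decayWeight :=
    USpace.ext_ae (hφ.trans (VSpace.atom_div_decayIntegral_ae_eq hp1 hp hφc hφs).symm)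
  simp only [Function.comp_apply]
  rw [hwk, h]

/-! ### The dual of `U^{p'}(K)` -/

/-- Testing against the profiles times ball integrals of an approximate identity at `y` bounds the
`L^p` norm on the cone with vertex `y`. -/
theorem tentENorm_le_of_forall_lintegral_le (hp1 : 1 < p) (hp : p ≠ ⊤) {h : UpperHalf n → 𝕜}
    (hh : AEStronglyMeasurable h) {R : ℝ≥0∞}
    (H : ∀ (a : UpperHalf n → 𝕜) (g : EuclideanSpace ℝ (Fin n) → ℝ),
      MemLp a p.conjExponent volume → (∀ y, 0 ≤ g y) → Integrable g → ∫ y, g y = 1 →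
      (∃ c : ℝ, ∀ y, g y ≤ c * decayWeight n y) →
      ∫⁻ z, ‖a z * (((K.ballIntegral g z : ℝ) : 𝕜) * h z)‖ₑ ≤
        R * eLpNorm a p.conjExponent volume) :
    tentENorm K p h ≤ R := by
  refine essSup_le_of_ae_le _ (Eventually.of_forall fun y => ?_)
  obtain ⟨g, hg0, hgi, hg1, hgc, hlim⟩ := exists_approx_identity K y
  have hm : ∀ k, AEStronglyMeasurable (fun z => ((K.ballIntegral (g k) z : ℝ) : 𝕜) * h z) :=
    fun k => (RCLike.continuous_ofReal.comp
      (K.continuous_ballIntegral (hgi k))).aestronglyMeasurable.mul hh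
  have hk : ∀ k, eLpNorm (fun z => ((K.ballIntegral (g k) z : ℝ) : 𝕜) * h z) p volume ≤ R :=
    fun k => eLpNorm_le_of_forall_lintegral_mul_le hp (conjExponent_ne_top hp1) (hm k)
      fun a ha => H a (g k) ha (hg0 k) (hgi k) (hg1 k) (hgc k)
  change eLpNorm h p (volume.restrict (K.cone y)) ≤ R
  rw [← eLpNorm_indicator_eq_eLpNorm_restrict (K.measurableSet_cone y)]
  refine (Lp.eLpNorm_lim_le_liminf_eLpNorm hm _ ?_).trans
    (liminf_le_of_frequently_le' (Frequently.of_forall hk))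
  filter_upwards [K.ae_kNorm_sub_ne y] with z hz
  have h1 := (((RCLike.continuous_ofReal (K := 𝕜)).tendsto _).comp (hlim z hz)).mul_const (h z)
  have h2 : (K.cone y).indicator h z =
      (((K.cone y).indicator (fun _ => (1 : ℝ)) z : ℝ) : 𝕜) * h z := by
    by_cases hzc : z ∈ K.cone y <;> simp [hzc]
  rw [h2]
  exact h1

theorem tentENorm_le_of_dual (hp1 : 1 < p) (hp : p ≠ ⊤) (ℓ : StrongDual 𝕜 (USpace 𝕜 K p))
    {h : UpperHalf n → 𝕜} (hh : AEStronglyMeasurable h)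
    (hrep : ∀ (a : UpperHalf n → 𝕜) (ha : MemLp a p.conjExponent volume),
      Integrable (fun z => a z * decayIntegral 𝕜 K z * h z) ∧
        ℓ (USpace.atom K hp1 hp ha integrable_ofReal_decayWeight) =
          ∫ z, a z * decayIntegral 𝕜 K z * h z) {R : ℝ≥0∞}
    (hR : ∀ (a : UpperHalf n → 𝕜) (g : EuclideanSpace ℝ (Fin n) → 𝕜)
      (ha : MemLp a p.conjExponent volume) (hg : HasL1NormOne g),
      ‖ℓ (USpace.atom K hp1 hp ha hg.1)‖ₑ ≤ R * eLpNorm a p.conjExponent volume) :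
    tentENorm K p h ≤ R := by
  refine tentENorm_le_of_forall_lintegral_le hp1 hp hh fun a g ha hg0 hgi hg1 ⟨c, hc⟩ => ?_
  have hgi' : Integrable fun y => (g y : 𝕜) := hgi.ofReal
  have hgn : HasL1NormOne fun y => (g y : 𝕜) := by
    refine ⟨hgi', ?_⟩
    rw [← hg1]
    refine integral_congr_ae (Eventually.of_forall fun y => ?_)
    simp only [RCLike.norm_ofReal, abs_of_nonneg (hg0 y)]
  have hPm : AEStronglyMeasurable (fun z => ((K.ballIntegral g z : ℝ) : 𝕜))
      (volume : Measure (UpperHalf n)) :=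
    (RCLike.continuous_ofReal.comp (K.continuous_ballIntegral hgi)).aestronglyMeasurable
  let s : UpperHalf n → 𝕜 := fun z => conjSign (a z * (((K.ballIntegral g z : ℝ) : 𝕜) * h z))
  have hsm : AEStronglyMeasurable s (volume : Measure (UpperHalf n)) :=
    (measurable_conjSign.comp_aemeasurable
      (ha.1.mul (hPm.mul hh)).aemeasurable).aestronglyMeasurable
  have hsa : MemLp (fun z => s z * a z) p.conjExponent volume :=
    ha.bounded_mul hsm fun z => norm_conjSign_le _
  -- the ratio of the two ball integrals is bounded since `g` is dominated by the weight
  let θ : UpperHalf n → 𝕜 := fun z => ((K.ballIntegral g z : ℝ) : 𝕜) / decayIntegral 𝕜 K z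
  have hθm : AEStronglyMeasurable θ (volume : Measure (UpperHalf n)) :=
    ((RCLike.continuous_ofReal.comp (K.continuous_ballIntegral hgi)).div continuous_decayIntegral
      decayIntegral_ne_zero).aestronglyMeasurable
  have hθ : ∀ z, ‖θ z‖ ≤ c := fun z => by
    have hpos := K.ballIntegral_pos integrable_decayWeight decayWeight_pos z
    simp only [θ]
    rw [decayIntegral_eq, norm_div, RCLike.norm_ofReal, RCLike.norm_ofReal, abs_of_pos hpos,
      abs_of_nonneg (K.ballIntegral_nonneg hg0 z), div_le_iff₀ hpos]
    refine (K.ballIntegral_mono hgi (integrable_decayWeight.const_mul c) hc z).trans (le_of_eq ?_)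
    exact integral_const_mul _ _
  have hb : MemLp (fun z => θ z * (s z * a z)) p.conjExponent volume := hsa.bounded_mul hθm hθ
  obtain ⟨hint, hℓ⟩ := hrep _ hb
  have hatom : USpace.atom K hp1 hp hb integrable_ofReal_decayWeight =
      USpace.atom K hp1 hp hsa hgn.1 := by
    refine USpace.ext_ae ?_
    filter_upwards [USpace.toFun_atom (K := K) hp1 hp hb integrable_ofReal_decayWeight,
      USpace.toFun_atom (K := K) hp1 hp hsa hgn.1] with z h1 h2
    rw [h1, h2, K.ballIntegral_ofReal g z]
    change θ z * (s z * a z) * decayIntegral 𝕜 K z = _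
    simp only [θ]
    rw [mul_right_comm, div_mul_cancel₀ _ (decayIntegral_ne_zero z), mul_comm]
  have hval : ∀ z, θ z * (s z * a z) * decayIntegral 𝕜 K z * h z =
      ((‖a z * (((K.ballIntegral g z : ℝ) : 𝕜) * h z)‖ : ℝ) : 𝕜) := fun z => by
    rw [← conjSign_mul_self]
    have h3 : θ z * decayIntegral 𝕜 K z = ((K.ballIntegral g z : ℝ) : 𝕜) :=
      div_mul_cancel₀ _ (decayIntegral_ne_zero z)
    change _ = s z * _
    rw [← h3]
    ring
  simp only [hval] at hint hℓ
  have hint' : Integrable fun z => a z * (((K.ballIntegral g z : ℝ) : 𝕜) * h z) := by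
    refine (integrable_norm_iff (ha.1.mul (hPm.mul hh))).1 ?_
    simpa using hint.re
  rw [← ofReal_integral_norm_eq_lintegral_enorm hint']
  have h4 : ‖ℓ (USpace.atom K hp1 hp hsa hgn.1)‖ =
      ∫ z, ‖a z * (((K.ballIntegral g z : ℝ) : 𝕜) * h z)‖ := by
    rw [← hatom, hℓ, integral_ofReal, RCLike.norm_ofReal,
      abs_of_nonneg (integral_nonneg fun _ => norm_nonneg _)]
  rw [← h4, ofReal_norm]
  refine (hR _ _ hsa hgn).trans ?_
  gcongr
  refine eLpNorm_mono fun z => ?_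
  rw [norm_mul]
  exact mul_le_of_le_one_left (norm_nonneg _) (norm_conjSign_le _)

theorem HasL1NormOne.lintegral_enorm {g : EuclideanSpace ℝ (Fin n) → 𝕜} (hg : HasL1NormOne g) :
    ∫⁻ y, ‖g y‖ₑ = 1 := by
  rw [← ofReal_integral_norm_eq_lintegral_enorm hg.1, hg.2, ENNReal.ofReal_one]

theorem USpace.integrable_mul (u : USpace 𝕜 K p) (g : TentSpace 𝕜 K p) :
    Integrable fun z => u.1.toFun z * g.toFun z := by
  refine ⟨u.1.toFun.aestronglyMeasurable.mul g.toFun.aestronglyMeasurable,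
    (lintegral_mul_le_vENorm _ g).trans_lt ?_⟩
  rw [VSpace.vENorm_eq]
  exact ENNReal.mul_lt_top enorm_lt_top enorm_lt_top

theorem USpace.norm_integral_mul_le (u : USpace 𝕜 K p) (g : TentSpace 𝕜 K p) :
    ‖∫ z, u.1.toFun z * g.toFun z‖ ≤ ‖g‖ * ‖u‖ := by
  have h1 := (enorm_integral_le_lintegral_enorm _).trans (lintegral_mul_le_vENorm u.1.toFun g)
  rw [VSpace.vENorm_eq, ← ofReal_norm, ← ofReal_norm, ← ofReal_norm,
    ← ENNReal.ofReal_mul (norm_nonneg _),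
    ENNReal.ofReal_le_ofReal_iff (mul_nonneg (norm_nonneg _) (norm_nonneg _))] at h1
  rwa [mul_comm]

/-- The functional on `U^{p'}(K)` given by integration against an element of `T^p(K)`. -/
noncomputable def TentSpace.toDual (g : TentSpace 𝕜 K p) : StrongDual 𝕜 (USpace 𝕜 K p) :=
  LinearMap.mkContinuous
    { toFun := fun u => ∫ z, u.1.toFun z * g.toFun z
      map_add' := fun u v => by
        rw [← integral_add (USpace.integrable_mul u g) (USpace.integrable_mul v g)]
        refine integral_congr_ae ?_
        filter_upwards [USpace.toFun_add u v] with z hz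
        rw [hz, add_mul]
      map_smul' := fun c u => by
        rw [RingHom.id_apply, smul_eq_mul, ← integral_const_mul]
        refine integral_congr_ae ?_
        filter_upwards [USpace.toFun_smul c u] with z hz
        rw [hz, mul_assoc] }
    ‖g‖ (fun u => USpace.norm_integral_mul_le u g)

theorem TentSpace.toDual_apply (g : TentSpace 𝕜 K p) (u : USpace 𝕜 K p) :
    g.toDual u = ∫ z, u.1.toFun z * g.toFun z := rfl

theorem TentSpace.toDual_atom (hp1 : 1 < p) (hp : p ≠ ⊤) (f : TentSpace 𝕜 K p)
    {a : UpperHalf n → 𝕜} {g : EuclideanSpace ℝ (Fin n) → 𝕜} (ha : MemLp a p.conjExponent volume)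
    (hg : Integrable g) :
    Integrable (fun z => a z * K.ballIntegral g z * f.toFun z) ∧
      f.toDual (USpace.atom K hp1 hp ha hg) = ∫ z, a z * K.ballIntegral g z * f.toFun z := by
  have h : (fun z => (USpace.atom K hp1 hp ha hg).1.toFun z * f.toFun z) =ᵐ[volume]
      fun z => a z * K.ballIntegral g z * f.toFun z := by
    filter_upwards [USpace.toFun_atom (K := K) hp1 hp ha hg] with z hz
    rw [hz]
  exact ⟨(USpace.integrable_mul (USpace.atom K hp1 hp ha hg) f).congr h, integral_congr_ae h⟩

/-- The tent norm is determined by the values of the functional on atoms. -/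
theorem TentSpace.enorm_le_of_atom_le (hp1 : 1 < p) (hp : p ≠ ⊤) (f : TentSpace 𝕜 K p) {R : ℝ≥0∞}
    (hR : ∀ (a : UpperHalf n → 𝕜) (g : EuclideanSpace ℝ (Fin n) → 𝕜)
      (ha : MemLp a p.conjExponent volume) (hg : HasL1NormOne g),
      ‖f.toDual (USpace.atom K hp1 hp ha hg.1)‖ₑ ≤ R * eLpNorm a p.conjExponent volume) :
    ‖f‖ₑ ≤ R := by
  rw [← f.tentENorm_eq]
  exact tentENorm_le_of_dual hp1 hp f.toDual f.toFun.aestronglyMeasurable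
    (fun a ha => f.toDual_atom hp1 hp ha integrable_ofReal_decayWeight) hR

theorem enorm_dual_atom_le (hp1 : 1 < p) (hp : p ≠ ⊤) (ℓ : StrongDual 𝕜 (USpace 𝕜 K p))
    (a : UpperHalf n → 𝕜) (g : EuclideanSpace ℝ (Fin n) → 𝕜)
    (ha : MemLp a p.conjExponent volume) (hg : HasL1NormOne g) :
    ‖ℓ (USpace.atom K hp1 hp ha hg.1)‖ₑ ≤ ‖ℓ‖ₑ * eLpNorm a p.conjExponent volume := by
  refine (ℓ.le_opENorm _).trans ?_
  gcongr
  refine (USpace.enorm_atom_le hp1 hp ha hg.1).trans ?_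
  rw [hg.lintegral_enorm, one_mul]

theorem TentSpace.norm_toDual (hp1 : 1 < p) (hp : p ≠ ⊤) (f : TentSpace 𝕜 K p) :
    ‖f.toDual‖ = ‖f‖ := by
  refine le_antisymm (LinearMap.mkContinuous_norm_le _ (norm_nonneg _) _) ?_
  have h := f.enorm_le_of_atom_le hp1 hp (enorm_dual_atom_le hp1 hp f.toDual)
  rwa [← ofReal_norm, ← ofReal_norm, ENNReal.ofReal_le_ofReal_iff (norm_nonneg _)] at h

/-- Every functional `ℓ` is given by an element of `T^p(K)`: the functional
`a ↦ ℓ (a · decayIntegral)` on `L^{p'}` is integration against some `G ∈ L^p`, and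
`G / decayIntegral` represents `ℓ`. -/
theorem TentSpace.toDual_surjective (hp1 : 1 < p) (hp : p ≠ ⊤) (ℓ : StrongDual 𝕜 (USpace 𝕜 K p)) :
    ∃ f : TentSpace 𝕜 K p, f.toDual = ℓ := by
  have hq := conjExponent_ne_top hp1
  let M : ℝ≥0∞ := ∫⁻ y : EuclideanSpace ℝ (Fin n), ‖(decayWeight n y : 𝕜)‖ₑ
  have hM : M < ⊤ := (integrable_ofReal_decayWeight (𝕜 := 𝕜)).2
  let L : StrongDual 𝕜 (Lp 𝕜 p.conjExponent (volume : Measure (UpperHalf n))) :=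
    LinearMap.mkContinuous
      { toFun := fun a => ℓ (USpace.atom K hp1 hp (Lp.memLp a) integrable_ofReal_decayWeight)
        map_add' := fun a b => by
          rw [← map_add]
          congr 1
          refine USpace.ext_ae ?_
          filter_upwards [
            USpace.toFun_atom (K := K) hp1 hp (Lp.memLp a) integrable_ofReal_decayWeight,
            USpace.toFun_atom (K := K) hp1 hp (Lp.memLp b) integrable_ofReal_decayWeight,
            USpace.toFun_atom (K := K) hp1 hp (Lp.memLp (a + b)) integrable_ofReal_decayWeight,
            USpace.toFun_add
              (USpace.atom K hp1 hp (Lp.memLp a) integrable_ofReal_decayWeight)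
              (USpace.atom K hp1 hp (Lp.memLp b) integrable_ofReal_decayWeight),
            Lp.coeFn_add a b] with z h1 h2 h3 h4 h5
          rw [h3, h4, h1, h2, h5, Pi.add_apply, add_mul]
        map_smul' := fun c a => by
          rw [RingHom.id_apply, ← map_smul]
          congr 1
          refine USpace.ext_ae ?_
          filter_upwards [
            USpace.toFun_atom (K := K) hp1 hp (Lp.memLp a) integrable_ofReal_decayWeight,
            USpace.toFun_atom (K := K) hp1 hp (Lp.memLp (c • a)) integrable_ofReal_decayWeight,
            USpace.toFun_smul c
              (USpace.atom K hp1 hp (Lp.memLp a) integrable_ofReal_decayWeight),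
            Lp.coeFn_smul c a] with z h1 h2 h3 h4
          rw [h2, h3, h1, h4, Pi.smul_apply, smul_eq_mul, mul_assoc] }
      (‖ℓ‖ * M.toReal) (fun a => by
        refine (ℓ.le_opNorm _).trans ?_
        rw [mul_assoc]
        refine mul_le_mul_of_nonneg_left ?_ (norm_nonneg ℓ)
        rw [← toReal_enorm, Lp.norm_def, ← ENNReal.toReal_mul]
        exact ENNReal.toReal_mono (ENNReal.mul_ne_top hM.ne (Lp.memLp a).2.ne)
          (USpace.enorm_atom_le hp1 hp (Lp.memLp a) integrable_ofReal_decayWeight))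
  have hLval : ∀ (a : UpperHalf n → 𝕜) (ha : MemLp a p.conjExponent volume),
      L (ha.toLp a) = ℓ (USpace.atom K hp1 hp ha integrable_ofReal_decayWeight) := by
    intro a ha
    change ℓ _ = ℓ _
    congr 1
    refine USpace.ext_ae ?_
    filter_upwards [
      USpace.toFun_atom (K := K) hp1 hp (Lp.memLp (ha.toLp a)) integrable_ofReal_decayWeight,
      USpace.toFun_atom (K := K) hp1 hp ha integrable_ofReal_decayWeight,
      ha.coeFn_toLp] with z h1 h2 h3
    rw [h1, h2, h3]
  obtain ⟨G, hGm, hG⟩ := exists_measurable_repr_lpDual hq L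
  have hGp : MemLp G p volume := ⟨hGm.aestronglyMeasurable,
    (eLpNorm_le_of_forall_lintegral_mul_le (p := p) (q := p.conjExponent) hp hq
      hGm.aestronglyMeasurable fun a ha => (hG a ha).1).trans_lt enorm_lt_top⟩
  let h : UpperHalf n → 𝕜 := fun z => (decayIntegral 𝕜 K z)⁻¹ * G z
  have hinv : Continuous fun z => (decayIntegral 𝕜 K z)⁻¹ :=
    continuous_decayIntegral.inv₀ decayIntegral_ne_zero
  have hhm : AEStronglyMeasurable h (volume : Measure (UpperHalf n)) :=
    hinv.aestronglyMeasurable.mul hGm.aestronglyMeasurable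
  have hloc : LocallyIntegrable h volume := by
    rw [locallyIntegrable_iff]
    intro O hO
    exact ((locallyIntegrable_iff.1 (hGp.locallyIntegrable Fact.out)) O hO).continuousOn_mul
      hinv.continuousOn hO
  have hcancel : ∀ a : UpperHalf n → 𝕜, (fun z => a z * decayIntegral 𝕜 K z * h z) =
      fun z => a z * G z := fun a => by
    ext z
    simp only [h]
    rw [mul_assoc, mul_inv_cancel_left₀ (decayIntegral_ne_zero z)]
  have hrep : ∀ (a : UpperHalf n → 𝕜) (ha : MemLp a p.conjExponent volume),
      Integrable (fun z => a z * decayIntegral 𝕜 K z * h z) ∧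
        ℓ (USpace.atom K hp1 hp ha integrable_ofReal_decayWeight) =
          ∫ z, a z * decayIntegral 𝕜 K z * h z := by
    intro a ha
    rw [hcancel, ← hLval]
    exact ⟨⟨ha.1.mul hGm.aestronglyMeasurable,
      (hG a ha).1.trans_lt (ENNReal.mul_lt_top enorm_lt_top ha.2)⟩, (hG a ha).2⟩
  have hfin : tentENorm K p h < ⊤ :=
    (tentENorm_le_of_dual hp1 hp ℓ hhm hrep (enorm_dual_atom_le hp1 hp ℓ)).trans_lt enorm_lt_top
  refine ⟨TentSpace.mk h hloc hfin, USpace.dual_ext hp1 hp fun a ha => ?_⟩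
  rw [(hrep a ha).2, (TentSpace.toDual_atom hp1 hp _ ha integrable_ofReal_decayWeight).2]
  refine integral_congr_ae ?_
  filter_upwards [TentSpace.toFun_mk h hloc hfin] with z hz
  rw [hz]
  rfl

/-- The isometric isomorphism of `T^p(K)` with the dual of `U^{p'}(K)`. -/
noncomputable def TentSpace.dualEquiv (hp1 : 1 < p) (hp : p ≠ ⊤) :
    TentSpace 𝕜 K p ≃ₗᵢ[𝕜] StrongDual 𝕜 (USpace 𝕜 K p) :=
  LinearIsometryEquiv.ofSurjective
    { toFun := TentSpace.toDual
      map_add' := fun f g => by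
        ext u
        change (f + g).toDual u = f.toDual u + g.toDual u
        rw [TentSpace.toDual_apply, TentSpace.toDual_apply, TentSpace.toDual_apply,
          ← integral_add (USpace.integrable_mul u f) (USpace.integrable_mul u g)]
        refine integral_congr_ae ?_
        filter_upwards [TentSpace.toFun_add f g] with z hz
        rw [hz, mul_add]
      map_smul' := fun c f => by
        ext u
        change (c • f).toDual u = c * f.toDual u
        rw [TentSpace.toDual_apply, TentSpace.toDual_apply, ← integral_const_mul]
        refine integral_congr_ae ?_
        filter_upwards [TentSpace.toFun_smul c f] with z hz
        rw [hz, mul_left_comm]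
      norm_map' := TentSpace.norm_toDual hp1 hp }
    (TentSpace.toDual_surjective hp1 hp)

end TentDuality

/-! ### Atomic decompositions in `U^{p'}(K)` -/

/-- If a balanced set `A` is norming for the dual, then by the Hahn–Banach theorem the unit ball lies
in the closed convex hull of `A`, so every vector is approximated by finite combinations of
elements of `A` with coefficients of total mass equal to its norm. -/
theorem exists_finite_approx_of_norming {𝕜 E : Type*} [RCLike 𝕜] [NormedAddCommGroup E]
    [NormedSpace 𝕜 E] {A : Set E} (hne : A.Nonempty)
    (hbal : ∀ a ∈ A, ∀ c : 𝕜, ‖c‖ ≤ 1 → c • a ∈ A)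
    (hnorm : ∀ (ℓ : StrongDual 𝕜 E) (r : ℝ), 0 ≤ r → (∀ a ∈ A, ‖ℓ a‖ ≤ r) → ‖ℓ‖ ≤ r) (u : E) :
    ∃ (m : ℕ) (c : Fin (m + 1) → 𝕜) (a : Fin (m + 1) → E),
      (∀ i, a i ∈ A) ∧ ∑ i, ‖c i‖ ≤ 1 * ‖u‖ ∧ ‖u - ∑ i, c i • a i‖ ≤ ‖u‖ / 2 := by
  rcases eq_or_ne u 0 with rfl | hu
  · obtain ⟨a, ha⟩ := hne
    exact ⟨0, fun _ => 0, fun _ => a, fun _ => ha, by simp, by simp⟩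
  let _ : NormedSpace ℝ E := NormedSpace.restrictScalars ℝ 𝕜 E
  have : IsScalarTower ℝ 𝕜 E := RestrictScalars.isScalarTower ℝ 𝕜 E
  have hpos : 0 < ‖u‖ := norm_pos_iff.2 hu
  set v : E := ((‖u‖⁻¹ : ℝ) : 𝕜) • u with hv
  have hvn : ‖v‖ = 1 := by
    rw [hv, norm_smul, RCLike.norm_ofReal, abs_of_pos (inv_pos.2 hpos), inv_mul_cancel₀ hpos.ne']
  have huv : u = ((‖u‖ : ℝ) : 𝕜) • v := by
    rw [hv, smul_smul, ← RCLike.ofReal_mul, mul_inv_cancel₀ hpos.ne', RCLike.ofReal_one, one_smul]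
  have hmem : v ∈ closure (convexHull ℝ A) := by
    by_contra hnot
    obtain ⟨ℓ, s, hs, hsv⟩ := RCLike.geometric_hahn_banach_closed_point (𝕜 := 𝕜)
      (convex_convexHull ℝ A).closure isClosed_closure hnot
    -- balancedness turns the bound on real parts into a bound on norms
    have hA : ∀ a ∈ A, ‖ℓ a‖ ≤ s := by
      intro a ha
      have h1 := hs _ (subset_closure (subset_convexHull ℝ A
        (hbal a ha (conjSign (ℓ a)) (norm_conjSign_le _))))
      rw [map_smul, smul_eq_mul, conjSign_mul_self, RCLike.ofReal_re] at h1
      exact h1.le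
    have hs0 : 0 ≤ s := by
      obtain ⟨a, ha⟩ := hne
      exact (norm_nonneg _).trans (hA a ha)
    have h2 := ℓ.le_of_opNorm_le (hnorm ℓ s hs0 hA) v
    rw [hvn, mul_one] at h2
    exact absurd (hsv.trans_le ((RCLike.re_le_norm _).trans h2)) (lt_irrefl _)
  obtain ⟨w, hw, hvw⟩ := Metric.mem_closure_iff.1 hmem (1 / 2) (by norm_num)
  obtain ⟨ι, _, θ, z, hθ, hθ1, hz, hzw⟩ := mem_convexHull_iff_exists_fintype.1 hw
  have hι : Nonempty ι := by
    by_contra hemp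
    rw [not_nonempty_iff] at hemp
    simp at hθ1
  obtain ⟨m, hm⟩ : ∃ m, Fintype.card ι = m + 1 :=
    Nat.exists_eq_succ_of_ne_zero Fintype.card_ne_zero
  let e : Fin (m + 1) ≃ ι := (Fintype.equivFinOfCardEq hm).symm
  refine ⟨m, fun i => ((‖u‖ * θ (e i) : ℝ) : 𝕜), fun i => z (e i), fun i => hz _, ?_, ?_⟩
  · rw [e.sum_comp (fun i => ‖((‖u‖ * θ i : ℝ) : 𝕜)‖), one_mul]
    have : ∀ i, ‖((‖u‖ * θ i : ℝ) : 𝕜)‖ = ‖u‖ * θ i := fun i => by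
      rw [RCLike.norm_ofReal, abs_of_nonneg (mul_nonneg hpos.le (hθ i))]
    simp only [this]
    rw [← Finset.mul_sum, hθ1, mul_one]
  · rw [e.sum_comp (fun i => ((‖u‖ * θ i : ℝ) : 𝕜) • z i)]
    have h1 : ∑ i, ((‖u‖ * θ i : ℝ) : 𝕜) • z i = ((‖u‖ : ℝ) : 𝕜) • w := by
      rw [← hzw, Finset.smul_sum]
      refine Finset.sum_congr rfl fun i _ => ?_
      rw [RCLike.ofReal_mul, mul_smul, RCLike.real_smul_eq_coe_smul (K := 𝕜) (θ i)]
    rw [h1]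
    nth_rewrite 1 [huv]
    rw [← smul_sub, norm_smul, RCLike.norm_ofReal, abs_norm, ← dist_eq_norm]
    have := mul_le_mul_of_nonneg_left hvw.le hpos.le
    linarith

namespace TentDuality

variable {𝕜 : Type*} [RCLike 𝕜] {n : ℕ} {K : SymmConvexBody n} {p : ℝ≥0∞} [Fact (1 ≤ p)]

theorem exists_hasL1NormOne : ∃ g : EuclideanSpace ℝ (Fin n) → 𝕜, HasL1NormOne g := by
  have hpos : 0 < ∫ y, decayWeight n y :=
    integral_pos_of_forall_pos integrable_decayWeight decayWeight_pos
  refine ⟨fun y => (((∫ y, decayWeight n y)⁻¹ * decayWeight n y : ℝ) : 𝕜),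
    (integrable_decayWeight.const_mul _).ofReal, ?_⟩
  have : ∀ y, ‖(((∫ y, decayWeight n y)⁻¹ * decayWeight n y : ℝ) : 𝕜)‖ =
      (∫ y, decayWeight n y)⁻¹ * decayWeight n y := fun y => by
    rw [RCLike.norm_ofReal, abs_of_pos (mul_pos (inv_pos.2 hpos) (decayWeight_pos y))]
  simp only [this]
  rw [integral_const_mul, inv_mul_cancel₀ hpos.ne']

theorem IsLqAtom.exists_USpace (hp1 : 1 < p) (hp : p ≠ ⊤) {F : UpperHalf n → 𝕜}
    (hF : IsLqAtom K p.conjExponent F) :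
    ∃ u : USpace 𝕜 K p, u.1.toFun =ᵐ[volume] F ∧ ‖u‖ ≤ 1 := by
  obtain ⟨a, g, ha, ha1, hg, hF⟩ := hF
  refine ⟨USpace.atom K hp1 hp ha hg.1, (USpace.toFun_atom hp1 hp ha hg.1).trans hF.symm, ?_⟩
  rw [← ENNReal.ofReal_le_one, ofReal_norm]
  refine (USpace.enorm_atom_le hp1 hp ha hg.1).trans ?_
  rwa [hg.lintegral_enorm, one_mul]

theorem USpace.norm_le_one_of_isLqAtom (hp1 : 1 < p) (hp : p ≠ ⊤) {u : USpace 𝕜 K p}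
    (hu : IsLqAtom K p.conjExponent u.1.toFun) : ‖u‖ ≤ 1 := by
  obtain ⟨v, hv, hv1⟩ := hu.exists_USpace hp1 hp
  rwa [← USpace.ext_ae hv]

theorem USpace.isLqAtom_atom (hp1 : 1 < p) (hp : p ≠ ⊤) {a : UpperHalf n → 𝕜}
    {g : EuclideanSpace ℝ (Fin n) → 𝕜} (ha : MemLp a p.conjExponent volume)
    (ha1 : eLpNorm a p.conjExponent volume ≤ 1) (hg : HasL1NormOne g) :
    IsLqAtom K p.conjExponent (USpace.atom K hp1 hp ha hg.1).1.toFun :=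
  ⟨a, g, ha, ha1, hg, USpace.toFun_atom hp1 hp ha hg.1⟩

theorem USpace.isLqAtom_smul {u : USpace 𝕜 K p} (hu : IsLqAtom K p.conjExponent u.1.toFun) {c : 𝕜}
    (hc : ‖c‖ ≤ 1) : IsLqAtom K p.conjExponent (c • u).1.toFun := by
  obtain ⟨a, g, ha, ha1, hg, hu⟩ := hu
  refine ⟨fun z => c * a z, g, ha.const_mul c, ?_, hg, ?_⟩
  · refine le_trans (eLpNorm_mono fun z => ?_) ha1
    rw [norm_mul]
    exact mul_le_of_le_one_left (norm_nonneg _) hc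
  · filter_upwards [USpace.toFun_smul c u, hu] with z h1 h2
    rw [h1, h2, atomFun, atomFun, mul_assoc]

/-- Atoms norm the dual of `U^{p'}(K)`. -/
theorem USpace.norm_dual_le_of_atom_le (hp1 : 1 < p) (hp : p ≠ ⊤)
    (ℓ : StrongDual 𝕜 (USpace 𝕜 K p)) {r : ℝ} (hr : 0 ≤ r)
    (h : ∀ u : USpace 𝕜 K p, IsLqAtom K p.conjExponent u.1.toFun → ‖ℓ u‖ ≤ r) : ‖ℓ‖ ≤ r := by
  obtain ⟨f, rfl⟩ := TentSpace.toDual_surjective hp1 hp ℓ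
  rw [TentSpace.norm_toDual hp1 hp f, ← ENNReal.ofReal_le_ofReal_iff hr, ofReal_norm]
  refine f.enorm_le_of_atom_le hp1 hp fun a g ha hg => ?_
  set N : ℝ := (eLpNorm a p.conjExponent volume).toReal with hN
  have hNe : eLpNorm a p.conjExponent volume = ENNReal.ofReal N :=
    (ENNReal.ofReal_toReal ha.2.ne).symm
  have hN0 : 0 ≤ N := ENNReal.toReal_nonneg
  rcases hN0.eq_or_lt with h0 | hpos
  · refine (enorm_dual_atom_le hp1 hp _ a g ha hg).trans ?_
    rw [hNe, ← h0]
    simp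
  · have hmem : MemLp (fun z => ((N⁻¹ : ℝ) : 𝕜) * a z) p.conjExponent volume := ha.const_mul _
    have hle : eLpNorm (fun z => ((N⁻¹ : ℝ) : 𝕜) * a z) p.conjExponent volume ≤ 1 := by
      refine le_of_eq ((eLpNorm_const_smul ((N⁻¹ : ℝ) : 𝕜) a _ _).trans ?_)
      rw [hNe, ← ofReal_norm, RCLike.norm_ofReal, abs_of_pos (inv_pos.2 hpos),
        ← ENNReal.ofReal_mul (inv_pos.2 hpos).le, inv_mul_cancel₀ hpos.ne', ENNReal.ofReal_one]
    have h1 := h _ (USpace.isLqAtom_atom (K := K) hp1 hp hmem hle hg)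
    have h2 : USpace.atom K hp1 hp ha hg.1 =
        ((N : ℝ) : 𝕜) • USpace.atom K hp1 hp hmem hg.1 := by
      refine USpace.ext_ae ?_
      filter_upwards [USpace.toFun_atom (K := K) hp1 hp ha hg.1,
        USpace.toFun_atom (K := K) hp1 hp hmem hg.1,
        USpace.toFun_smul ((N : ℝ) : 𝕜) (USpace.atom K hp1 hp hmem hg.1)] with z e1 e2 e3
      rw [e1, e3, e2, ← mul_assoc, ← mul_assoc, ← RCLike.ofReal_mul, mul_inv_cancel₀ hpos.ne',
        RCLike.ofReal_one, one_mul]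
    rw [h2, map_smul, enorm_smul, hNe, mul_comm]
    refine mul_le_mul' ?_ ?_
    · rw [← ofReal_norm]
      exact ENNReal.ofReal_le_ofReal h1
    · rw [← ofReal_norm, RCLike.norm_ofReal, abs_of_pos hpos]

theorem USpace.toFun_sum (lam : ℕ → 𝕜) (F : ℕ → USpace 𝕜 K p) (N : ℕ) :
    (∑ i ∈ Finset.range N, lam i • F i).1.toFun =ᵐ[volume]
      fun z => ∑ i ∈ Finset.range N, lam i * (F i).1.toFun z := by
  induction N with
  | zero => exact VSpace.toFun_zero
  | succ N ih =>
    rw [Finset.sum_range_succ]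
    filter_upwards [ih, USpace.toFun_add (∑ i ∈ Finset.range N, lam i • F i) (lam N • F N),
      USpace.toFun_smul (lam N) (F N)] with z h1 h2 h3
    rw [h2, h1, h3, Finset.sum_range_succ]

theorem USpace.tendstoLpLoc_of_hasSum (hp1 : 1 < p) (hp : p ≠ ⊤) {lam : ℕ → 𝕜}
    {F : ℕ → USpace 𝕜 K p} {u : USpace 𝕜 K p} (h : HasSum (fun i => lam i • F i) u) :
    TendstoLpLoc p.conjExponent
      (fun N z => ∑ i ∈ Finset.range N, lam i * (F i).1.toFun z) u.1.toFun := by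
  intro O _
  have h1 : Tendsto (fun N => ‖∑ i ∈ Finset.range N, lam i • F i - u‖ₑ) atTop (𝓝 0) := by
    have := ENNReal.tendsto_ofReal (tendsto_iff_norm_sub_tendsto_zero.1 h.tendsto_sum_nat)
    simpa only [ofReal_norm, ENNReal.ofReal_zero] using this
  refine tendsto_of_tendsto_of_tendsto_of_le_of_le tendsto_const_nhds h1 (fun _ => zero_le)
    fun N => ?_
  refine (eLpNorm_mono_measure _ Measure.restrict_le_self).trans ?_
  refine le_trans (le_of_eq (eLpNorm_congr_ae ?_))
    (VSpace.eLpNorm_le hp1 hp (∑ i ∈ Finset.range N, lam i • F i - u).1)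
  filter_upwards [USpace.toFun_sum lam F N,
    VSpace.toFun_sub (∑ i ∈ Finset.range N, lam i • F i : USpace 𝕜 K p).1 u.1] with z e1 e2
  rw [← e1]
  exact e2.symm

theorem TendstoLpLoc.ae_unique {q : ℝ≥0∞} (hq : 1 ≤ q) {s s' : ℕ → UpperHalf n → 𝕜}
    {f f' : UpperHalf n → 𝕜} (hs : ∀ N, AEStronglyMeasurable (s N)) (hf : AEStronglyMeasurable f)
    (hf' : AEStronglyMeasurable f') (hss : ∀ N, s N =ᵐ[volume] s' N)
    (h : TendstoLpLoc q s f) (h' : TendstoLpLoc q s' f') : f =ᵐ[volume] f' := by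
  have hO : ∀ O : Set (UpperHalf n), IsCompact O → ∀ᵐ z ∂(volume.restrict O), f z = f' z := by
    intro O hO
    have h0 : eLpNorm (fun z => f' z - f z) q (volume.restrict O) = 0 := by
      refine le_antisymm (ge_of_tendsto' (by simpa using (h O hO).add (h' O hO)) fun N => ?_)
        zero_le
      have h1 : eLpNorm (fun z => s' N z - f' z) q (volume.restrict O) =
          eLpNorm (fun z => s N z - f' z) q (volume.restrict O) := by
        refine eLpNorm_congr_ae (ae_restrict_of_ae ?_)
        filter_upwards [hss N] with z hz
        rw [hz]
      rw [h1]
      have h2 : (fun z => f' z - f z) =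
          (fun z => s N z - f z) - fun z => s N z - f' z := by
        ext z
        simp
      rw [h2]
      exact eLpNorm_sub_le ((hs N).sub hf).restrict ((hs N).sub hf').restrict hq
    have h3 := (eLpNorm_eq_zero_iff (hf'.sub hf).restrict (zero_lt_one.trans_le hq).ne').1 h0
    filter_upwards [h3] with z hz
    exact (sub_eq_zero.1 hz).symm
  have hall : ∀ᵐ z ∂(volume.restrict (⋃ i, compactCovering (UpperHalf n) i)), f z = f' z :=
    (ae_restrict_iUnion_iff _ _).2 fun i => hO _ (isCompact_compactCovering _ i)
  rwa [iUnion_compactCovering, Measure.restrict_univ] at hall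

theorem USpace.exists_atomic_decomposition (hp1 : 1 < p) (hp : p ≠ ⊤) (u : USpace 𝕜 K p) :
    ∃ (lam : ℕ → 𝕜) (F : ℕ → USpace 𝕜 K p),
      (∀ i, IsLqAtom K p.conjExponent (F i).1.toFun) ∧ Summable (fun i => ‖lam i‖) ∧
      HasSum (fun i => lam i • F i) u ∧ ∑' i, ‖lam i‖ ≤ 2 * ‖u‖ := by
  have hne : {u : USpace 𝕜 K p | IsLqAtom K p.conjExponent u.1.toFun}.Nonempty := by
    obtain ⟨g, hg⟩ := exists_hasL1NormOne (𝕜 := 𝕜) (n := n)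
    have h0 : MemLp (0 : UpperHalf n → 𝕜) p.conjExponent volume := MemLp.zero
    exact ⟨USpace.atom K hp1 hp h0 hg.1,
      USpace.isLqAtom_atom hp1 hp h0 (by rw [eLpNorm_zero]; exact zero_le) hg⟩
  obtain ⟨lam, F, h1, h2, h3, h4⟩ := exists_hasSum_of_approx
    (fun a ha => USpace.norm_le_one_of_isLqAtom hp1 hp ha)
    (exists_finite_approx_of_norming hne (fun a ha c hc => USpace.isLqAtom_smul ha hc)
      fun ℓ r hr h => USpace.norm_dual_le_of_atom_le hp1 hp ℓ hr h) u
  exact ⟨lam, F, h1, h2, h3, h4.trans_eq (by rw [mul_one])⟩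

theorem exists_USpace_of_atomic_series (hp1 : 1 < p) (hp : p ≠ ⊤) {f : UpperHalf n →ₘ[volume] 𝕜}
    {lam : ℕ → 𝕜} {F : ℕ → UpperHalf n → 𝕜} (hF : ∀ i, IsLqAtom K p.conjExponent (F i))
    (hlam : Summable fun i => ‖lam i‖)
    (hf : TendstoLpLoc p.conjExponent (fun N z => ∑ i ∈ Finset.range N, lam i * F i z) f) :
    ∃ u : USpace 𝕜 K p, u.1.toFun = f := by
  have := USpace.completeSpace (𝕜 := 𝕜) (K := K) hp1 hp
  choose U hU hU1 using fun i => (hF i).exists_USpace hp1 hp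
  have hs : Summable fun i => lam i • U i := by
    refine Summable.of_norm_bounded hlam fun i => ?_
    rw [norm_smul]
    exact mul_le_of_le_one_right (norm_nonneg _) (hU1 i)
  obtain ⟨u, hu⟩ := hs
  refine ⟨u, AEEqFun.ext ?_⟩
  refine TendstoLpLoc.ae_unique (Fact.out : 1 ≤ p.conjExponent) (fun N => ?_)
    u.1.toFun.aestronglyMeasurable f.aestronglyMeasurable (fun N => ?_)
    (USpace.tendstoLpLoc_of_hasSum hp1 hp hu) hf
  · exact (AEEqFun.aestronglyMeasurable _).congr (USpace.toFun_sum lam U N)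
  · filter_upwards [ae_all_iff.2 hU] with z hz
    exact Finset.sum_congr rfl fun i _ => by rw [hz i]

end TentDuality

theorem norm_le_tsum_of_hasSum {𝕜 E : Type*} [RCLike 𝕜] [NormedAddCommGroup E] [NormedSpace 𝕜 E]
    {lam : ℕ → 𝕜} {F : ℕ → E} {u : E} (hF : ∀ i, ‖F i‖ ≤ 1) (hlam : Summable fun i => ‖lam i‖)
    (h : HasSum (fun i => lam i • F i) u) : ‖u‖ ≤ ∑' i, ‖lam i‖ := by
  have hle : ∀ i, ‖lam i • F i‖ ≤ ‖lam i‖ := fun i => by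
    rw [norm_smul]
    exact mul_le_of_le_one_right (norm_nonneg _) (hF i)
  rw [← h.tsum_eq]
  exact tsum_of_norm_bounded hlam.hasSum hle

/-! ### A weighted covering lemma -/

open Classical in
/-- The local ratio method for weighted independent sets. If every subfamily of `s` without
conflicts has total weight at most `M`, then there are nonnegative `v` of total mass at most `M` such
that the weight of each element is at most the sum of `v` over the conflicting elements that do not
exceed it in size. The elements are processed in order of increasing size; `v` is the residual
weight. -/
theorem exists_local_ratio {α : Type*} (r : α → ℝ) {meet : α → α → Prop} (hrefl : ∀ x, meet x x)
    (hsymm : ∀ x y, meet x y → meet y x) (s : Finset α) :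
    ∀ (w : α → ℝ) (M : ℝ), (∀ z ∈ s, 0 ≤ w z) →
      (∀ T ⊆ s, (T : Set α).Pairwise (fun x y => ¬ meet x y) → ∑ z ∈ T, w z ≤ M) →
      ∃ v : α → ℝ, (∀ z ∈ s, 0 ≤ v z) ∧ ∑ z ∈ s, v z ≤ M ∧
        ∀ z ∈ s, w z ≤ ∑ y ∈ s, if r y ≤ r z ∧ meet y z then v y else 0 := by
  induction s using Finset.induction_on_min_value r with
  | empty =>
    intro w M _ hM
    exact ⟨0, by simp, by simpa using hM ∅ (by simp) (by simp), by simp⟩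
  | insert a s ha hmin ih =>
    intro w M hw hM
    have hwa : 0 ≤ w a := hw a (Finset.mem_insert_self _ _)
    have hws : ∀ z ∈ s, 0 ≤ w z := fun z hz => hw z (Finset.mem_insert_of_mem hz)
    let w' : α → ℝ := fun z => if meet a z then max (w z - w a) 0 else w z
    have hw'0 : ∀ z ∈ s, 0 ≤ w' z := fun z hz => by
      simp only [w']
      split_ifs
      · exact le_max_right _ _
      · exact hws z hz
    have hw'le : ∀ z ∈ s, w' z ≤ w z := fun z hz => by
      simp only [w']
      split_ifs
      · exact max_le (by linarith) (hws z hz)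
      · exact le_rfl
    have hM' : ∀ T ⊆ s, (T : Set α).Pairwise (fun x y => ¬ meet x y) →
        ∑ z ∈ T, w' z ≤ M - w a := by
      intro T hT hpair
      set T' := T.filter fun z => 0 < w' z with hT'
      have hT's : T' ⊆ s := (Finset.filter_subset _ _).trans hT
      have hpair' : (T' : Set α).Pairwise (fun x y => ¬ meet x y) :=
        hpair.mono (by exact_mod_cast Finset.filter_subset _ _)
      have hsum : ∑ z ∈ T, w' z = ∑ z ∈ T', w' z := by
        refine (Finset.sum_filter_of_ne fun z hz hne => ?_).symm
        exact lt_of_le_of_ne (hw'0 z (hT hz)) (Ne.symm hne)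
      rw [hsum]
      by_cases hex : ∃ b ∈ T', meet a b
      · obtain ⟨b, hb, hab⟩ := hex
        have hb' : w' b = w b - w a := by
          have hpos := (Finset.mem_filter.1 hb).2
          simp only [w', if_pos hab] at hpos ⊢
          rcases lt_max_iff.1 hpos with h | h
          · exact max_eq_left h.le
          · exact absurd h (lt_irrefl _)
        have h1 := hM T' (hT's.trans (Finset.subset_insert _ _)) hpair'
        rw [← Finset.add_sum_erase _ _ hb] at h1 ⊢
        have h2 : ∑ z ∈ T'.erase b, w' z ≤ ∑ z ∈ T'.erase b, w z :=
          Finset.sum_le_sum fun z hz => hw'le z (hT's (Finset.mem_of_mem_erase hz))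
        rw [hb']
        linarith
      · have hno : ∀ z ∈ T', ¬ meet a z := fun z hz h => hex ⟨z, hz, h⟩
        have haT : a ∉ T' := fun h => ha (hT's h)
        have h1 := hM (insert a T') (Finset.insert_subset_insert _ hT's) (by
          rw [Finset.coe_insert]
          refine hpair'.insert fun b hb _ => ⟨hno b hb, fun h => hno b hb (hsymm _ _ h)⟩)
        rw [Finset.sum_insert haT] at h1
        have h2 : ∑ z ∈ T', w' z = ∑ z ∈ T', w z :=
          Finset.sum_congr rfl fun z hz => if_neg (hno z hz)
        linarith
    obtain ⟨v, hv0, hvM, hvw⟩ := ih w' (M - w a) hw'0 hM'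
    have hne : ∀ z ∈ s, z ≠ a := fun z hz h => ha (h ▸ hz)
    have hupd : ∀ z ∈ s, Function.update v a (w a) z = v z := fun z hz =>
      Function.update_of_ne (hne z hz) _ _
    refine ⟨Function.update v a (w a), fun z hz => ?_, ?_, fun z hz => ?_⟩
    · rcases Finset.mem_insert.1 hz with rfl | hz
      · rwa [Function.update_self]
      · rw [hupd z hz]
        exact hv0 z hz
    · rw [Finset.sum_insert ha, Function.update_self, Finset.sum_congr rfl hupd]
      linarith
    · have hsum : ∑ y ∈ s, (if r y ≤ r z ∧ meet y z then Function.update v a (w a) y else 0) =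
          ∑ y ∈ s, if r y ≤ r z ∧ meet y z then v y else 0 :=
        Finset.sum_congr rfl fun y hy => by rw [hupd y hy]
      have hnn : 0 ≤ ∑ y ∈ s, if r y ≤ r z ∧ meet y z then v y else 0 :=
        Finset.sum_nonneg fun y hy => by
          split_ifs
          · exact hv0 y hy
          · exact le_rfl
      rw [Finset.sum_insert ha, Function.update_self, hsum]
      rcases Finset.mem_insert.1 hz with rfl | hz
      · rw [if_pos ⟨le_rfl, hrefl _⟩]
        linarith
      · have h1 := hvw z hz
        by_cases haz : meet a z
        · rw [if_pos ⟨hmin z hz, haz⟩]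
          simp only [w', if_pos haz] at h1
          linarith [le_max_left (w z - w a) 0]
        · rw [if_neg (fun h => haz h.2), zero_add]
          simpa only [w', if_neg haz] using h1

/-! ### Domination by ball integrals -/

namespace TentDuality

variable {𝕜 : Type*} [RCLike 𝕜] {n : ℕ} {K : SymmConvexBody n}

namespace SymmConvexBody

/-- If the `K`-ball `y` meets a ball `w` at least as large, and `z` is close to `w` relative to the
size of `y`, then the ball `z` and the threefold dilate of `y` share a ball of half the radius
of `y`. -/
theorem exists_halfBall_subset {w y z : UpperHalf n} (hmeet : (K.kBall y ∩ K.kBall w).Nonempty)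
    (hle : (y.2 : ℝ) ≤ w.2)
    (hclose : K.kNorm (z.1 - w.1) + |(z.2 : ℝ) - w.2| ≤ (y.2 : ℝ) / 2) :
    ∃ c, {x | K.kNorm (x - c) ≤ (y.2 : ℝ) / 2} ⊆
      K.kBall z ∩ {x | K.kNorm (x - y.1) ≤ 3 * (y.2 : ℝ)} := by
  obtain ⟨q, hqy, hqw⟩ := hmeet
  have hqy' : K.kNorm (q - y.1) ≤ y.2 := hqy
  have hqw' : K.kNorm (q - w.1) ≤ w.2 := hqw
  have hy : (0 : ℝ) < y.2 := y.2.2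
  have hw : (0 : ℝ) < w.2 := w.2.2
  set θ : ℝ := (y.2 : ℝ) / w.2 with hθ
  have hθ0 : 0 ≤ θ := (div_pos hy hw).le
  have hθ1 : θ ≤ 1 := (div_le_one hw).2 hle
  have hθw : θ * w.2 = y.2 := div_mul_cancel₀ _ hw.ne'
  -- the center lies on the segment from the common point to the center of the larger ball
  refine ⟨q + θ • (w.1 - q), fun x hx => ?_⟩
  set c := q + θ • (w.1 - q) with hc
  have hx' : K.kNorm (x - c) ≤ (y.2 : ℝ) / 2 := hx
  have h1 : K.kNorm (c - w.1) ≤ w.2 - y.2 := by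
    have : c - w.1 = (1 - θ) • (q - w.1) := by
      rw [hc]
      module
    rw [this, K.kNorm_smul (by linarith)]
    calc (1 - θ) * K.kNorm (q - w.1) ≤ (1 - θ) * w.2 :=
          mul_le_mul_of_nonneg_left hqw' (by linarith)
      _ = w.2 - y.2 := by rw [sub_mul, one_mul, hθw]
  have h2 : K.kNorm (c - q) ≤ y.2 := by
    have : c - q = θ • (w.1 - q) := by
      rw [hc]
      module
    rw [this, K.kNorm_smul hθ0, K.kNorm_sub_comm, ← hθw]
    exact mul_le_mul_of_nonneg_left hqw' hθ0
  refine ⟨?_, ?_⟩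
  · change K.kNorm (x - z.1) ≤ z.2
    have h3 := K.kNorm_sub_le x c z.1
    have h4 := K.kNorm_sub_le c w.1 z.1
    rw [K.kNorm_sub_comm w.1] at h4
    have h5 := neg_abs_le ((z.2 : ℝ) - w.2)
    linarith
  · change K.kNorm (x - y.1) ≤ 3 * (y.2 : ℝ)
    have h3 := K.kNorm_sub_le x c y.1
    have h4 := K.kNorm_sub_le c q y.1
    linarith

theorem volumeReal_setOf_kNorm_sub_le (x : EuclideanSpace ℝ (Fin n)) {t : ℝ} (ht : 0 < t) :
    volume.real {y | K.kNorm (y - x) ≤ t} = t ^ n * volume.real K.carrier := by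
  rw [measureReal_def, K.volume_setOf_kNorm_sub_le x ht, ENNReal.toReal_mul,
    ENNReal.toReal_ofReal (pow_pos ht n).le, measureReal_def]

theorem volume_setOf_kNorm_sub_le_lt_top (x : EuclideanSpace ℝ (Fin n)) {t : ℝ} (ht : 0 < t) :
    volume {y | K.kNorm (y - x) ≤ t} < ⊤ := by
  rw [K.volume_setOf_kNorm_sub_le x ht]
  exact ENNReal.mul_lt_top ENNReal.ofReal_lt_top K.volume_carrier_lt_top

theorem measurableSet_setOf_kNorm_sub_le (x : EuclideanSpace ℝ (Fin n)) (t : ℝ) :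
    MeasurableSet {y | K.kNorm (y - x) ≤ t} :=
  (isClosed_le (K.continuous_kNorm.comp (continuous_id.sub continuous_const))
    continuous_const).measurableSet

end SymmConvexBody

/-- The normalized indicator of the threefold dilate of a `K`-ball. -/
noncomputable def tripleBump (K : SymmConvexBody n) (z : UpperHalf n)
    (y : EuclideanSpace ℝ (Fin n)) : ℝ :=
  {y | K.kNorm (y - z.1) ≤ 3 * (z.2 : ℝ)}.indicator
    (fun _ => (((z.2 : ℝ) / 2) ^ n * volume.real K.carrier)⁻¹) y

theorem volumeReal_carrier_pos : 0 < volume.real K.carrier :=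
  ENNReal.toReal_pos K.volume_carrier_pos.ne' K.volume_carrier_lt_top.ne

theorem tripleBump_coeff_pos (z : UpperHalf n) :
    0 < (((z.2 : ℝ) / 2) ^ n * volume.real K.carrier)⁻¹ :=
  inv_pos.2 (mul_pos (pow_pos (half_pos z.2.2) n) volumeReal_carrier_pos)

theorem three_mul_height_pos (z : UpperHalf n) : 0 < 3 * (z.2 : ℝ) :=
  mul_pos three_pos z.2.2

theorem tripleBump_nonneg (z : UpperHalf n) (y : EuclideanSpace ℝ (Fin n)) :
    0 ≤ tripleBump K z y :=
  Set.indicator_nonneg (fun _ _ => (tripleBump_coeff_pos z).le) y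

theorem integrable_tripleBump (z : UpperHalf n) : Integrable (tripleBump K z) :=
  (integrable_indicator_iff (SymmConvexBody.measurableSet_setOf_kNorm_sub_le _ _)).2
    (integrableOn_const
      (SymmConvexBody.volume_setOf_kNorm_sub_le_lt_top _ (three_mul_height_pos z)).ne)

theorem integral_tripleBump (z : UpperHalf n) : ∫ y, tripleBump K z y = 6 ^ n := by
  unfold tripleBump
  rw [integral_indicator (SymmConvexBody.measurableSet_setOf_kNorm_sub_le _ _), setIntegral_const,
    SymmConvexBody.volumeReal_setOf_kNorm_sub_le _ (three_mul_height_pos z), smul_eq_mul]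
  have h1 := (volumeReal_carrier_pos (K := K)).ne'
  have h2 : (z.2 : ℝ) ≠ 0 := ne_of_gt z.2.2
  have h3 : (3 * (z.2 : ℝ)) ^ n = 6 ^ n * ((z.2 : ℝ) / 2) ^ n := by
    rw [← mul_pow]
    congr 1
    ring
  rw [h3]
  field_simp

theorem one_le_ballIntegral_tripleBump {w y z : UpperHalf n}
    (hmeet : (K.kBall y ∩ K.kBall w).Nonempty) (hle : (y.2 : ℝ) ≤ w.2)
    (hclose : K.kNorm (z.1 - w.1) + |(z.2 : ℝ) - w.2| ≤ (y.2 : ℝ) / 2) :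
    1 ≤ K.ballIntegral (tripleBump K y) z := by
  obtain ⟨c, hc⟩ := SymmConvexBody.exists_halfBall_subset hmeet hle hclose
  have hpos : (0 : ℝ) < (y.2 : ℝ) / 2 := half_pos y.2.2
  calc (1 : ℝ) = ∫ x in {x | K.kNorm (x - c) ≤ (y.2 : ℝ) / 2}, tripleBump K y x := by
        rw [setIntegral_congr_fun (g := fun _ => (((y.2 : ℝ) / 2) ^ n * volume.real K.carrier)⁻¹)
          (SymmConvexBody.measurableSet_setOf_kNorm_sub_le _ _)
          (fun x hx => Set.indicator_of_mem (hc hx).2 _), setIntegral_const,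
          SymmConvexBody.volumeReal_setOf_kNorm_sub_le _ hpos, smul_eq_mul,
          mul_inv_cancel₀ (inv_pos.1 (tripleBump_coeff_pos y)).ne']
    _ ≤ _ := setIntegral_mono_set (integrable_tripleBump y).integrableOn
        (Eventually.of_forall fun x => tripleBump_nonneg y x)
        (Eventually.of_forall fun x hx => (hc hx).1)

end TentDuality

namespace TentDuality

variable {𝕜 : Type*} [RCLike 𝕜] {n : ℕ} {K : SymmConvexBody n}

theorem sum_norm_le_sENorm {f : UpperHalf n → 𝕜} (hf : sENorm K f ≠ ⊤) {T : Finset (UpperHalf n)}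
    (hT : (T : Set (UpperHalf n)).PairwiseDisjoint K.kBall) :
    ∑ z ∈ T, ‖f z‖ ≤ (sENorm K f).toReal := by
  have h := le_iSup₂ (f := fun (C : Finset (UpperHalf n))
    (_ : (C : Set (UpperHalf n)).PairwiseDisjoint K.kBall) => ∑ z ∈ C, ‖f z‖ₑ) T hT
  have h2 := ENNReal.toReal_mono hf h
  rw [ENNReal.toReal_sum fun _ _ => enorm_ne_top] at h2
  simpa only [toReal_enorm] using h2

theorem mem_kBall_center (z : UpperHalf n) : z.1 ∈ K.kBall z := by
  change K.kNorm (z.1 - z.1) ≤ z.2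
  rw [sub_self, K.kNorm_zero]
  exact le_of_lt z.2.2

theorem ballIntegral_sum_tripleBump (s : Finset (UpperHalf n)) (v : UpperHalf n → ℝ)
    (z : UpperHalf n) : K.ballIntegral (fun x => ∑ y ∈ s, v y * tripleBump K y x) z =
      ∑ y ∈ s, v y * K.ballIntegral (tripleBump K y) z := by
  unfold SymmConvexBody.ballIntegral
  rw [integral_finsetSum _ fun y _ => ((integrable_tripleBump y).const_mul _).restrict]
  exact Finset.sum_congr rfl fun y _ => integral_const_mul _ _

/-- A function in `C_c` is dominated by the ball integrals of a function `g` on `ℝⁿ` whose integral is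
controlled by the `S¹`-norm: the local ratio weights of a fine finite net, spread over dilated
balls, dominate on the net, and a small multiple of a positive weight absorbs the oscillation. -/
theorem exists_dominating_ballIntegral {f : UpperHalf n → 𝕜} (hc : Continuous f)
    (hs : HasCompactSupport f) (hfin : sENorm K f ≠ ⊤) (hpos : 0 < (sENorm K f).toReal) :
    ∃ g : EuclideanSpace ℝ (Fin n) → ℝ, Integrable g ∧ (∀ y, 0 < g y) ∧
      ∫ y, g y ≤ (6 ^ n + 1) * (sENorm K f).toReal ∧ ∀ z, ‖f z‖ ≤ K.ballIntegral g z := by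
  classical
  set M : ℝ := (sENorm K f).toReal with hM
  set O := tsupport f with hO
  have hOc : IsCompact O := hs
  have hOne : O.Nonempty := by
    rw [Set.nonempty_iff_ne_empty]
    intro h
    have hf0 : f = 0 := tsupport_eq_empty_iff.1 h
    simp [hM, hf0, sENorm] at hpos
  obtain ⟨z₀, hz₀, hmin⟩ := hOc.exists_isMinOn hOne
    (SymmConvexBody.continuous_height (n := n)).continuousOn
  obtain ⟨z₁, hz₁, hmin₁⟩ := hOc.exists_isMinOn hOne
    (K.continuous_ballIntegral (integrable_decayWeight (n := n))).continuousOn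
  have hI : 0 < ∫ y, decayWeight n y :=
    integral_pos_of_forall_pos integrable_decayWeight decayWeight_pos
  set δ : ℝ := M / ∫ y, decayWeight n y with hδ
  have hδ0 : 0 < δ := div_pos hpos hI
  set ε : ℝ := δ * K.ballIntegral (decayWeight n) z₁ with hε
  have hε0 : 0 < ε := mul_pos hδ0 (K.ballIntegral_pos integrable_decayWeight decayWeight_pos z₁)
  -- a finite net of the support, fine compared with its distance to the boundary
  let U : UpperHalf n → Set (UpperHalf n) := fun w =>
    {z | K.kNorm (z.1 - w.1) + |(z.2 : ℝ) - w.2| < (z₀.2 : ℝ) / 2 ∧ ‖f z - f w‖ < ε}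
  have hU : ∀ w ∈ O, U w ∈ 𝓝 w := by
    intro w _
    have c1 : Continuous fun z : UpperHalf n => K.kNorm (z.1 - w.1) + |(z.2 : ℝ) - w.2| :=
      (K.continuous_kNorm.comp (continuous_fst.sub continuous_const)).add
        (SymmConvexBody.continuous_height.sub continuous_const).abs
    have c2 : Continuous fun z : UpperHalf n => ‖f z - f w‖ := (hc.sub continuous_const).norm
    refine ((isOpen_lt c1 continuous_const).inter (isOpen_lt c2 continuous_const)).mem_nhds
      ⟨?_, ?_⟩
    · change K.kNorm (w.1 - w.1) + |(w.2 : ℝ) - w.2| < (z₀.2 : ℝ) / 2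
      rw [sub_self, sub_self, abs_zero, K.kNorm_zero, add_zero]
      exact half_pos z₀.2.2
    · change ‖f w - f w‖ < ε
      rwa [sub_self, norm_zero]
  obtain ⟨s, hsO, hcov⟩ := hOc.elim_nhds_subcover U hU
  obtain ⟨v, hv0, hvM, hvw⟩ := exists_local_ratio (fun z : UpperHalf n => (z.2 : ℝ))
    (meet := fun y z => (K.kBall y ∩ K.kBall z).Nonempty)
    (fun z => ⟨z.1, mem_kBall_center z, mem_kBall_center z⟩)
    (fun y z h => by rwa [Set.inter_comm]) s (fun z => ‖f z‖) M (fun z _ => norm_nonneg _)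
    (fun T _ hT => sum_norm_le_sENorm hfin fun x hx y hy hxy =>
      Set.disjoint_iff_inter_eq_empty.2 (Set.not_nonempty_iff_eq_empty.1 (hT hx hy hxy)))
  let g₁ : EuclideanSpace ℝ (Fin n) → ℝ := fun x => ∑ y ∈ s, v y * tripleBump K y x
  have hg₁0 : ∀ x, 0 ≤ g₁ x := fun x =>
    Finset.sum_nonneg fun y hy => mul_nonneg (hv0 y hy) (tripleBump_nonneg y x)
  have hg₁i : Integrable g₁ :=
    integrable_finsetSum _ fun y _ => (integrable_tripleBump y).const_mul _
  have hδi : Integrable fun x => δ * decayWeight n x := integrable_decayWeight.const_mul δ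
  have hsplit : ∀ z, K.ballIntegral (fun x => g₁ x + δ * decayWeight n x) z =
      K.ballIntegral g₁ z + δ * K.ballIntegral (decayWeight n) z := fun z => by
    unfold SymmConvexBody.ballIntegral
    rw [integral_add hg₁i.restrict hδi.restrict, integral_const_mul]
  refine ⟨fun x => g₁ x + δ * decayWeight n x, hg₁i.add hδi,
    fun y => add_pos_of_nonneg_of_pos (hg₁0 y) (mul_pos hδ0 (decayWeight_pos y)), ?_, ?_⟩
  · rw [integral_add hg₁i hδi, integral_const_mul, hδ, div_mul_cancel₀ _ hI.ne',
      integral_finsetSum _ fun y _ => (integrable_tripleBump y).const_mul _]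
    simp only [integral_const_mul, integral_tripleBump]
    rw [← Finset.sum_mul, add_mul, one_mul, mul_comm (6 ^ n : ℝ)]
    have := mul_le_mul_of_nonneg_right hvM (by positivity : (0 : ℝ) ≤ 6 ^ n)
    linarith
  · intro z
    rw [hsplit]
    by_cases hz : z ∈ O
    · obtain ⟨w, hw, hzw⟩ := Set.mem_iUnion₂.1 (hcov hz)
      have h1 : ‖f w‖ ≤ K.ballIntegral g₁ z := by
        refine (hvw w hw).trans ?_
        rw [ballIntegral_sum_tripleBump]
        refine Finset.sum_le_sum fun y hy => ?_
        split_ifs with h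
        · refine le_mul_of_one_le_right (hv0 y hy) (one_le_ballIntegral_tripleBump h.2 h.1 ?_)
          have h0 : (z₀.2 : ℝ) ≤ y.2 := hmin (hsO y hy)
          linarith [hzw.1]
        · exact mul_nonneg (hv0 y hy) (K.ballIntegral_nonneg (tripleBump_nonneg y) z)
      have h2 : ε ≤ δ * K.ballIntegral (decayWeight n) z :=
        mul_le_mul_of_nonneg_left (hmin₁ hz) hδ0.le
      have h3 : ‖f z‖ ≤ ‖f w‖ + ‖f z - f w‖ := norm_le_insert' _ _
      linarith [hzw.2]
    · rw [image_eq_zero_of_notMem_tsupport hz, norm_zero]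
      exact add_nonneg (K.ballIntegral_nonneg hg₁0 z)
        (mul_nonneg hδ0.le (K.ballIntegral_nonneg (fun y => (decayWeight_pos y).le) z))

/-! ### Atomic decompositions in `S¹₀(K)` -/

theorem sENorm_le_one_of_isCcAtom {F : UpperHalf n → 𝕜} (hF : IsCcAtom K F) : sENorm K F ≤ 1 := by
  obtain ⟨a, g, ha, hg, hF⟩ := hF
  refine iSup₂_le fun C hC => ?_
  calc ∑ z ∈ C, ‖F z‖ₑ ≤ ∑ z ∈ C, ∫⁻ y in K.kBall z, ‖g y‖ₑ := by
        refine Finset.sum_le_sum fun z _ => ?_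
        rw [hF z, atomFun, enorm_mul]
        refine (mul_le_of_le_one_left zero_le ?_).trans (K.enorm_ballIntegral_le g z)
        rw [← ofReal_norm, ENNReal.ofReal_le_one]
        exact ha z
    _ = ∫⁻ y in ⋃ z ∈ C, K.kBall z, ‖g y‖ₑ :=
        (lintegral_biUnion_finset hC (fun z _ => K.measurableSet_kBall z) _).symm
    _ ≤ ∫⁻ y, ‖g y‖ₑ := setLIntegral_le_lintegral _ _
    _ = 1 := hg.lintegral_enorm

theorem IsCcAtom.hasCompactSupport {F : UpperHalf n → 𝕜} (hF : IsCcAtom K F) :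
    HasCompactSupport F := by
  obtain ⟨a, g, -, -, hF⟩ := hF
  have : F = fun z => a z * ∫ y in K.kBall z, g y := funext hF
  rw [this]
  exact a.2.mul_right

/-- An `S`-atom as an element of `S¹₀(K)`. -/
noncomputable def S0Space.ofAtom (F : C(UpperHalf n, 𝕜)) (hF : IsCcAtom K F) : S0Space 𝕜 K :=
  ⟨⟨F, (sENorm_le_one_of_isCcAtom hF).trans_lt ENNReal.one_lt_top⟩,
    subset_closure hF.hasCompactSupport⟩

theorem S0Space.norm_le_one_of_isCcAtom {f : S0Space 𝕜 K} (hf : IsCcAtom K f.1.toFun) :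
    ‖f‖ ≤ 1 :=
  ENNReal.toReal_mono ENNReal.one_ne_top (sENorm_le_one_of_isCcAtom hf)

/-- Every element of `C_c` is a single multiple of an `S`-atom: divide by the dominating ball
integral. -/
theorem S0Space.exists_smul_atom {f : S0Space 𝕜 K} (hf : HasCompactSupport f.1.toFun) :
    ∃ (c : 𝕜) (F : S0Space 𝕜 K), IsCcAtom K F.1.toFun ∧ f = c • F ∧
      ‖c‖ ≤ (6 ^ n + 1) * ‖f‖ := by
  rcases (norm_nonneg f).eq_or_lt with h0 | hpos
  · obtain ⟨g, hg⟩ := exists_hasL1NormOne (𝕜 := 𝕜) (n := n)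
    have hF : IsCcAtom K (0 : C(UpperHalf n, 𝕜)) :=
      ⟨0, g, fun z => by simp, hg, fun z => by simp [atomFun]⟩
    refine ⟨0, S0Space.ofAtom 0 hF, hF, ?_, ?_⟩
    · rw [zero_smul]
      exact norm_eq_zero.1 h0.symm
    · rw [norm_zero]
      exact mul_nonneg (by positivity) (norm_nonneg f)
  · obtain ⟨g, hgi, hg0, hgM, hfg⟩ := exists_dominating_ballIntegral (K := K)
      f.1.toFun.continuous hf (Subtype.prop f.1).ne hpos
    have hPpos := K.ballIntegral_pos hgi hg0
    have hPc : Continuous fun z => ((K.ballIntegral g z : ℝ) : 𝕜) :=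
      RCLike.continuous_ofReal.comp (K.continuous_ballIntegral hgi)
    have hPne : ∀ z, ((K.ballIntegral g z : ℝ) : 𝕜) ≠ 0 := fun z => by
      exact_mod_cast (hPpos z).ne'
    set G : ℝ := ∫ y, g y with hG
    have hGpos : 0 < G := integral_pos_of_forall_pos hgi hg0
    have hGne : (G : 𝕜) ≠ 0 := by exact_mod_cast hGpos.ne'
    let a : C_c(UpperHalf n, 𝕜) :=
      ⟨⟨fun z => f.1.toFun z / ((K.ballIntegral g z : ℝ) : 𝕜),
        f.1.toFun.continuous.div hPc hPne⟩, by
        change HasCompactSupport fun z => f.1.toFun z / ((K.ballIntegral g z : ℝ) : 𝕜)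
        simp only [div_eq_mul_inv]
        exact hf.mul_right⟩
    have haz : ∀ z, a z = f.1.toFun z / ((K.ballIntegral g z : ℝ) : 𝕜) := fun z => rfl
    let g' : EuclideanSpace ℝ (Fin n) → 𝕜 := fun y => ((G⁻¹ * g y : ℝ) : 𝕜)
    have hg' : HasL1NormOne g' := by
      refine ⟨(hgi.const_mul _).ofReal, ?_⟩
      have : ∀ y, ‖g' y‖ = G⁻¹ * g y := fun y => by
        rw [RCLike.norm_ofReal, abs_of_pos (mul_pos (inv_pos.2 hGpos) (hg0 y))]
      simp only [this]
      rw [integral_const_mul, inv_mul_cancel₀ hGpos.ne']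
    have hval : ∀ z, (G : 𝕜)⁻¹ * f.1.toFun z = atomFun K a g' z := fun z => by
      have h1 : ∫ y in K.kBall z, g' y = (G : 𝕜)⁻¹ * ((K.ballIntegral g z : ℝ) : 𝕜) := by
        refine (K.ballIntegral_ofReal (𝕜 := 𝕜) (fun y => G⁻¹ * g y) z).trans ?_
        rw [← RCLike.ofReal_inv, ← RCLike.ofReal_mul]
        congr 1
        exact integral_const_mul _ _
      rw [atomFun, h1, haz, mul_left_comm, div_mul_cancel₀ _ (hPne z)]
    have hF : IsCcAtom K ((G : 𝕜)⁻¹ • f).1.toFun := by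
      refine ⟨a, g', fun z => ?_, hg', hval⟩
      rw [haz, norm_div, RCLike.norm_ofReal, abs_of_pos (hPpos z)]
      exact (div_le_one (hPpos z)).2 (hfg z)
    refine ⟨(G : 𝕜), (G : 𝕜)⁻¹ • f, hF, ?_, ?_⟩
    · rw [smul_smul, mul_inv_cancel₀ hGne, one_smul]
    · rw [RCLike.norm_ofReal, abs_of_pos hGpos]
      exact hgM

theorem S0Space.exists_atomic_decomposition (f : S0Space 𝕜 K) :
    ∃ (lam : ℕ → 𝕜) (F : ℕ → S0Space 𝕜 K),
      (∀ i, IsCcAtom K (F i).1.toFun) ∧ Summable (fun i => ‖lam i‖) ∧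
      HasSum (fun i => lam i • F i) f ∧
      ∑' i, ‖lam i‖ ≤ 2 * ((6 ^ n + 1) * (3 / 2)) * ‖f‖ := by
  refine exists_hasSum_of_approx (A := {F : S0Space 𝕜 K | IsCcAtom K F.1.toFun})
    (fun F hF => S0Space.norm_le_one_of_isCcAtom hF) (fun u => ?_) f
  obtain ⟨w, hw, huw⟩ : ∃ w : S0Space 𝕜 K, HasCompactSupport w.1.toFun ∧ ‖u - w‖ ≤ ‖u‖ / 2 := by
    rcases eq_or_ne u 0 with rfl | hu
    · exact ⟨0, (sCc 𝕜 K).zero_mem, by simp⟩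
    · obtain ⟨w, hw, huw⟩ := Metric.mem_closure_iff.1 u.2 (‖u‖ / 2) (half_pos (norm_pos_iff.2 hu))
      refine ⟨⟨w, subset_closure hw⟩, hw, ?_⟩
      rw [dist_eq_norm] at huw
      exact huw.le
  obtain ⟨c, F, hF, hwF, hcw⟩ := S0Space.exists_smul_atom hw
  refine ⟨0, fun _ => c, fun _ => F, fun _ => hF, ?_, ?_⟩
  · rw [Finset.sum_const, Finset.card_univ, Fintype.card_fin, zero_add, one_smul, mul_assoc]
    refine hcw.trans (mul_le_mul_of_nonneg_left ?_ (by positivity))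
    have h1 : ‖w‖ ≤ ‖u‖ + ‖u - w‖ := norm_le_insert u w
    linarith
  · rw [Finset.sum_const, Finset.card_univ, Fintype.card_fin, zero_add, one_smul, ← hwF]
    exact huw

end TentDuality

/-! ### Duality and atomic decompositions of `U^{p'}(K)` and `S¹₀(K)` -/

theorem theorem2p5 (𝕜 : Type*) [RCLike 𝕜] (n : ℕ) (hn : 1 ≤ n) :
    ∃ C : ℝ, 0 < C ∧ ∀ K : SymmConvexBody n,
      -- the spaces `T^p(K)` and `U^{p'}(K)`
      (∀ (p : ℝ≥0∞) [Fact (1 ≤ p)], 1 < p → p ≠ ⊤ →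
        -- `U^{p'}(K)` is a Banach space with dual `T^p(K)`, via the integral pairing
        CompleteSpace (USpace 𝕜 K p) ∧
        (∃ Φ : TentSpace 𝕜 K p ≃ₗᵢ[𝕜] StrongDual 𝕜 (USpace 𝕜 K p),
          ∀ (g : TentSpace 𝕜 K p) (u : USpace 𝕜 K p),
            Integrable (fun z => u.1.toFun z * g.toFun z) volume ∧
            Φ g u = ∫ z, u.1.toFun z * g.toFun z) ∧
        -- a function in `L^{p'}_loc` lies in `U^{p'}(K)` if and only if it has an
        -- atomic decomposition
        (∀ f : UpperHalf n →ₘ[volume] 𝕜, MemLpLoc f p.conjExponent →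
          ((∃ u : USpace 𝕜 K p, u.1.toFun = f) ↔
            ∃ (lam : ℕ → 𝕜) (F : ℕ → UpperHalf n → 𝕜),
              (∀ i, IsLqAtom K p.conjExponent (F i)) ∧ Summable (fun i => ‖lam i‖) ∧
              TendstoLpLoc p.conjExponent
                (fun N z => ∑ i ∈ Finset.range N, lam i * F i z) f)) ∧
        -- each atom lies in `U^{p'}(K)`
        (∀ F : UpperHalf n → 𝕜, IsLqAtom K p.conjExponent F →
          ∃ u : USpace 𝕜 K p, u.1.toFun =ᵐ[volume] F) ∧
        -- each `u` has a decomposition that converges in norm and in `L^{p'}_loc`,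
        -- with `∑ |λ_i| ≤ C ‖u‖`
        (∀ u : USpace 𝕜 K p, ∃ (lam : ℕ → 𝕜) (F : ℕ → USpace 𝕜 K p),
          (∀ i, IsLqAtom K p.conjExponent (F i).1.toFun) ∧ Summable (fun i => ‖lam i‖) ∧
          HasSum (fun i => lam i • F i) u ∧
          TendstoLpLoc p.conjExponent
            (fun N z => ∑ i ∈ Finset.range N, lam i * (F i).1.toFun z) u.1.toFun ∧
          ∑' i, ‖lam i‖ ≤ C * ‖u‖) ∧
        -- `‖u‖ ≤ C ∑ |λ_i|` for every decomposition
        (∀ (u : USpace 𝕜 K p) (lam : ℕ → 𝕜) (F : ℕ → USpace 𝕜 K p),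
          (∀ i, IsLqAtom K p.conjExponent (F i).1.toFun) → Summable (fun i => ‖lam i‖) →
          HasSum (fun i => lam i • F i) u → ‖u‖ ≤ C * ∑' i, ‖lam i‖)) ∧
      -- the space `S¹₀(K)`
      (∀ F : C(UpperHalf n, 𝕜), IsCcAtom K F → ∃ f : S0Space 𝕜 K, f.1.toFun = F) ∧
      (∀ f : S0Space 𝕜 K, ∃ (lam : ℕ → 𝕜) (F : ℕ → S0Space 𝕜 K),
        (∀ i, IsCcAtom K (F i).1.toFun) ∧ Summable (fun i => ‖lam i‖) ∧
        HasSum (fun i => lam i • F i) f ∧ ∑' i, ‖lam i‖ ≤ C * ‖f‖) ∧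
      (∀ (f : S0Space 𝕜 K) (lam : ℕ → 𝕜) (F : ℕ → S0Space 𝕜 K),
        (∀ i, IsCcAtom K (F i).1.toFun) → Summable (fun i => ‖lam i‖) →
        HasSum (fun i => lam i • F i) f → ‖f‖ ≤ C * ∑' i, ‖lam i‖) := by
  have h6 : (1 : ℝ) ≤ 6 ^ n := one_le_pow₀ (by norm_num)
  have hC1 : (1 : ℝ) ≤ 3 * (6 ^ n + 1) := by linarith
  have hup : ∀ {x : ℝ} {lam : ℕ → 𝕜}, x ≤ ∑' i, ‖lam i‖ →
      x ≤ 3 * (6 ^ n + 1) * ∑' i, ‖lam i‖ := fun h =>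
    h.trans (le_mul_of_one_le_left (tsum_nonneg fun _ => norm_nonneg _) hC1)
  refine ⟨3 * (6 ^ n + 1), by positivity, fun K => ⟨?_, ?_, ?_, ?_⟩⟩
  · intro p _ hp1 hp
    have hdec : ∀ u : USpace 𝕜 K p, ∃ (lam : ℕ → 𝕜) (F : ℕ → USpace 𝕜 K p),
        (∀ i, IsLqAtom K p.conjExponent (F i).1.toFun) ∧ Summable (fun i => ‖lam i‖) ∧
        HasSum (fun i => lam i • F i) u ∧
        TendstoLpLoc p.conjExponent
          (fun N z => ∑ i ∈ Finset.range N, lam i * (F i).1.toFun z) u.1.toFun ∧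
        ∑' i, ‖lam i‖ ≤ 3 * (6 ^ n + 1) * ‖u‖ := by
      intro u
      obtain ⟨lam, F, hF, hlam, hsum, hle⟩ := USpace.exists_atomic_decomposition hp1 hp u
      refine ⟨lam, F, hF, hlam, hsum, USpace.tendstoLpLoc_of_hasSum hp1 hp hsum, hle.trans ?_⟩
      exact mul_le_mul_of_nonneg_right (by linarith) (norm_nonneg u)
    refine ⟨USpace.completeSpace hp1 hp, ⟨TentSpace.dualEquiv hp1 hp, fun g u =>
      ⟨USpace.integrable_mul u g, rfl⟩⟩, fun f _ => ⟨?_, ?_⟩, fun F hF => ?_, hdec, ?_⟩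
    · rintro ⟨u, rfl⟩
      obtain ⟨lam, F, hF, hlam, -, hloc, -⟩ := hdec u
      exact ⟨lam, fun i => (F i).1.toFun, hF, hlam, hloc⟩
    · rintro ⟨lam, F, hF, hlam, hf⟩
      exact exists_USpace_of_atomic_series hp1 hp hF hlam hf
    · obtain ⟨u, hu, -⟩ := hF.exists_USpace hp1 hp
      exact ⟨u, hu⟩
    · intro u lam F hF hlam hsum
      exact hup (norm_le_tsum_of_hasSum
        (fun i => USpace.norm_le_one_of_isLqAtom hp1 hp (hF i)) hlam hsum)
  · intro F hF
    exact ⟨S0Space.ofAtom F hF, rfl⟩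
  · intro f
    obtain ⟨lam, F, hF, hlam, hsum, hle⟩ := S0Space.exists_atomic_decomposition f
    exact ⟨lam, F, hF, hlam, hsum, hle.trans_eq (by ring)⟩
  · intro f lam F hF hlam hsum
    exact hup (norm_le_tsum_of_hasSum
      (fun i => S0Space.norm_le_one_of_isCcAtom (hF i)) hlam hsum)
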